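/- Let $M$ be a smooth $5$-dimensional manifold and $D$ a smooth rank $2$ distribution on $M$; put $D^1=D$ and $D^{l}=D^{l-1}+[D,D^{l-1}]$, and assume that $(\dim D(x),\dim D^2(x),\dim D^3(x))=(2,3,5)$ for every $x\in M$. Let $\varsigma$ be the Liouville form and $\sigma=d\varsigma$ the symplectic form on $T^*M$, let $(D^2)^\perp\subset T^*M$ be the annihilator of $D^2$, and let $\pi$ denote the projections of $T^*M$ and of the $6$-dimensional manifold $\mathbb P(D^2)^\perp$ to $M$. The kernels of $\sigma|_{(D^2)^\perp}$ off the zero section are lines; they induce a line distribution $\mathcal C$ on $\mathbb P(D^2)^\perp$, whose integral curves are the abnormal extremals. The equation $\varsigma=0$ induces a corank $1$ distribution $\Delta$ on $\mathbb P(D^2)^\perp$, and $V_\lambda$ denotes the tangent line at $\lambda$ to the fiber of $\mathbb P(D^2)^\perp$. Fix $q\in M$. For $\lambda\in\mathbb P(D^2)^\perp$ over $q$, let $\gamma$ be a segment of the abnormal extremal through $\lambda$, let $\phi:O\to N$ be the projection of a neighborhood $O$ of $\gamma$ to its ($5$-dimensional) space of abnormal extremals, and put $\widetilde\Delta(\gamma)=\phi_*\Delta\subset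 T_\gamma N$ (of dimension $4$) and $\mathcal E_\gamma(\bar\lambda)=\phi_*V_{\bar\lambda}\subset\widetilde\Delta(\gamma)$ for $\bar\lambda\in\gamma$. Let $L_\lambda$ be the curve in the projective plane $\mathbb P(\widetilde\Delta(\gamma)/\mathcal E_\gamma(\lambda))$ formed by the images of $\mathcal E_\gamma(\bar\lambda)$, $\bar\lambda\in\gamma\setminus\{\lambda\}$, extended smoothly to $\bar\lambda=\lambda$. Let the osculating cone of $L_\lambda$ at $\lambda$ be the zero set in $\widetilde\Delta(\gamma)/\mathcal E_\gamma(\lambda)$ of a nonzero quadratic form whose quadric has contact of order four with $L_\lambda$ at $\lambda$ (that is, the form vanishes to order at least $5$ along a smooth nowhere zero representative of $L_\lambda$). Under the natural identification $\widetilde\Delta(\gamma)/\mathcal E_\gamma(\lambda)\cong\lambda^\perp/\pi_*\mathcal C_\lambda$, where $\lambda^\perp\subset T_qM$ is the kernel of $\lambda$, let $\mathrm{Con}(\lambda)\subset\lambda^\perp$ be the preimage of this cone, and put $\Xi_q=\bigcup_\lambda \mathrm{Con}(\lambda)$, the union over the fiber of $\mathbb P(D^2)^\perp$ over $q$. Then: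 1. The cone $\mathrm{Con}(\lambda)$ exists and is unique for every $\lambda$ in this fiber (it does not depend on the choices made). 2. $\Xi_q$ is a quadratic cone of signature $(3,2)$: it is the zero set in $T_qM$ of a quadratic form of signature $(3,2)$. 3. Let $X_1,\dots,X_5$ be an adapted frame of $D$ near $q$, i.e. smooth vector fields such that $X_1,X_2$ span $D$, $X_3\equiv[X_1,X_2]$ mod $D$, $X_4\equiv[X_1,X_3]$ and $X_5\equiv[X_2,X_3]$ mod $D^2$. Let $u_i(\mu)=\langle\mu,X_i\rangle$, let $\vec u_i$ be the Hamiltonian field of $u_i$ (with $\sigma(\vec u_i,\cdot)=-du_i$), $\vec h=u_4\vec u_2-u_5\vec u_1$, $\epsilon_1=\frac1{u_5}\partial_{u_4}$, and let $\vec e$ be the Euler field. There are linear forms $l_1,l_2$ and quadratic forms $Q,\mathcal B_2$ in $(u_4,u_5)$ such that at all points of $(D^2)^\perp$ over $q$ with $u_5\ne0$, modulo $\mathbb R\,\pi_*\vec h$, $$\pi_*[\vec h,\epsilon_1]\equiv-\tfrac1{u_5}X_2,\qquad \pi_*(\mathrm{ad}\,\vec h)^2\epsilon_1\equiv\tfrac{l_1}{u_5}X_2+X_3,\qquad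 \pi_*(\mathrm{ad}\,\vec h)^3\epsilon_1\equiv\tfrac{Q}{u_5}X_2+l_2X_3+u_4X_5-u_5X_4,$$ and $(\mathrm{ad}\,\vec h)^4\epsilon_1\equiv\mathcal B_2(\mathrm{ad}\,\vec h)^2\epsilon_1+b_1[\vec h,\epsilon_1]+b_0\epsilon_1$ modulo $\mathrm{span}\{\vec h,\vec e\}$ for some numbers $b_0,b_1$; and the vector $\sum_i x_iX_i(q)$ lies in $\Xi_q$ if and only if $$x_1x_5-x_2x_4+\tfrac23\Bigl(x_3-l_2(x_5,-x_4)-\tfrac34l_1(x_5,-x_4)\Bigr)^2-\Bigl(\tfrac7{10}\mathcal B_2(x_5,-x_4)+Q(x_5,-x_4)+\tfrac38\,l_1(x_5,-x_4)^2\Bigr)=0.$$ -/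

import Mathlib

open scoped Manifold ContDiff Topology
open Set

namespace TwoFive

/-- The model space of `M`; also used as coordinate space for the five dimensional leaf space. -/
abbrev E5 : Type := EuclideanSpace ℝ (Fin 5)

/-- The cotangent bundle of the model space: pairs (base point, covector). -/
abbrev Phase : Type := E5 × (E5 →L[ℝ] ℝ)

section Distributions

variable {M : Type*} [TopologicalSpace M] [ChartedSpace E5 M] [IsManifold (𝓡 5) ∞ M]

/-- A field of subspaces of the tangent spaces of a 5-dimensional manifold. -/
abbrev SubspaceField (M : Type*) [TopologicalSpace M] [ChartedSpace E5 M] : Type _ :=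
  ∀ x : M, Submodule ℝ (TangentSpace (𝓡 5) x)

/-- A vector field (not necessarily continuous). -/
abbrev VField (M : Type*) [TopologicalSpace M] [ChartedSpace E5 M] : Type _ :=
  ∀ x : M, TangentSpace (𝓡 5) x

/-- `X` is a smooth vector field on `U`. -/
def SmoothFieldOn (X : VField M) (U : Set M) : Prop :=
  ContMDiffOn (𝓡 5) (𝓡 5).tangent ∞
    (fun x => (⟨x, X x⟩ : TangentBundle (𝓡 5) M)) U

/-- `X` is a smooth section of the field of subspaces `F` over `U`. -/
def IsSectionOn (F : SubspaceField M) (X : VField M) (U : Set M) : Prop :=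
  SmoothFieldOn X U ∧ ∀ x ∈ U, X x ∈ F x

/-- `D` is a smooth rank 2 distribution: locally the span of two pointwise linearly
independent smooth vector fields. -/
def IsRankTwoDistribution (D : SubspaceField M) : Prop :=
  ∀ x₀ : M, ∃ U : Set M, IsOpen U ∧ x₀ ∈ U ∧ ∃ X₁ X₂ : VField M,
    SmoothFieldOn X₁ U ∧ SmoothFieldOn X₂ U ∧
    ∀ x ∈ U, LinearIndependent ℝ ![X₁ x, X₂ x] ∧ D x = Submodule.span ℝ {X₁ x, X₂ x}

/-- The field `F + [D, F]`, where the brackets are those of local smooth sections. -/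
noncomputable def bracketSum (D F : SubspaceField M) : SubspaceField M := fun x =>
  F x ⊔ Submodule.span ℝ
    {w | ∃ (U : Set M) (X Y : VField M), IsOpen U ∧ x ∈ U ∧ IsSectionOn D X U ∧
      IsSectionOn F Y U ∧ w = VectorField.mlieBracket (𝓡 5) X Y x}

/-- The second power `D² = D + [D, D]`. -/
noncomputable def distSq (D : SubspaceField M) : SubspaceField M := bracketSum D D

/-- The third power `D³ = D² + [D, D²]`. -/
noncomputable def distCube (D : SubspaceField M) : SubspaceField M := bracketSum D (distSq D)

/-- The small growth vector is `(2,3,5)` at every point. -/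
def HasGrowth235 (D : SubspaceField M) : Prop :=
  ∀ x : M, Module.finrank ℝ (D x) = 2 ∧ Module.finrank ℝ (distSq D x) = 3 ∧
    Module.finrank ℝ (distCube D x) = 5

/-- The differential at `x` of the preferred chart at `q`. -/
noncomputable def chartDeriv (q x : M) : TangentSpace (𝓡 5) x →L[ℝ] E5 :=
  mfderiv (𝓡 5) 𝓘(ℝ, E5) (extChartAt (𝓡 5) q) x

/-- `(D²)^⊥` without its zero section, over the domain of the preferred chart at `q`, written in
the canonical coordinates of the cotangent bundle induced by this chart. -/
def conormal (D : SubspaceField M) (q : M) : Set Phase :=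
  {μ | μ.1 ∈ (extChartAt (𝓡 5) q).target ∧ μ.2 ≠ 0 ∧
    ∀ v ∈ distSq D ((extChartAt (𝓡 5) q).symm μ.1),
      μ.2 (chartDeriv q ((extChartAt (𝓡 5) q).symm μ.1) v) = 0}

end Distributions

/-! Geometry of a submanifold `S` of the cotangent bundle. -/

section Phase

/-- The tangent space at `μ` to a submanifold `S`: the velocities of the curves in `S`. -/
def tangentTo (S : Set Phase) (μ : Phase) : Submodule ℝ Phase :=
  Submodule.span ℝ {w | ∃ c : ℝ → Phase, c 0 = μ ∧ HasDerivAt c w 0 ∧ ∀ᶠ t in 𝓝 0, c t ∈ S}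

/-- The Liouville form `ς` at `μ`. -/
def liouville (μ : Phase) : Phase →ₗ[ℝ] ℝ :=
  (μ.2 : E5 →ₗ[ℝ] ℝ) ∘ₗ LinearMap.fst ℝ E5 (E5 →L[ℝ] ℝ)

/-- The standard symplectic form `σ = dς` (it has constant coefficients). -/
def symp (w w' : Phase) : ℝ := w.2 w'.1 - w'.2 w.1

/-- The kernel of `σ` restricted to the tangent space of `S` at `μ`. -/
def charSpace (S : Set Phase) (μ : Phase) : Submodule ℝ Phase where
  carrier := {w | w ∈ tangentTo S μ ∧ ∀ w' ∈ tangentTo S μ, symp w w' = 0}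
  zero_mem' := ⟨Submodule.zero_mem _, fun w' _ => by simp [symp]⟩
  add_mem' := by
    rintro a b ⟨ha, ha'⟩ ⟨hb, hb'⟩
    refine ⟨Submodule.add_mem _ ha hb, fun w' hw' => ?_⟩
    have h1 := ha' w' hw'
    have h2 := hb' w' hw'
    simp only [symp, Prod.fst_add, Prod.snd_add, _root_.add_apply, map_add] at *
    linarith
  smul_mem' := by
    rintro r a ⟨ha, ha'⟩
    refine ⟨Submodule.smul_mem _ r ha, fun w' hw' => ?_⟩
    have h1 := ha' w' hw'
    simp only [symp, Prod.smul_fst, Prod.smul_snd, _root_.smul_apply, map_smul,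
      smul_eq_mul] at *
    rw [← mul_sub, h1, mul_zero]

/-- The Euler field, generating the homotheties of the fibers. -/
def euler (μ : Phase) : Phase := (0, μ.2)

/-- The tangent space to the fiber of `S` over the base point. -/
def vertSpace (S : Set Phase) (μ : Phase) : Submodule ℝ Phase :=
  tangentTo S μ ⊓ LinearMap.ker (LinearMap.fst ℝ E5 (E5 →L[ℝ] ℝ))

/-- The corank 1 distribution on `S` given by the Pfaffian equation `ς = 0`. -/
def contactSpace (S : Set Phase) (μ : Phase) : Submodule ℝ Phase :=
  tangentTo S μ ⊓ LinearMap.ker (liouville μ)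

/-- The differential of `φ` at `ν`, as a linear map. -/
noncomputable def dMap (φ : Phase → E5) (ν : Phase) : Phase →ₗ[ℝ] E5 :=
  (fderiv ℝ φ ν : Phase →L[ℝ] E5)

/-- `φ` represents, near `μ`, the projection of the projectivization of `S` onto the space of
leaves of its characteristic 1-foliation, this leaf space being described by 5 coordinates:
`φ` is smooth, and at each point of `S` in the neighborhood `O` of `μ` the kernel of the
differential of `φ` on the tangent space of `S` is spanned by the characteristic direction and the
Euler field. (When `S` has dimension 7 and characteristic lines, the differential of `φ` is then
onto, and `φ` is locally the quotient by the foliation on the projectivization.) -/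
def IsLeafProjection (S : Set Phase) (μ : Phase) (O : Set Phase) (φ : Phase → E5) : Prop :=
  IsOpen O ∧ μ ∈ O ∧ ContDiffOn ℝ ∞ φ O ∧
    ∀ ν ∈ O ∩ S, tangentTo S ν ⊓ LinearMap.ker (dMap φ ν) =
      charSpace S ν ⊔ Submodule.span ℝ {euler ν}

/-- `c`, restricted to `(-δ, δ)`, is a parameterized segment of an abnormal extremal
through `μ`. -/
def IsAbnormalExtremal (S : Set Phase) (μ : Phase) (δ : ℝ) (c : ℝ → Phase) : Prop :=
  c 0 = μ ∧ ContDiffOn ℝ ∞ c (Ioo (-δ) δ) ∧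
    ∀ t ∈ Ioo (-δ) δ, c t ∈ S ∧ deriv c t ∈ charSpace S (c t) ∧ deriv c t ≠ 0

/-- The hyperplane `Δ̃(γ)` in the tangent space of the leaf space, computed at the point `μ` of
the leaf `γ`. -/
noncomputable def leafContact (S : Set Phase) (φ : Phase → E5) (μ : Phase) : Submodule ℝ E5 :=
  (contactSpace S μ).map (dMap φ μ)

/-- The line `𝓔_γ(ν)`: the image of the vertical space at `ν` under the differential of the
projection to the leaf space. -/
noncomputable def lineE (S : Set Phase) (φ : Phase → E5) (ν : Phase) : Submodule ℝ E5 :=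
  (vertSpace S ν).map (dMap φ ν)

/-- The line `𝓔_γ(ν)` regarded inside `Δ̃(γ)`. -/
noncomputable def lineIn (S : Set Phase) (φ : Phase → E5) (μ ν : Phase) :
    Submodule ℝ (leafContact S φ μ) :=
  (lineE S φ ν).submoduleOf (leafContact S φ μ)

/-- The three dimensional space `Δ̃(γ) / 𝓔_γ(μ)`. -/
abbrev ReducedSpace (S : Set Phase) (φ : Phase → E5) (μ : Phase) : Type :=
  (leafContact S φ μ) ⧸ (lineIn S φ μ μ)

/-- The point `L_μ(ν)` of the projective plane of `Δ̃(γ) / 𝓔_γ(μ)`: the image of `𝓔_γ(ν)` under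
the canonical projection. -/
noncomputable def reducedLine (S : Set Phase) (φ : Phase → E5) (μ ν : Phase) :
    Submodule ℝ (ReducedSpace S φ μ) :=
  (lineIn S φ μ ν).map (lineIn S φ μ μ).mkQ

/-- `η` is a smooth, nowhere zero curve of vectors which spans the line `L_μ(c t)` for `t ≠ 0`; so
it represents the smooth plane curve `L_μ`, including the value at `t = 0` which is defined by
removing the singularity. -/
def IsRepresentative (S : Set Phase) (φ : Phase → E5) (μ : Phase) (δ : ℝ) (c : ℝ → Phase)
    (η : ℝ → ReducedSpace S φ μ) : Prop :=
  (∀ f : ReducedSpace S φ μ →ₗ[ℝ] ℝ, ContDiffOn ℝ ∞ (fun t => f (η t)) (Ioo (-δ) δ)) ∧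
    (∀ t ∈ Ioo (-δ) δ, η t ≠ 0) ∧
    ∀ t ∈ Ioo (-δ) δ, t ≠ 0 → η t ∈ reducedLine S φ μ (c t)

/-- The nonzero quadratic form `b` defines the osculating quadric, at the parameter `0`, of the
curve in the projective plane with the representative `η`: the quadric has contact of order four
with the curve. -/
def IsOsculatingForm {Y : Type*} [AddCommGroup Y] [Module ℝ Y] (η : ℝ → Y)
    (b : QuadraticForm ℝ Y) : Prop :=
  b ≠ 0 ∧ (fun t => b (η t)) =O[𝓝 0] (fun t : ℝ => t ^ 5)

/-- The preimage, in the space of vectors `v` at the base point annihilated by the covector of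
`μ`, of the cone `b = 0`, under the identification of `Δ̃(γ) / 𝓔_γ(μ)` with the quotient of
`μ^⊥` by the projected characteristic line: the class of `v` corresponds to the class of `dφ(w)`,
where `w` is any vector tangent to `S` at `μ` which projects to `v`. -/
def coneOf (S : Set Phase) (φ : Phase → E5) (μ : Phase)
    (b : QuadraticForm ℝ (ReducedSpace S φ μ)) : Set E5 :=
  {v | ∃ (w : Phase) (hw : w ∈ contactSpace S μ), w.1 = v ∧
    b ((lineIn S φ μ μ).mkQ ⟨dMap φ μ w, Submodule.mem_map_of_mem hw⟩) = 0}

end Phase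

section Cones

variable {M : Type*} [TopologicalSpace M] [ChartedSpace E5 M] [IsManifold (𝓡 5) ∞ M]

/-- The covector at `q` with the coordinates `p`, as a point of the cotangent bundle. -/
noncomputable def covectorAt (q : M) (p : E5 →L[ℝ] ℝ) : Phase := (extChartAt (𝓡 5) q q, p)

/-- `K` is the cone `Con(λ)` in `T_q M`, where `λ` is the point of the fiber of `P(D²)^⊥` over `q`
spanned by the covector `p`: the pull back to `λ^⊥` of the osculating cone at `λ` of the
curve `L_λ`. -/
def IsCon (D : SubspaceField M) (q : M) (p : E5 →L[ℝ] ℝ) (K : Set (TangentSpace (𝓡 5) q)) :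
    Prop :=
  ∃ (O : Set Phase) (φ : Phase → E5) (δ : ℝ) (c : ℝ → Phase)
    (η : ℝ → ReducedSpace (conormal D q) φ (covectorAt q p))
    (b : QuadraticForm ℝ (ReducedSpace (conormal D q) φ (covectorAt q p))),
    IsLeafProjection (conormal D q) (covectorAt q p) O φ ∧
    0 < δ ∧ (∀ t ∈ Ioo (-δ) δ, c t ∈ O) ∧
    IsAbnormalExtremal (conormal D q) (covectorAt q p) δ c ∧
    IsRepresentative (conormal D q) φ (covectorAt q p) δ c η ∧
    IsOsculatingForm η b ∧
    K = {v | chartDeriv q q v ∈ coneOf (conormal D q) φ (covectorAt q p) b}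

/-- The set `Ξ_q`: the union of the cones `Con(λ)` over the fiber of `P(D²)^⊥` over `q`, each point
`λ` of the fiber being given by the nonzero covectors `p` which span it. -/
def Xi (D : SubspaceField M) (q : M) : Set (TangentSpace (𝓡 5) q) :=
  {v | ∃ p : E5 →L[ℝ] ℝ, covectorAt q p ∈ conormal D q ∧ ∃ K, IsCon D q p K ∧ v ∈ K}

/-! Adapted frames and the explicit equation. The fields `X 0, ..., X 4` of a frame stand
for `X₁, ..., X₅`. -/

/-- `X` is an adapted frame of `D` on the open set `U`. -/
def IsAdaptedFrame (D : SubspaceField M) (X : Fin 5 → VField M) (U : Set M) : Prop :=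
  IsOpen U ∧ (∀ i, SmoothFieldOn (X i) U) ∧ ∀ x ∈ U,
    D x = Submodule.span ℝ {X 0 x, X 1 x} ∧
    X 2 x - VectorField.mlieBracket (𝓡 5) (X 0) (X 1) x ∈ D x ∧
    X 3 x - VectorField.mlieBracket (𝓡 5) (X 0) (X 2) x ∈ distSq D x ∧
    X 4 x - VectorField.mlieBracket (𝓡 5) (X 1) (X 2) x ∈ distSq D x

/-- A vector field of `M`, written in the preferred chart at `q`. -/
noncomputable def inChart (q : M) (X : VField M) : E5 → E5 := fun y =>
  chartDeriv q ((extChartAt (𝓡 5) q).symm y) (X ((extChartAt (𝓡 5) q).symm y))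

/-- The Hamiltonian vector field, with respect to `σ`, of the function `(y, p) ↦ p (X y)`. -/
noncomputable def hamLift (X : E5 → E5) : Phase → Phase := fun μ =>
  (X μ.1, -(μ.2.comp (fderiv ℝ X μ.1)))

/-- The quasi-impulse of `X`. -/
noncomputable def impulse (q : M) (X : VField M) (μ : Phase) : ℝ := μ.2 (inChart q X μ.1)

/-- The field `h = u₄ u⃗₂ - u₅ u⃗₁`, which spans the characteristic lines. -/
noncomputable def hField (q : M) (X : Fin 5 → VField M) : Phase → Phase := fun μ =>
  impulse q (X 3) μ • hamLift (inChart q (X 1)) μ -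
    impulse q (X 4) μ • hamLift (inChart q (X 0)) μ

/-- The vertical field `(1/u₅) ∂_{u₄}`; here `θ` is the field of covectors with `θ(X₄) = 1` and
`θ(X_j) = 0` for the other `j`. -/
noncomputable def epsField (q : M) (X : Fin 5 → VField M) (θ : E5 → E5 →L[ℝ] ℝ) :
    Phase → Phase := fun μ => (0, (impulse q (X 4) μ)⁻¹ • θ μ.1)

/-- The field `(ad h)^k ε₁`, with `ε₁ = (1/u₅) ∂_{u₄}`. -/
noncomputable def adEps (q : M) (X : Fin 5 → VField M) (θ : E5 → E5 →L[ℝ] ℝ) (k : ℕ) :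
    Phase → Phase :=
  (fun W => VectorField.lieBracket ℝ (hField q X) W)^[k] (epsField q X θ)

/-- `θ` is, on the part of the chart domain that lies in `U`, the member dual to `X₄` of the
coframe dual to `X`. -/
def IsDualToFourth (q : M) (X : Fin 5 → VField M) (U : Set M) (θ : E5 → E5 →L[ℝ] ℝ) : Prop :=
  ∀ y ∈ (extChartAt (𝓡 5) q).target, (extChartAt (𝓡 5) q).symm y ∈ U →
    ∀ j : Fin 5, θ y (inChart q (X j) y) = if j = 3 then 1 else 0

/-- The functions `l₁, l₂` (linear) and `Q, B₂` (quadratic) of `(u₄, u₅)` are the coefficients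
at `q` in the expansions of the projections of `(ad h)^i ε₁`, `i = 1, 2, 3`, modulo the projection
of `h`, and in the expansion of `(ad h)^4 ε₁` modulo `h` and the Euler field. -/
def IsFrameCoefficients (D : SubspaceField M) (q : M) (X : Fin 5 → VField M)
    (θ : E5 → E5 →L[ℝ] ℝ) (l₁ l₂ : (Fin 2 → ℝ) →ₗ[ℝ] ℝ)
    (Q B₂ : QuadraticForm ℝ (Fin 2 → ℝ)) : Prop :=
  ∀ (p : E5 →L[ℝ] ℝ) (μ : Phase) (u₄ u₅ : ℝ) (Y : Fin 5 → E5),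
    μ = covectorAt q p → μ ∈ conormal D q → u₄ = impulse q (X 3) μ → u₅ = impulse q (X 4) μ →
    (∀ i, Y i = inChart q (X i) μ.1) → u₅ ≠ 0 →
    (adEps q X θ 1 μ).1 - (-(1 / u₅)) • Y 1 ∈ Submodule.span ℝ {(hField q X μ).1} ∧
    (adEps q X θ 2 μ).1 - ((l₁ ![u₄, u₅] / u₅) • Y 1 + Y 2) ∈
      Submodule.span ℝ {(hField q X μ).1} ∧
    (adEps q X θ 3 μ).1 -
        ((Q ![u₄, u₅] / u₅) • Y 1 + l₂ ![u₄, u₅] • Y 2 + u₄ • Y 4 - u₅ • Y 3) ∈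
      Submodule.span ℝ {(hField q X μ).1} ∧
    ∃ b₀ b₁ : ℝ,
      adEps q X θ 4 μ -
          (B₂ ![u₄, u₅] • adEps q X θ 2 μ + b₁ • adEps q X θ 1 μ + b₀ • adEps q X θ 0 μ) ∈
        Submodule.span ℝ {hField q X μ, euler μ}

/-- The left-hand side of the explicit equation of `Ξ_q`, as a function of the coordinates
`x 0, ..., x 4` (standing for `x₁, ..., x₅`). -/
noncomputable def mainForm (l₁ l₂ : (Fin 2 → ℝ) →ₗ[ℝ] ℝ) (Q B₂ : QuadraticForm ℝ (Fin 2 → ℝ))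
    (x : Fin 5 → ℝ) : ℝ :=
  x 0 * x 4 - x 1 * x 3
    + 2 / 3 * (x 2 - l₂ ![x 4, -x 3] - 3 / 4 * l₁ ![x 4, -x 3]) ^ 2
    - (7 / 10 * B₂ ![x 4, -x 3] + Q ![x 4, -x 3] + 3 / 8 * (l₁ ![x 4, -x 3]) ^ 2)

end Cones

end TwoFive

/-! The theorem comes from a fourth order linear differential equation. On `(D²)^⊥`, with fiber
coordinates (u₄, u₅), the field h = u₄u⃗₂ − u₅u⃗₁ spans the kernels of σ. If φ is the projection to
the leaf space, then differentiating dφ(W) along an extremal replaces W by [h, W]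
(`hasDerivAt_fderiv_along`). So the line 𝓔_γ is spanned by a curve G = dφ(ε₁) whose derivatives are
the images of (ad h)^k ε₁. These brackets climb through ε₁, X₂, X₃, u₄X₅ − u₅X₄, and for k ≤ 3 their
images form a basis of Δ̃(γ). Hence the fourth bracket depends on the previous ones modulo h and the
Euler field. The factor 1/u₅ in ε₁ and the Jacobi identity kill its component along the third
(`AdaptedFrame.iterCoef_four_three`), so G'''' = B₂G'' + b₁G' + b₀G.

Modulo G(0), the coordinates of G in the basis G'(0), G''(0), G'''(0) are s, s²/2 + B₂s⁴/24, s³/6 +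
B₂s⁵/120, up to orders 4, 5, 6; the functions b₁, b₀ do not enter. Comparing the coefficients of s²,
…, s⁶ shows that −x₁x₃ + ⅔x₂² − (7/10)B₂x₃² is, up to a factor, the only conic with contact of order
four (`vanishesTo_osculating`, `osculating_unique`). Since the brackets project to T_qM by explicit
formulas in the frame, the cone does not depend on φ, on the segment or on the representative
(`AdaptedFrame.coneOf_eq_frameCone`).

If v = Σ xᵢXᵢ lies in λ^⊥ and X is its coordinate along the third bracket, then (u₄X, u₅X) = (x₅,
−x₄). By homogeneity of l₁, l₂, Q, B₂ the point λ disappears from the equation of the cone, so that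
Con(λ) is the intersection of λ^⊥ with a quadric F = 0 which is the same for all λ
(`AdaptedFrame.mem_frameCone_iff`). Every v lies in some λ^⊥, hence Ξ_q is that quadric
(`AdaptedFrame.mem_union_cones_iff`). The form F is the sum of two hyperbolic planes and a positive
square, of signature (3, 2).

The coordinates require u₅ ≠ 0; the missing point of the fiber is reached by exchanging X₁ and X₂
(`swapFrame`, `AdaptedFrame.frameForm_swap`). Existence of the cone requires a smooth leaf
projection, obtained from first integrals and hence from a flow that is smooth in all variables. In
the code the indices are shifted: `Y 0, …, Y 4` stand for X₁, …, X₅. -/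

namespace TwoFive

/-! ### Smooth dependence of integral curves on time and initial point. -/

section SmoothFlow

/-- The compact time interval on which integral curves are parametrized. -/
abbrev TimeInterval : Type := Icc (-1 : ℝ) 1

variable {E F : Type} [NormedAddCommGroup E] [NormedSpace ℝ E] [NormedAddCommGroup F]
  [NormedSpace ℝ F]

/-- Pointwise application of a curve of operators to a curve of vectors. -/
noncomputable def pointwiseApply (A : C(TimeInterval, E →L[ℝ] F)) :
    C(TimeInterval, E) →L[ℝ] C(TimeInterval, F) :=
  LinearMap.mkContinuous
    { toFun := fun h => (⟨fun t => A t (h t), by fun_prop⟩ : C(TimeInterval, F))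
      map_add' := fun h k => by ext t; simp
      map_smul' := fun c h => by ext t; simp } ‖A‖
    (fun h => (ContinuousMap.norm_le _ (by positivity)).2 fun t =>
      (A t).le_of_opNorm_le_of_le (A.norm_coe_le_norm t) (h.norm_coe_le_norm t))

@[simp] lemma pointwiseApply_apply (A : C(TimeInterval, E →L[ℝ] F)) (h : C(TimeInterval, E))
    (t : TimeInterval) : pointwiseApply A h t = A t (h t) := rfl

lemma contDiff_pointwiseApply {n : WithTop ℕ∞} : ContDiff ℝ n
    (pointwiseApply : C(TimeInterval, E →L[ℝ] F) → C(TimeInterval, E) →L[ℝ] C(TimeInterval, F)) := by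
  refine IsBoundedLinearMap.contDiff (E := C(TimeInterval, E →L[ℝ] F))
    (F := C(TimeInterval, E) →L[ℝ] C(TimeInterval, F)) ?_
  refine IsLinearMap.with_bound ⟨fun A B => by ext h t; simp, fun c A => by ext h t; simp⟩ 1
    fun A => ?_
  rw [one_mul]
  exact LinearMap.mkContinuous_norm_le _ (norm_nonneg A) _

/-- The derivative `f'` is uniformly continuous near the compact range of `α`, so the mean value
inequality bounds the remainder by `ε` times the sup norm at all times simultaneously. -/
lemma hasFDerivAt_superposition (f : C(E, F)) (f' : C(E, E →L[ℝ] F))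
    (hf : ∀ x, HasFDerivAt f (f' x) x) (α : C(TimeInterval, E)) :
    HasFDerivAt (fun β : C(TimeInterval, E) => f.comp β) (pointwiseApply (f'.comp α)) α := by
  rw [hasFDerivAt_iff_isLittleO, Asymptotics.isLittleO_iff]
  intro ε hε
  have hK : IsCompact (range α) := isCompact_range α.continuous
  have h1 := hK.uniformContinuousAt_of_continuousAt f' (fun a _ => f'.continuous.continuousAt)
    (Metric.dist_mem_uniformity hε)
  obtain ⟨δ, hδ, h2⟩ := Metric.mem_uniformity_dist.1 h1
  filter_upwards [Metric.ball_mem_nhds α hδ] with β hβ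
  refine (ContinuousMap.norm_le _ (by positivity)).2 fun t => ?_
  have h3 : dist (β t) (α t) < δ := (ContinuousMap.dist_apply_le_dist t).trans_lt hβ
  have h4 := (convex_ball (α t) δ).norm_image_sub_le_of_norm_hasFDerivWithin_le' (f := f)
    (f' := f') (φ := f' (α t)) (C := ε) (x := α t) (y := β t)
    (fun x _ => (hf x).hasFDerivWithinAt)
    (fun x hx => by
      have := h2 (a := α t) (b := x) (by rwa [dist_comm]) (mem_range_self t)
      rw [← dist_eq_norm, dist_comm]
      exact le_of_lt this) (Metric.mem_ball_self hδ) h3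
  refine h4.trans (mul_le_mul_of_nonneg_left ?_ hε.le)
  exact (β - α).norm_coe_le_norm t

/-- The derivative of the superposition by `f` is the superposition by `f'` followed by the bounded
linear map `pointwiseApply`. The target varies in the induction because `f'` is operator valued. -/
lemma contDiff_superposition_nat (n : ℕ) : ∀ {F : Type} [NormedAddCommGroup F]
    [NormedSpace ℝ F] (f : C(E, F)), ContDiff ℝ n f →
    ContDiff ℝ n (fun β : C(TimeInterval, E) => f.comp β) := by
  induction n with
  | zero =>
    intro F _ _ f _
    exact contDiff_zero.2 (ContinuousMap.continuous_postcomp f)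
  | succ n ih =>
    intro F _ _ f hf
    push_cast at hf ⊢
    obtain ⟨f', hf', hd⟩ := contDiff_succ_iff_hasFDerivAt.1 hf
    refine contDiff_succ_iff_hasFDerivAt.2 ⟨_, ?_, fun α =>
      hasFDerivAt_superposition f ⟨f', hf'.continuous⟩ hd α⟩
    exact (contDiff_pointwiseApply (E := E) (F := F)).comp (ih ⟨f', hf'.continuous⟩ hf')

lemma contDiff_superposition (f : C(E, F)) (hf : ContDiff ℝ ∞ f) :
    ContDiff ℝ ∞ (fun β : C(TimeInterval, E) => f.comp β) :=
  contDiff_infty.2 fun n => contDiff_superposition_nat n f (contDiff_infty.1 hf n)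

/-- The primitive vanishing at time `0`. -/
noncomputable def primitive : C(TimeInterval, E) →L[ℝ] C(TimeInterval, E) :=
  LinearMap.mkContinuous
    { toFun := fun β => ⟨fun t => ∫ r in (0 : ℝ)..t, IccExtend (by norm_num) β r, by
        have : Continuous fun t : ℝ => ∫ r in (0 : ℝ)..t,
            IccExtend (by norm_num : (-1 : ℝ) ≤ 1) β r :=
          intervalIntegral.continuous_primitive
            (fun a b => (β.continuous.Icc_extend'.intervalIntegrable a b)) 0
        exact this.comp continuous_subtype_val⟩
      map_add' := fun β γ => by
        ext t
        simp only [ContinuousMap.coe_mk, ContinuousMap.add_apply]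
        rw [← intervalIntegral.integral_add (β.continuous.Icc_extend'.intervalIntegrable _ _)
          (γ.continuous.Icc_extend'.intervalIntegrable _ _)]
        rfl
      map_smul' := fun c β => by
        ext t
        simp only [ContinuousMap.coe_mk, ContinuousMap.smul_apply, RingHom.id_apply]
        rw [← intervalIntegral.integral_smul]
        rfl } 1
    (fun β => by
      rw [one_mul]
      refine (ContinuousMap.norm_le _ (norm_nonneg _)).2 fun t => ?_
      have h := intervalIntegral.norm_integral_le_of_norm_le_const (a := 0) (b := (t : ℝ))
        (f := IccExtend (by norm_num : (-1 : ℝ) ≤ 1) β) (C := ‖β‖)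
        (fun r _ => β.norm_coe_le_norm _)
      refine h.trans ?_
      have : |(t : ℝ) - 0| ≤ 1 := by rw [sub_zero]; exact abs_le.2 t.2
      exact mul_le_of_le_one_right (norm_nonneg _) this)

lemma primitive_apply (β : C(TimeInterval, E)) (t : TimeInterval) :
    primitive β t = ∫ r in (0 : ℝ)..t, IccExtend (by norm_num : (-1 : ℝ) ≤ 1) β r := rfl

lemma norm_primitive_le : ‖(primitive : C(TimeInterval, E) →L[ℝ] C(TimeInterval, E))‖ ≤ 1 :=
  LinearMap.mkContinuous_norm_le _ zero_le_one _

/-- The integral operator whose fixed points are the integral curves of `s • f` through `x`. -/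
noncomputable def picardMap (f : C(E, E)) (s : ℝ) (x : E) (α : C(TimeInterval, E)) :
    C(TimeInterval, E) :=
  ContinuousMap.const _ x + s • primitive (f.comp α)

lemma dist_superposition_le (f : C(E, E)) {C : NNReal} (hf : LipschitzWith C f)
    (α β : C(TimeInterval, E)) : dist (f.comp α) (f.comp β) ≤ C * dist α β :=
  (ContinuousMap.dist_le (by positivity)).2 fun t =>
    (hf.dist_le_mul _ _).trans
      (mul_le_mul_of_nonneg_left (ContinuousMap.dist_apply_le_dist t) C.2)

lemma contracting_picardMap [CompleteSpace E] (f : C(E, E)) {C : NNReal} (hf : LipschitzWith C f) {s : ℝ}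
    (hs : |s| * (C : ℝ) < 1) (x : E) : ContractingWith (‖s‖₊ * C) (picardMap f s x) := by
  refine ⟨by exact_mod_cast hs, LipschitzWith.of_dist_le_mul fun α β => ?_⟩
  rw [picardMap, picardMap, dist_add_left, dist_eq_norm, ← smul_sub, norm_smul, ← map_sub]
  have h1 := (primitive (E := E)).le_of_opNorm_le norm_primitive_le (f.comp α - f.comp β)
  rw [one_mul, ← dist_eq_norm (f.comp α)] at h1
  have h2 := h1.trans (dist_superposition_le f hf α β)
  push_cast
  rw [mul_assoc]
  exact mul_le_mul_of_nonneg_left h2 (norm_nonneg _)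

open Classical in
/-- The integral curve of `s • f` through `x`, for small `s`. -/
noncomputable def flowCurve (f : C(E, E)) (z : ℝ × E) : C(TimeInterval, E) :=
  if h : ∃ α, picardMap f z.1 z.2 α = α then h.choose else 0

lemma picardMap_flowCurve [CompleteSpace E] (f : C(E, E)) {C : NNReal} (hf : LipschitzWith C f) {s : ℝ}
    (hs : |s| * (C : ℝ) < 1) (x : E) : picardMap f s x (flowCurve f (s, x)) = flowCurve f (s, x) := by
  have h : ∃ α, picardMap f s x α = α :=
    ⟨_, (contracting_picardMap f hf hs x).fixedPoint_isFixedPt⟩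
  rw [flowCurve, dif_pos h]
  exact h.choose_spec

lemma eq_flowCurve [CompleteSpace E] (f : C(E, E)) {C : NNReal} (hf : LipschitzWith C f) {s : ℝ}
    (hs : |s| * (C : ℝ) < 1) (x : E) {α : C(TimeInterval, E)} (hα : picardMap f s x α = α) :
    α = flowCurve f (s, x) :=
  (contracting_picardMap f hf hs x).fixedPoint_unique' hα (picardMap_flowCurve f hf hs x)

/-- Implicit function theorem for `α - picardMap f s x α = 0` on the Banach space of curves. The
derivative in `α` is the identity minus an operator of norm at most `|s| * C < 1`, hence invertible;
uniqueness of the fixed point identifies the implicit function with `flowCurve`. -/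
lemma contDiffAt_flowCurve [CompleteSpace E] (f : C(E, E)) (hsm : ContDiff ℝ ∞ f) {C : NNReal}
    (hf : LipschitzWith C f) {s : ℝ} (hs : |s| * (C : ℝ) < 1) (x : E) :
    ContDiffAt ℝ ∞ (flowCurve f) (s, x) := by
  set G : (ℝ × E) × C(TimeInterval, E) → C(TimeInterval, E) :=
    fun p => p.2 - picardMap f p.1.1 p.1.2 p.2 with hG
  have hconst : ContDiff ℝ ∞ (fun x : E => (ContinuousMap.const TimeInterval x)) := 
    (show IsBoundedLinearMap ℝ (fun x : E => ContinuousMap.const TimeInterval x) from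
      IsLinearMap.with_bound ⟨fun _ _ => rfl, fun _ _ => rfl⟩ 1 fun x => by
        rw [one_mul]
        exact (ContinuousMap.norm_le _ (norm_nonneg _)).2 fun _ => le_rfl).contDiff
  have hsup := contDiff_superposition f hsm
  have hGs : ContDiff ℝ ∞ G := by
    refine contDiff_snd.sub (ContDiff.add (hconst.comp (contDiff_snd.comp contDiff_fst)) ?_)
    exact (contDiff_fst.comp contDiff_fst).smul
      ((primitive (E := E)).contDiff.comp (hsup.comp contDiff_snd))
  set α := flowCurve f (s, x) with hα
  have hd : HasFDerivAt (fun β => G ((s, x), β))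
      (ContinuousLinearMap.id ℝ _ - s • (primitive (E := E)).comp
        (pointwiseApply (ContinuousMap.comp ⟨fderiv ℝ f,
          hsm.continuous_fderiv (by simp)⟩ α))) α := by
    have h1 := hasFDerivAt_superposition f ⟨fderiv ℝ f, hsm.continuous_fderiv (by simp)⟩
      (fun x => (hsm.differentiable (by simp) x).hasFDerivAt) α
    have h2 := ((primitive (E := E)).hasFDerivAt.comp α h1).const_smul s
    have h3 := (hasFDerivAt_id (𝕜 := ℝ) α).sub (h2.const_add (ContinuousMap.const _ x))
    exact h3
  have hpart : (fderiv ℝ G ((s, x), α) ∘SL ContinuousLinearMap.inr ℝ (ℝ × E) _) =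
      (ContinuousLinearMap.id ℝ _ - s • (primitive (E := E)).comp
        (pointwiseApply (ContinuousMap.comp ⟨fderiv ℝ f,
          hsm.continuous_fderiv (by simp)⟩ α))) := by
    have h1 := (hGs.differentiable (by simp) ((s, x), α)).hasFDerivAt
    exact (h1.comp α (hasFDerivAt_prodMk_right (s, x) α)).unique hd
  have hinv : (fderiv ℝ G ((s, x), α) ∘SL ContinuousLinearMap.inr ℝ (ℝ × E) _).IsInvertible := by
    rw [hpart]
    set T : C(TimeInterval, E) →L[ℝ] C(TimeInterval, E) := s • (primitive (E := E)).comp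
        (pointwiseApply (ContinuousMap.comp ⟨fderiv ℝ f,
          hsm.continuous_fderiv (by simp)⟩ α)) with hT
    have hTn : ‖T‖ < 1 := by
      refine lt_of_le_of_lt ?_ hs
      refine ContinuousLinearMap.opNorm_le_bound _ (by positivity) fun h => ?_
      rw [mul_assoc]
      refine (norm_smul_le s (primitive (E := E) (pointwiseApply (ContinuousMap.comp ⟨fderiv ℝ f,
          hsm.continuous_fderiv (by simp)⟩ α) h))).trans (mul_le_mul_of_nonneg_left ?_ (abs_nonneg _))
      have h1 := (primitive (E := E)).le_of_opNorm_le norm_primitive_le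
        (pointwiseApply (ContinuousMap.comp ⟨fderiv ℝ f,
          hsm.continuous_fderiv (by simp)⟩ α) h)
      rw [one_mul] at h1
      refine h1.trans ((ContinuousMap.norm_le _ (by positivity)).2 fun t => ?_)
      refine ((fderiv ℝ f (α t)).le_opNorm (h t)).trans ?_
      exact mul_le_mul (norm_fderiv_le_of_lipschitz ℝ hf) (h.norm_coe_le_norm t)
        (norm_nonneg _) C.2
    refine ⟨ContinuousLinearEquiv.ofUnit (Units.oneSub T hTn), ?_⟩
    ext1 h
    rfl
  have hzero : G ((s, x), α) = 0 := by
    simp only [hG]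
    rw [picardMap_flowCurve f hf hs x, sub_self]
  have h1 := hGs.contDiffAt (x := ((s, x), α))
  have h2 := h1.contDiffAt_implicitFunction (by simp) hinv
  refine h2.congr_of_eventuallyEq ?_
  have h3 := h1.eventually_apply_implicitFunction (by simp) hinv
  have h4 : ∀ᶠ p : ℝ × E in 𝓝 (s, x), |p.1| * (C : ℝ) < 1 :=
    (Continuous.tendsto (by fun_prop : Continuous fun p : ℝ × E => |p.1| * (C : ℝ))
      (s, x)).eventually (gt_mem_nhds hs)
  filter_upwards [h3, h4] with p hp hp'
  rw [hzero] at hp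
  exact (eq_flowCurve f hf hp' p.2 (sub_eq_zero.1 hp).symm).symm

/-- The local flow of `f`. -/
noncomputable def flow (f : C(E, E)) (z : ℝ × E) : E := flowCurve f z ⟨1, by norm_num⟩

lemma contDiffAt_flow [CompleteSpace E] (f : C(E, E)) (hsm : ContDiff ℝ ∞ f) {C : NNReal}
    (hf : LipschitzWith C f) {s : ℝ} (hs : |s| * (C : ℝ) < 1) (x : E) :
    ContDiffAt ℝ ∞ (flow f) (s, x) :=
  (show IsBoundedLinearMap ℝ (fun β : C(TimeInterval, E) => β ⟨1, by norm_num⟩) from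
    IsLinearMap.with_bound ⟨fun _ _ => rfl, fun _ _ => rfl⟩ 1 fun β => by
      rw [one_mul]; exact β.norm_coe_le_norm _).contDiff.contDiffAt.comp (s, x)
    (contDiffAt_flowCurve f hsm hf hs x)

/-- The curve of speed `s`, with its parameter rescaled by `r`, is a fixed point of the Picard map
of speed `s * r`. -/
lemma flow_mul [CompleteSpace E] (f : C(E, E)) {C : NNReal} (hf : LipschitzWith C f) {s : ℝ}
    (hs : |s| * (C : ℝ) < 1) (x : E) (r : TimeInterval) :
    flow f (s * r, x) = flowCurve f (s, x) r := by
  have hle : ∀ t : TimeInterval, |(t : ℝ)| ≤ 1 := fun t => abs_le.2 t.2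
  have hsr : |s * (r : ℝ)| * (C : ℝ) < 1 := by
    rw [abs_mul]
    have := mul_le_of_le_one_right (abs_nonneg s) (hle r)
    exact (mul_le_mul_of_nonneg_right this C.2).trans_lt hs
  have hmem : ∀ t : TimeInterval, (r : ℝ) * t ∈ Icc (-1 : ℝ) 1 := fun t => by
    refine abs_le.1 ?_
    rw [abs_mul]
    exact mul_le_one₀ (hle r) (abs_nonneg _) (hle t)
  set β : C(TimeInterval, E) := (flowCurve f (s, x)).comp ⟨fun t => ⟨r * t, hmem t⟩,
    by fun_prop⟩ with hβ
  have key : β = flowCurve f (s * r, x) := by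
    refine eq_flowCurve f hf hsr x ?_
    ext t
    have h1 := DFunLike.congr_fun (picardMap_flowCurve f hf hs x) ⟨r * t, hmem t⟩
    change x + (s * (r : ℝ)) • primitive (f.comp β) t = flowCurve f (s, x) ⟨r * t, hmem t⟩
    rw [← h1]
    change _ = x + s • primitive _ _
    rw [primitive_apply, primitive_apply, mul_smul]
    congr 2
    have h2 : ∀ u ∈ uIcc (0 : ℝ) t, IccExtend (by norm_num : (-1 : ℝ) ≤ 1) (f.comp β) u =
        IccExtend (by norm_num : (-1 : ℝ) ≤ 1) (f.comp (flowCurve f (s, x))) (r * u) := by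
      intro u hu
      have hu' : u ∈ Icc (-1 : ℝ) 1 := by
        have : (Set.uIcc (0:ℝ) t) ⊆ Icc (-1) 1 := by
          refine (uIcc_subset_Icc (by norm_num) t.2)
        exact this hu
      rw [IccExtend_of_mem _ _ hu', IccExtend_of_mem _ _ (hmem ⟨u, hu'⟩)]
      rfl
    rw [intervalIntegral.integral_congr h2]
    rcases eq_or_ne (r : ℝ) 0 with h0 | h0
    · simp [h0]
    · rw [intervalIntegral.integral_comp_mul_left (fun u => IccExtend
        (by norm_num : (-1 : ℝ) ≤ 1) (f.comp (flowCurve f (s, x))) u) h0, mul_zero,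
        smul_smul, mul_inv_cancel₀ h0, one_smul]
  rw [flow, ← key]
  change flowCurve f (s, x) _ = _
  congr 1
  ext
  simp

lemma flow_zero [CompleteSpace E] (f : C(E, E)) {C : NNReal} (hf : LipschitzWith C f) (x : E) :
    flow f (0, x) = x := by
  have h := DFunLike.congr_fun (picardMap_flowCurve f hf (s := 0) (by simp) x)
    (⟨1, by norm_num⟩ : TimeInterval)
  rw [flow, ← h]
  simp [picardMap]

/-- By definition `flow` is evaluated at an endpoint of `TimeInterval`. Passing to a slightly larger
speed `S` moves this to the interior parameter `s / S`, where the integral equation can be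
differentiated. -/
lemma hasDerivAt_flow [CompleteSpace E] (f : C(E, E)) {C : NNReal}
    (hf : LipschitzWith C f) {s : ℝ} (hs : |s| * (C : ℝ) < 1) (x : E) :
    HasDerivAt (fun r => flow f (r, x)) (f (flow f (s, x))) s := by
  obtain ⟨S, hS, hSC⟩ : ∃ S : ℝ, |s| < S ∧ S * (C : ℝ) < 1 := by
    have : ∀ᶠ S in 𝓝[>] |s|, S * (C : ℝ) < 1 :=
      nhdsWithin_le_nhds ((Continuous.tendsto (by fun_prop : Continuous fun S : ℝ =>
        S * (C : ℝ)) |s|).eventually (gt_mem_nhds hs))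
    obtain ⟨S, h1, h2⟩ := (this.and self_mem_nhdsWithin).exists
    exact ⟨S, h2, h1⟩
  have hS0 : 0 < S := (abs_nonneg s).trans_lt hS
  have hSC' : |S| * (C : ℝ) < 1 := by rwa [abs_of_pos hS0]
  set g := IccExtend (by norm_num : (-1 : ℝ) ≤ 1) (f.comp (flowCurve f (S, x))) with hg
  have hgc : Continuous g := (f.comp (flowCurve f (S, x))).continuous.Icc_extend'
  have heq : ∀ r, |r| < S → flow f (r, x) = x + S • ∫ u in (0 : ℝ)..r / S, g u := by
    intro r hr
    have hmem : r / S ∈ Icc (-1 : ℝ) 1 := by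
      refine abs_le.1 ?_
      rw [abs_div, abs_of_pos hS0, div_le_one hS0]
      exact hr.le
    have h1 := flow_mul f hf hSC' x ⟨r / S, hmem⟩
    rw [mul_div_cancel₀ _ hS0.ne'] at h1
    rw [h1, ← picardMap_flowCurve f hf hSC' x]
    rfl
  have hmem : s / S ∈ Icc (-1 : ℝ) 1 := by
    refine abs_le.1 ?_
    rw [abs_div, abs_of_pos hS0, div_le_one hS0]
    exact hS.le
  have hval : g (s / S) = f (flow f (s, x)) := by
    have h1 := flow_mul f hf hSC' x ⟨s / S, hmem⟩
    rw [mul_div_cancel₀ _ hS0.ne'] at h1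
    rw [h1, hg, IccExtend_of_mem _ _ hmem]
    rfl
  have hd : HasDerivAt (fun r => x + S • ∫ u in (0 : ℝ)..r / S, g u)
      (S • ((1 / S) • g (s / S))) s := by
    have h1 : HasDerivAt (fun v => ∫ u in (0 : ℝ)..v, g u) (g (s / S)) (s / S) :=
      intervalIntegral.integral_hasDerivAt_right (hgc.intervalIntegrable _ _)
        (hgc.stronglyMeasurableAtFilter _ _) hgc.continuousAt
    have h2 := h1.scomp s ((hasDerivAt_id s).div_const S)
    exact (h2.const_smul S).const_add x
  rw [smul_smul, mul_one_div_cancel hS0.ne', one_smul, hval] at hd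
  refine hd.congr_of_eventuallyEq ?_
  have : ∀ᶠ r in 𝓝 s, |r| < S :=
    (continuous_abs.tendsto s).eventually (gt_mem_nhds hS)
  filter_upwards [this] with r hr using heq r hr

lemma flow_add [CompleteSpace E] (f : C(E, E)) {C : NNReal} (hf : LipschitzWith C f) {ε : ℝ} 
    (hε : ε * (C : ℝ) < 1) (x : E) {s t : ℝ} (hst : |s| + |t| < ε) :
    flow f (s, flow f (t, x)) = flow f (s + t, x) := by
  have hε0 : 0 < ε := by have := abs_nonneg s; have := abs_nonneg t; linarith
  have hlt : ∀ r, |r| < ε → |r| * (C : ℝ) < 1 := fun r hr =>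
    (mul_le_mul_of_nonneg_right hr.le C.2).trans_lt hε
  have h := ODE_solution_unique_of_mem_Ioo (v := fun _ => f) (s := fun _ => univ) (K := C)
    (f := fun r => flow f (r, flow f (t, x))) (g := fun r => flow f (r + t, x))
    (a := -(ε - |t|)) (b := ε - |t|) (t₀ := 0) (fun _ _ => hf.lipschitzOnWith)
    (by have := abs_nonneg s; constructor <;> linarith)
    (fun r hr => ⟨hasDerivAt_flow f hf (hlt r (by
      have := abs_nonneg t
      exact abs_lt.2 ⟨by linarith [hr.1], by linarith [hr.2]⟩)) _, mem_univ _⟩)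
    (fun r hr => ⟨by
      have h1 := hasDerivAt_flow f hf (s := r + t) (hlt _ (by
        have := abs_add_le r t
        have := abs_lt.2 hr
        linarith)) x
      have h2 := h1.scomp r ((hasDerivAt_id r).add_const t)
      rw [one_smul] at h2
      exact h2, mem_univ _⟩)
    (by simp [flow_zero f hf])
  exact h (abs_lt.1 (by linarith) : s ∈ Ioo _ _)

end SmoothFlow

/-! ### First integrals of a nonvanishing smooth vector field. -/

section FirstIntegrals

variable {E F : Type} [NormedAddCommGroup E] [NormedSpace ℝ E] 
  [NormedAddCommGroup F] [NormedSpace ℝ F]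

lemma exists_compactlySupported_extension [FiniteDimensional ℝ E] {g : E → F} {U : Set E} (hU : IsOpen U)
    (hg : ContDiffOn ℝ ∞ g U) {x₀ : E} (hx₀ : x₀ ∈ U) :
    ∃ f : E → F, ContDiff ℝ ∞ f ∧ HasCompactSupport f ∧ f =ᶠ[𝓝 x₀] g := by
  obtain ⟨r, hr, hrU⟩ := Metric.nhds_basis_closedBall.mem_iff.1 (hU.mem_nhds hx₀)
  let χ : ContDiffBump x₀ := ⟨r / 2, r, by positivity, by linarith⟩
  refine ⟨fun x => χ x • g x, contDiff_iff_contDiffAt.2 fun x => ?_, ?_, ?_⟩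
  · by_cases hx : x ∈ U
    · exact χ.contDiff.contDiffAt.smul (hg.contDiffAt (hU.mem_nhds hx))
    · have hx' : x ∈ (Metric.closedBall x₀ r)ᶜ := fun h => hx (hrU h)
      refine (contDiffAt_const (c := (0 : F))).congr_of_eventuallyEq ?_
      filter_upwards [Metric.isClosed_closedBall.isOpen_compl.mem_nhds hx'] with y hy
      have : χ y = 0 := χ.zero_of_le_dist (by
        simp only [mem_compl_iff, Metric.mem_closedBall, not_le] at hy
        exact hy.le)
      rw [this, zero_smul]
  · exact χ.hasCompactSupport.smul_right
  · filter_upwards [χ.eventuallyEq_one] with x hx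
    rw [hx]
    simp

lemma exists_smooth_integralCurve [FiniteDimensional ℝ E] {K : E → E} {U : Set E} (hU : IsOpen U)
    (hK : ContDiffOn ℝ ∞ K U) {x₀ : E} (hx₀ : x₀ ∈ U) :
    ∃ (ε : ℝ) (γ : ℝ → E), 0 < ε ∧ γ 0 = x₀ ∧ ContDiffOn ℝ ∞ γ (Ioo (-ε) ε) ∧
      ∀ t ∈ Ioo (-ε) ε, γ t ∈ U ∧ HasDerivAt γ (K (γ t)) t := by
  obtain ⟨f, hf, hfc, hfK⟩ := exists_compactlySupported_extension hU hK hx₀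
  obtain ⟨C, hC⟩ := hf.lipschitzWith_of_hasCompactSupport hfc (by simp)
  let f' : C(E, E) := ⟨f, hf.continuous⟩
  have hsm : ∀ s : ℝ, |s| * (C : ℝ) < 1 → ContDiffAt ℝ ∞ (fun s => flow f' (s, x₀)) s :=
    fun s hs => (contDiffAt_flow f' hf hC hs x₀).comp (f := fun s : ℝ => (s, x₀)) s (by fun_prop)
  have h0 : ∀ᶠ s in 𝓝 (0 : ℝ), |s| * (C : ℝ) < 1 :=
    (Continuous.tendsto (by fun_prop : Continuous fun s : ℝ => |s| * (C : ℝ))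
      0).eventually (gt_mem_nhds (by simp))
  have hc : ContinuousAt (fun s => flow f' (s, x₀)) 0 := (hsm 0 (by simp)).continuousAt
  have h1 : ∀ᶠ s in 𝓝 (0 : ℝ), flow f' (s, x₀) ∈ U ∧ f (flow f' (s, x₀)) =
      K (flow f' (s, x₀)) := by
    have : Filter.Tendsto (fun s => flow f' (s, x₀)) (𝓝 0) (𝓝 x₀) := by
      have := hc.tendsto
      rwa [flow_zero f' hC] at this
    exact this.eventually ((hU.eventually_mem hx₀).and hfK)
  obtain ⟨ε, hε, hball⟩ := Metric.eventually_nhds_iff_ball.1 (h0.and h1)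
  rw [Real.ball_eq_Ioo, zero_sub, zero_add] at hball
  refine ⟨ε, fun s => flow f' (s, x₀), hε, flow_zero f' hC x₀, fun s hs =>
    (hsm s (hball s hs).1).contDiffWithinAt, fun s hs => ⟨(hball s hs).2.1, ?_⟩⟩
  rw [← (hball s hs).2.2]
  exact hasDerivAt_flow f' hC (hball s hs).1 x₀

/-- Near `x₀`, `Φ` moves a point along the normalized field to the hyperplane through `x₀` on which
`ℓ` is constant, and then applies `P`. It is constant along the field, and its differential at `x₀`
is `P`, which is onto; so the kernel of the differential has dimension one nearby. -/
lemma exists_first_integrals [FiniteDimensional ℝ E] [FiniteDimensional ℝ F] {K : E → E} {U : Set E} (hU : IsOpen U)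
    (hK : ContDiffOn ℝ ∞ K U) {x₀ : E} (hx₀ : x₀ ∈ U) (hne : K x₀ ≠ 0) (P : E →L[ℝ] F)
    (hP : Function.Surjective P) (hPK : P (K x₀) = 0)
    (hdim : Module.finrank ℝ E = Module.finrank ℝ F + 1) :
    ∃ (Φ : E → F) (W : Set E), IsOpen W ∧ x₀ ∈ W ∧ W ⊆ U ∧ ContDiffOn ℝ ∞ Φ W ∧
      ∀ x ∈ W, LinearMap.ker (fderiv ℝ Φ x : E →ₗ[ℝ] F) = Submodule.span ℝ {K x} := by
  obtain ⟨ℓ, hℓ⟩ := SeparatingDual.exists_eq_one (R := ℝ) hne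
  have hU1 : IsOpen {x ∈ U | ℓ (K x) ≠ 0} :=
    (ℓ.continuous.comp_continuousOn hK.continuousOn).isOpen_inter_preimage hU isOpen_ne
  -- Rescaling keeps the line spanned by `K` and makes `ℓ` grow at unit speed, so that the time
  -- needed to reach the hyperplane is `-ℓ (x - x₀)`.
  have hK1 : ContDiffOn ℝ ∞ (fun x => (ℓ (K x))⁻¹ • K x) {x ∈ U | ℓ (K x) ≠ 0} :=
    ((ℓ.contDiff.comp_contDiffOn (hK.mono fun x hx => hx.1)).inv fun x hx => hx.2).smul
      (hK.mono fun x hx => hx.1)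
  obtain ⟨f, hf, hfc, hfK⟩ := exists_compactlySupported_extension hU1 hK1
    (x₀ := x₀) ⟨hx₀, by rw [hℓ]; exact one_ne_zero⟩
  obtain ⟨C, hC⟩ := hf.lipschitzWith_of_hasCompactSupport hfc (by simp)
  let f' : C(E, E) := ⟨f, hf.continuous⟩
  obtain ⟨ε, hε, hεC⟩ : ∃ ε : ℝ, 0 < ε ∧ ε * (C : ℝ) < 1 := by
    have : ∀ᶠ S in 𝓝[>] (0 : ℝ), S * (C : ℝ) < 1 :=
      nhdsWithin_le_nhds ((Continuous.tendsto (by fun_prop : Continuous fun S : ℝ =>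
        S * (C : ℝ)) 0).eventually (gt_mem_nhds (by simp)))
    obtain ⟨S, h1, h2⟩ := (this.and self_mem_nhdsWithin).exists
    exact ⟨S, h2, h1⟩
  have hlt : ∀ r, |r| < ε → |r| * (C : ℝ) < 1 := fun r hr =>
    (mul_le_mul_of_nonneg_right hr.le C.2).trans_lt hεC
  set Φ : E → F := fun x => P (flow f' (-ℓ (x - x₀), x)) with hΦ
  set W₁ : Set E := {x | |ℓ (x - x₀)| < ε} with hW₁
  have hW₁o : IsOpen W₁ := isOpen_lt (by fun_prop) continuous_const
  have hx₀W : x₀ ∈ W₁ := by simpa [hW₁] using hε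
  have hflow : ∀ x ∈ W₁, ContDiffAt ℝ ∞ (flow f') (-ℓ (x - x₀), x) := fun x hx =>
    contDiffAt_flow f' hf hC (hlt _ (by rw [abs_neg]; exact hx)) x
  have hΦs : ∀ x ∈ W₁, ContDiffAt ℝ ∞ Φ x := fun x hx =>
    P.contDiff.contDiffAt.comp x ((hflow x hx).comp (f := fun x => (-ℓ (x - x₀), x)) x (by fun_prop))
  have hΦd : ∀ x ∈ W₁, ∀ v, fderiv ℝ Φ x v =
      P (fderiv ℝ (flow f') (-ℓ (x - x₀), x) (-ℓ v, v)) := by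
    intro x hx v
    have h1 : HasFDerivAt (fun x => (-ℓ (x - x₀), x)) ((-ℓ).prod (ContinuousLinearMap.id ℝ E)) x :=
      ((ℓ.hasFDerivAt.comp x ((hasFDerivAt_id x).sub_const x₀)).neg).prodMk (hasFDerivAt_id x)
    have h2 := P.hasFDerivAt.comp x
      (((hflow x hx).differentiableAt (by simp)).hasFDerivAt.comp
        (f := fun x => (-ℓ (x - x₀), x)) x h1)
    have h3 : fderiv ℝ Φ x = _ := h2.fderiv
    rw [h3]
    rfl
  have htime : ∀ x ∈ W₁, fderiv ℝ (flow f') (-ℓ (x - x₀), x) (1, 0) =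
      f (flow f' (-ℓ (x - x₀), x)) := by
    intro x hx
    have h1 : HasDerivAt (fun r : ℝ => (r, x)) (1, 0) (-ℓ (x - x₀)) :=
      (hasDerivAt_id _).prodMk (hasDerivAt_const _ _)
    have h2 := ((hflow x hx).differentiableAt (by simp)).hasFDerivAt.comp_hasDerivAt _ h1
    exact h2.unique (hasDerivAt_flow f' hC (hlt _ (by rw [abs_neg]; exact hx)) x)
  -- The flow carries the field to itself: differentiate `flow (s, flow (t, x)) = flow (s + t, x)`
  -- at `t = 0`.
  have hspace : ∀ x ∈ W₁, fderiv ℝ (flow f') (-ℓ (x - x₀), x) (0, f x) =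
      f (flow f' (-ℓ (x - x₀), x)) := by
    intro x hx
    set s := -ℓ (x - x₀) with hs
    have hsε : |s| < ε := by rw [hs, abs_neg]; exact hx
    have h0 : HasDerivAt (fun t : ℝ => flow f' (t, x)) (f x) 0 := by
      have := hasDerivAt_flow f' hC (s := 0) (by simp) x
      rwa [flow_zero f' hC] at this
    have h1 : HasDerivAt (fun t : ℝ => (s, flow f' (t, x))) (0, f x) 0 :=
      (hasDerivAt_const _ _).prodMk h0
    have h2 : HasFDerivAt (flow f') (fderiv ℝ (flow f') (s, x)) (s, flow f' (0, x)) := by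
      rw [flow_zero f' hC]
      exact ((hflow x hx).differentiableAt (by simp)).hasFDerivAt
    have h3 := h2.comp_hasDerivAt 0 h1
    have h4 : HasDerivAt (fun t : ℝ => flow f' (s + t, x)) (f (flow f' (s, x))) 0 := by
      have h5 : HasDerivAt (fun r : ℝ => flow f' (r, x)) (f (flow f' (s, x))) (s + 0) := by
        rw [add_zero]
        exact hasDerivAt_flow f' hC (hlt _ hsε) x
      have h6 := h5.scomp 0 ((hasDerivAt_id (0 : ℝ)).const_add s)
      rw [one_smul] at h6
      exact h6
    refine (h3.congr_of_eventuallyEq ?_).unique h4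
    have : ∀ᶠ t in 𝓝 (0 : ℝ), |s| + |t| < ε :=
      (Continuous.tendsto (by fun_prop : Continuous fun t : ℝ => |s| + |t|)
        0).eventually (gt_mem_nhds (by simpa using hsε))
    filter_upwards [this] with t ht using (flow_add f' hC hεC x ht).symm
  have hf0 : f x₀ = K x₀ := by
    have := hfK.self_of_nhds
    simpa [hℓ] using this
  have hd0 : fderiv ℝ Φ x₀ = P := by
    ext v
    rw [hΦd x₀ hx₀W v]
    have h1 : ((-ℓ v, v) : ℝ × E) = (-ℓ v) • ((1, 0) : ℝ × E) + (0, v) := by simp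
    have h2 : fderiv ℝ (flow f') (-ℓ (x₀ - x₀), x₀) (0, v) = v := by
      have h3 : HasFDerivAt (fun y : E => ((-ℓ (x₀ - x₀), y) : ℝ × E))
          (ContinuousLinearMap.inr ℝ ℝ E) x₀ := hasFDerivAt_prodMk_right _ _
      have h4 := ((hflow x₀ hx₀W).differentiableAt (by simp)).hasFDerivAt.comp x₀ h3
      have h5 : HasFDerivAt (flow f' ∘ fun y : E => ((-ℓ (x₀ - x₀), y) : ℝ × E))
          (ContinuousLinearMap.id ℝ E) x₀ := by
        refine (hasFDerivAt_id x₀).congr_of_eventuallyEq (Filter.Eventually.of_forall fun y => ?_)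
        simp [flow_zero f' hC]
      exact DFunLike.congr_fun (h4.unique h5) v
    rw [h1, map_add, map_smul, htime x₀ hx₀W, h2, map_add, map_smul]
    have h6 : flow f' (-ℓ (x₀ - x₀), x₀) = x₀ := by simp [flow_zero f' hC]
    rw [h6, hf0, hPK, smul_zero, zero_add]
  -- A fixed right inverse of `P` turns surjectivity of the nearby differentials into the open
  -- condition that an endomorphism of `F` is a unit.
  obtain ⟨R, hR⟩ := P.exists_rightInverse_of_surjective (LinearMap.range_eq_top.2 hP)
  have hcont : ContinuousAt (fun x => (fderiv ℝ Φ x).comp R) x₀ :=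
    ((hΦs x₀ hx₀W).continuousAt_fderiv (by simp)).clm_comp continuousAt_const
  have hunit : ∀ᶠ x in 𝓝 x₀, IsUnit ((fderiv ℝ Φ x).comp R) := by
    refine hcont.tendsto.eventually (Units.isOpen.mem_nhds ?_)
    change IsUnit _
    rw [hd0, hR]
    exact isUnit_one
  have hfe := hfK.eventually_nhds
  have hall := (hunit.and (hfe.and ((hW₁o.eventually_mem hx₀W).and
    (hU1.eventually_mem ⟨hx₀, by rw [hℓ]; exact one_ne_zero⟩))))
  obtain ⟨W, hW, hWo, hxW⟩ := eventually_nhds_iff.1 hall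
  refine ⟨Φ, W, hWo, hxW, fun x hx => (hW x hx).2.2.2.1, fun x hx =>
    (hΦs x (hW x hx).2.2.1).contDiffWithinAt, fun x hx => ?_⟩
  obtain ⟨hu, hfx, hx₁, hxU, hℓx⟩ := hW x hx
  have hfx' := hfx.self_of_nhds
  have hKf : K x = ℓ (K x) • f x := by rw [hfx', smul_smul, mul_inv_cancel₀ hℓx, one_smul]
  have hℓf : ℓ (f x) = 1 := by rw [hfx', map_smul, smul_eq_mul, inv_mul_cancel₀ hℓx]
  -- Along the field the contributions of time and space cancel, because `ℓ (f x) = 1`.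
  have hmem : K x ∈ LinearMap.ker (fderiv ℝ Φ x : E →ₗ[ℝ] F) := by
    rw [LinearMap.mem_ker, ContinuousLinearMap.coe_coe, hKf, map_smul, hΦd x hx₁, hℓf]
    have h1 : ((-1, f x) : ℝ × E) = -((1, 0) : ℝ × E) + (0, f x) := by simp
    rw [h1, map_add, map_neg, htime x hx₁, hspace x hx₁]
    simp
  have hsurj : Function.Surjective (fderiv ℝ Φ x : E →ₗ[ℝ] F) := by
    obtain ⟨u, hu⟩ := hu
    intro y
    refine ⟨R ((↑u⁻¹ : F →L[ℝ] F) y), ?_⟩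
    have h1 : ((u : F →L[ℝ] F) * (↑u⁻¹ : F →L[ℝ] F)) y = y := by rw [Units.mul_inv]; rfl
    rw [hu] at h1
    exact h1
  have hKx : K x ≠ 0 := fun h => hℓx (by rw [h, map_zero])
  symm
  refine Submodule.eq_of_le_of_finrank_eq ((Submodule.span_singleton_le_iff_mem _ _).2 hmem) ?_
  rw [finrank_span_singleton hKx]
  have := LinearMap.finrank_range_add_finrank_ker (fderiv ℝ Φ x : E →ₗ[ℝ] F)
  rw [LinearMap.range_eq_top.2 hsurj, finrank_top] at this
  omega

end FirstIntegrals

/-! ### Lie brackets under differentials and along integral curves. -/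

section Calculus

lemma minSmoothness_two_le_infty : minSmoothness ℝ 2 ≤ (∞ : WithTop ℕ∞) := by
  rw [minSmoothness_of_isRCLikeNormedField]
  exact WithTop.coe_le_coe.2 le_top

lemma one_add_one_le_infty : (1 + 1 : WithTop ℕ∞) ≤ ∞ := by
  rw [one_add_one_eq_two]
  exact WithTop.coe_le_coe.2 le_top

variable {N E F : Type} [NormedAddCommGroup N] [NormedSpace ℝ N] [NormedAddCommGroup E]
  [NormedSpace ℝ E] [NormedAddCommGroup F] [NormedSpace ℝ F]

/-- The map `Ψ` is not assumed invertible: it will parametrize the 7-dimensional conormal manifold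
inside the 10-dimensional cotangent bundle. The second derivatives of `Ψ` cancel by symmetry. -/
lemma fderiv_lieBracket_of_related {Ψ : N → E} {h W : E → E} {h' W' : N → N} {z : N}
    (hΨ : ContDiffAt ℝ ∞ Ψ z) (hh : DifferentiableAt ℝ h (Ψ z)) (hW : DifferentiableAt ℝ W (Ψ z))
    (hh' : DifferentiableAt ℝ h' z) (hW' : DifferentiableAt ℝ W' z)
    (eh : ∀ᶠ x in 𝓝 z, fderiv ℝ Ψ x (h' x) = h (Ψ x))
    (eW : ∀ᶠ x in 𝓝 z, fderiv ℝ Ψ x (W' x) = W (Ψ x)) :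
    fderiv ℝ Ψ z (VectorField.lieBracket ℝ h' W' z) = VectorField.lieBracket ℝ h W (Ψ z) := by
  have hd := hΨ.differentiableAt (by simp)
  rw [VectorField.fderiv_apply_lieBracket hΨ minSmoothness_two_le_infty hW' hh']
  have e1 : (fun x => fderiv ℝ Ψ x (W' x)) =ᶠ[𝓝 z] W ∘ Ψ := eW
  have e2 : (fun x => fderiv ℝ Ψ x (h' x)) =ᶠ[𝓝 z] h ∘ Ψ := eh
  rw [e1.fderiv_eq, e2.fderiv_eq, fderiv_comp z hW hd, fderiv_comp z hh hd]
  simp only [ContinuousLinearMap.comp_apply]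
  rw [eh.self_of_nhds, eW.self_of_nhds]
  rfl

/-- In `dφ([H, W]) = H(dφ W) - W(dφ H)` the last term vanishes because `φ` is constant along `H`.
Differentiation along an extremal thereby becomes the operator `ad h`. -/
lemma hasDerivAt_fderiv_along {φ : N → F} {H W : N → N} {c : ℝ → N} {t a : ℝ}
    (hφ : ContDiffAt ℝ ∞ φ (c t)) (hH : DifferentiableAt ℝ H (c t))
    (hW : DifferentiableAt ℝ W (c t))
    (h0 : ∀ᶠ x in 𝓝 (c t), fderiv ℝ φ x (H x) = 0) (hc : HasDerivAt c (a • H (c t)) t) :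
    HasDerivAt (fun r => fderiv ℝ φ (c r) (W (c r)))
      (a • fderiv ℝ φ (c t) (VectorField.lieBracket ℝ H W (c t))) t := by
  have e2 : (fun x => fderiv ℝ φ x (H x)) =ᶠ[𝓝 (c t)] fun _ => 0 := h0
  rw [VectorField.fderiv_apply_lieBracket hφ minSmoothness_two_le_infty hW hH, e2.fderiv_eq]
  have hd : DifferentiableAt ℝ (fun x => fderiv ℝ φ x (W x)) (c t) :=
    ((hφ.fderiv_right (m := 1) one_add_one_le_infty).differentiableAt (by simp)).clm_apply hW
  have h1 := hd.hasFDerivAt.comp_hasDerivAt t hc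
  rw [map_smul] at h1
  simpa [Function.comp_def] using h1

end Calculus

/-! ### Orders of vanishing and smooth division by the parameter. -/

section Orders

/-- `f` vanishes to order at least `n` at `0`. -/
def VanishesTo (n : ℕ) (f : ℝ → ℝ) : Prop := f =O[𝓝 0] fun t => t ^ n

namespace VanishesTo

variable {f g : ℝ → ℝ} {m n : ℕ}

lemma add (hf : VanishesTo n f) (hg : VanishesTo n g) : VanishesTo n (fun t => f t + g t) :=
  Asymptotics.IsBigO.add hf hg

lemma sub (hf : VanishesTo n f) (hg : VanishesTo n g) : VanishesTo n (fun t => f t - g t) :=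
  Asymptotics.IsBigO.sub hf hg

lemma const_mul (hf : VanishesTo n f) (c : ℝ) : VanishesTo n (fun t => c * f t) :=
  Asymptotics.IsBigO.const_mul_left hf c

lemma mul (hf : VanishesTo m f) (hg : VanishesTo n g) : VanishesTo (m + n) (fun t => f t * g t) := by
  unfold VanishesTo
  simp_rw [pow_add]
  exact Asymptotics.IsBigO.mul hf hg

lemma mono (hf : VanishesTo n f) (h : m ≤ n) : VanishesTo m f := by
  refine Asymptotics.IsBigO.trans hf ?_
  refine Asymptotics.IsBigO.of_bound 1 ?_
  filter_upwards [Metric.ball_mem_nhds (0 : ℝ) one_pos] with t ht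
  have ht' : |t| ≤ 1 := by
    rw [mem_ball_zero_iff, Real.norm_eq_abs] at ht
    exact ht.le
  rw [one_mul, norm_pow, norm_pow, Real.norm_eq_abs]
  exact pow_le_pow_of_le_one (abs_nonneg _) ht' h

lemma pow (hf : VanishesTo 1 f) (n : ℕ) : VanishesTo n (fun t => f t ^ n) := by
  have := Asymptotics.IsBigO.pow hf n
  simpa [VanishesTo] using this

lemma of_continuousAt (hf : ContinuousAt f 0) : VanishesTo 0 f := by
  unfold VanishesTo
  simp only [pow_zero]
  exact hf.isBigO_one ℝ

lemma of_hasDerivAt {f' : ℝ} (hf : HasDerivAt f f' 0) :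
    VanishesTo 1 (fun t => f t - f 0) := by
  unfold VanishesTo
  have := hf.isBigO_sub
  simpa using this

lemma congr (hf : VanishesTo n f) (h : ∀ t, g t = f t) : VanishesTo n g := by
  have : g = f := funext h
  rwa [this]

lemma primitive {f' : ℝ → ℝ} (hf : ∀ᶠ t in 𝓝 (0 : ℝ), HasDerivAt f (f' t) t) (h0 : f 0 = 0)
    (hf' : VanishesTo n f') : VanishesTo (n + 1) f := by
  obtain ⟨C, hC⟩ := Asymptotics.IsBigO.bound hf'
  obtain ⟨δ, hδ, hball⟩ := Metric.eventually_nhds_iff_ball.1 (hf.and hC)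
  refine Asymptotics.IsBigO.of_bound C ?_
  filter_upwards [Metric.ball_mem_nhds (0 : ℝ) hδ] with t ht
  have hsub : Metric.closedBall (0 : ℝ) |t| ⊆ Metric.ball 0 δ := fun x hx => by
    rw [mem_closedBall_zero_iff] at hx
    rw [mem_ball_zero_iff] at ht ⊢
    exact hx.trans_lt ht
  have h1 := (convex_closedBall (0 : ℝ) |t|).norm_image_sub_le_of_norm_hasDerivWithin_le
    (f := f) (f' := f') (C := C * |t| ^ n) (x := 0) (y := t)
    (fun x hx => (hball x (hsub hx)).1.hasDerivWithinAt)
    (fun x hx => by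
      have h2 := (hball x (hsub hx)).2
      have h3 : ‖x ^ n‖ ≤ |t| ^ n := by
        rw [norm_pow]
        exact pow_le_pow_left₀ (norm_nonneg _) (mem_closedBall_zero_iff.1 hx) n
      -- The constant of the big-O bound need not be nonnegative, but it must be wherever the power
      -- does not vanish.
      have hC0 : 0 ≤ C ∨ ‖x ^ n‖ = 0 := by
        by_contra! hcon
        have : 0 < ‖x ^ n‖ := lt_of_le_of_ne (norm_nonneg _) (Ne.symm hcon.2)
        nlinarith [norm_nonneg (f' x)]
      rcases hC0 with hC0 | hz
      · exact h2.trans (mul_le_mul_of_nonneg_left h3 hC0)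
      · by_cases hC0 : 0 ≤ C
        · exact h2.trans (mul_le_mul_of_nonneg_left h3 hC0)
        · have hx0 : ‖(t : ℝ) ^ n‖ = 0 ∨ ‖t ^ n‖ ≠ 0 := em _
          rcases hx0 with h5 | h5
          · rw [hz, mul_zero] at h2
            rw [norm_pow, Real.norm_eq_abs] at h5
            rw [h5, mul_zero]; exact h2
          · have h6 := (hball t ht).2
            have : 0 < ‖t ^ n‖ := lt_of_le_of_ne (norm_nonneg _) (Ne.symm h5)
            push Not at hC0
            nlinarith [norm_nonneg (f' t)])
    (by simp) (by simp)
  rw [h0, sub_zero, sub_zero, Real.norm_eq_abs] at h1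
  rw [norm_pow, Real.norm_eq_abs, Real.norm_eq_abs]
  refine h1.trans (le_of_eq ?_)
  rw [Real.norm_eq_abs]
  ring

/-- Since `s` has nonzero derivative, `t = O(s)`, and `c ≠ 0` would give `t ^ n = O(t ^ (n + 1))`.
This lets coefficients of expansions in powers of `s` be compared one at a time. -/
lemma coeff_eq_zero {c : ℝ} {s : ℝ → ℝ} {a : ℝ} (hs : HasDerivAt s a 0) (hs0 : s 0 = 0)
    (ha : a ≠ 0) (h : VanishesTo (n + 1) (fun t => c * s t ^ n)) : c = 0 := by
  by_contra hc
  have h1 : (fun t : ℝ => t) =O[𝓝 0] s := by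
    have h2 := (hs.isTheta_sub ha).2
    simpa [hs0, Function.comp_def] using h2
  have h2 : (fun t : ℝ => t ^ n) =O[𝓝 0] fun t => c * s t ^ n :=
    (h1.pow n).trans ((Asymptotics.isBigO_const_mul_self c⁻¹ _ _).congr_left fun t => by
      field_simp)
  have h3 : (fun t : ℝ => t ^ n) =O[𝓝 0] fun t => t ^ (n + 1) := h2.trans h
  have h4 : (fun t : ℝ => t ^ (n + 1)) =o[𝓝 0] fun t => t ^ n :=
    Asymptotics.isLittleO_pow_pow n.lt_succ_self
  have h5 := h3.trans_isLittleO h4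
  have h6 := Asymptotics.isLittleO_irrefl (f'' := fun t : ℝ => t ^ n) (l := 𝓝 (0 : ℝ)) (by
    have : ∃ᶠ t : ℝ in 𝓝[>] 0, t ^ n ≠ 0 := by
      refine Filter.Eventually.frequently ?_
      filter_upwards [self_mem_nhdsWithin] with t ht
      exact pow_ne_zero _ (ne_of_gt ht)
    exact this.filter_mono nhdsWithin_le_nhds)
  exact h6 h5

end VanishesTo

/-- The weight `r ^ k` makes the induction close: differentiation under the integral replaces `f` by
its derivative and `k` by `k + 1`. -/
lemma contDiffOn_mul_integral {δ : ℝ} (n : ℕ) : ∀ (k : ℕ) {f : ℝ → ℝ},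
    ContDiffOn ℝ ∞ f (Ioo (-δ) δ) →
    ContDiffOn ℝ n (fun t => ∫ r in (0 : ℝ)..1, r ^ k * f (t * r)) (Ioo (-δ) δ) := by
  have hmul : ∀ {T : ℝ}, T < δ → ∀ {t r : ℝ}, |t| ≤ T → r ∈ Icc (0 : ℝ) 1 →
      t * r ∈ Icc (-T) T ∧ t * r ∈ Ioo (-δ) δ := by
    intro T hT t r ht hr
    have h1 : |t * r| ≤ T := by
      rw [abs_mul, abs_of_nonneg hr.1]
      exact (mul_le_of_le_one_right (abs_nonneg _) hr.2).trans ht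
    exact ⟨abs_le.1 h1, abs_lt.1 (h1.trans_lt hT)⟩
  have key : ∀ (k : ℕ) {f : ℝ → ℝ}, ContDiffOn ℝ ∞ f (Ioo (-δ) δ) → ∀ t ∈ Ioo (-δ) δ,
      HasDerivAt (fun t => ∫ r in (0 : ℝ)..1, r ^ k * f (t * r))
        (∫ r in (0 : ℝ)..1, r ^ (k + 1) * deriv f (t * r)) t := by
    intro k f hf t ht
    have hf' : ContDiffOn ℝ ∞ (deriv f) (Ioo (-δ) δ) := hf.deriv_of_isOpen isOpen_Ioo (by simp)
    obtain ⟨T, hT1, hT2⟩ := exists_between (abs_lt.2 ht)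
    have hsub : Icc (-T) T ⊆ Ioo (-δ) δ := fun x hx => ⟨by linarith [hx.1], by linarith [hx.2]⟩
    obtain ⟨C, hC⟩ := isCompact_Icc.exists_bound_of_continuousOn (hf'.continuousOn.mono hsub)
    have hcont : ∀ (j : ℕ) {g : ℝ → ℝ}, ContDiffOn ℝ ∞ g (Ioo (-δ) δ) → ∀ x, |x| ≤ T →
        ContinuousOn (fun r => r ^ j * g (x * r)) (Icc 0 1) := by
      intro j g hg x hx
      refine (continuousOn_id.pow j).mul (hg.continuousOn.comp (by fun_prop) ?_)
      intro r hr
      exact (hmul hT2 hx hr).2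
    have huIcc : uIcc (0 : ℝ) 1 = Icc 0 1 := uIcc_of_le zero_le_one
    have hS : {x : ℝ | |x| < T} ∈ 𝓝 t := (isOpen_lt continuous_abs continuous_const).mem_nhds hT1
    refine (intervalIntegral.hasDerivAt_integral_of_dominated_loc_of_deriv_le
      (F := fun x r => r ^ k * f (x * r)) (F' := fun x r => r ^ (k + 1) * deriv f (x * r))
      (bound := fun _ => C) hS ?_ ?_ ?_ ?_ ?_ ?_).2
    · filter_upwards [hS] with x hx
      have := (hcont k hf x (le_of_lt hx)).intervalIntegrable_of_Icc
        (μ := MeasureTheory.volume) zero_le_one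
      exact this.aestronglyMeasurable_restrict_uIoc
    · exact (hcont k hf t hT1.le).intervalIntegrable_of_Icc zero_le_one
    · have := (hcont (k + 1) hf' t hT1.le).intervalIntegrable_of_Icc
        (μ := MeasureTheory.volume) zero_le_one
      exact this.aestronglyMeasurable_restrict_uIoc
    · refine Filter.Eventually.of_forall fun r hr x hx => ?_
      rw [uIoc_of_le zero_le_one] at hr
      have hr' : r ∈ Icc (0 : ℝ) 1 := ⟨hr.1.le, hr.2⟩
      rw [norm_mul, norm_pow, Real.norm_eq_abs, abs_of_nonneg hr'.1]
      refine (mul_le_of_le_one_left (norm_nonneg _) (pow_le_one₀ hr'.1 hr'.2)).trans ?_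
      exact hC _ (hmul hT2 (le_of_lt hx) hr').1
    · exact intervalIntegrable_const
    · refine Filter.Eventually.of_forall fun r hr x hx => ?_
      rw [uIoc_of_le zero_le_one] at hr
      have hr' : r ∈ Icc (0 : ℝ) 1 := ⟨hr.1.le, hr.2⟩
      have h1 : HasDerivAt f (deriv f (x * r)) (x * r) :=
        ((hf.contDiffAt (isOpen_Ioo.mem_nhds (hmul hT2 (le_of_lt hx) hr').2)).differentiableAt
          (by simp)).hasDerivAt
      have h2 := (h1.comp x ((hasDerivAt_id x).mul_const r)).const_mul (r ^ k)
      refine h2.congr_deriv ?_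
      ring
  induction n with
  | zero =>
    intro k f hf
    exact contDiffOn_zero.2 fun t ht => (key k hf t ht).continuousAt.continuousWithinAt
  | succ n ih =>
    intro k f hf
    push_cast
    rw [contDiffOn_succ_iff_deriv_of_isOpen isOpen_Ioo]
    refine ⟨fun t ht => (key k hf t ht).differentiableAt.differentiableWithinAt, by simp, ?_⟩
    exact (ih (k + 1) (hf.deriv_of_isOpen isOpen_Ioo (by simp))).congr
      fun t ht => (key k hf t ht).deriv

/-- Hadamard's lemma in one variable. -/
lemma exists_smooth_quotient {δ : ℝ} {f : ℝ → ℝ} (hf : ContDiffOn ℝ ∞ f (Ioo (-δ) δ))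
    (h0 : f 0 = 0) : ∃ g : ℝ → ℝ, ContDiffOn ℝ ∞ g (Ioo (-δ) δ) ∧
      (∀ t ∈ Ioo (-δ) δ, f t = t * g t) ∧ g 0 = deriv f 0 := by
  have hf' : ContDiffOn ℝ ∞ (deriv f) (Ioo (-δ) δ) := hf.deriv_of_isOpen isOpen_Ioo (by simp)
  refine ⟨fun t => ∫ r in (0 : ℝ)..1, r ^ 0 * deriv f (t * r), ?_, ?_, by simp⟩
  · rw [contDiffOn_infty]
    exact fun n => contDiffOn_mul_integral n 0 hf'
  · intro t ht
    have hmem : ∀ r ∈ uIcc (0 : ℝ) 1, t * r ∈ Ioo (-δ) δ := by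
      intro r hr
      rw [uIcc_of_le zero_le_one] at hr
      refine abs_lt.1 ?_
      rw [abs_mul, abs_of_nonneg hr.1]
      exact (mul_le_of_le_one_right (abs_nonneg _) hr.2).trans_lt (abs_lt.2 ht)
    have h1 := intervalIntegral.integral_eq_sub_of_hasDerivAt (a := 0) (b := 1)
      (f := fun r => f (t * r)) (f' := fun r => t * deriv f (t * r))
      (fun r hr => by
        have h2 : HasDerivAt f (deriv f (t * r)) (t * r) :=
          ((hf.contDiffAt (isOpen_Ioo.mem_nhds (hmem r hr))).differentiableAt
            (by simp)).hasDerivAt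
        have h3 := h2.comp r ((hasDerivAt_id r).const_mul t)
        refine h3.congr_deriv ?_
        ring)
      (ContinuousOn.intervalIntegrable (continuousOn_const.mul
        (hf'.continuousOn.comp (by fun_prop) hmem)))
    simp only [mul_one, mul_zero, h0, sub_zero] at h1
    rw [← h1, intervalIntegral.integral_const_mul]
    simp

end Orders

/-! ### The fourth order linear equation and its Taylor expansions. -/

section LinearSystem

/-- Near `0`, `y 0, …, y 3` solve the first order system equivalent to the equation
`∂⁴ y = B ∂² y + b₁ ∂ y + b₀ y`, where `∂ = a⁻¹ d/dt`. -/
structure SolvesSystem (a B b₁ b₀ : ℝ → ℝ) (y : Fin 4 → ℝ → ℝ) : Prop where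
  deriv_zero : ∀ᶠ t in 𝓝 (0 : ℝ), HasDerivAt (y 0) (a t * y 1 t) t
  deriv_one : ∀ᶠ t in 𝓝 (0 : ℝ), HasDerivAt (y 1) (a t * y 2 t) t
  deriv_two : ∀ᶠ t in 𝓝 (0 : ℝ), HasDerivAt (y 2) (a t * y 3 t) t
  deriv_three : ∀ᶠ t in 𝓝 (0 : ℝ),
    HasDerivAt (y 3) (a t * (B t * y 2 t + b₁ t * y 1 t + b₀ t * y 0 t)) t

/-- In the parameter `s` the operator `a⁻¹ d/dt` is `d/ds`; all expansions below are in powers of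
`s`. -/
lemma exists_primitive {δ : ℝ} (hδ : 0 < δ) {a : ℝ → ℝ} (ha : ContinuousOn a (Ioo (-δ) δ)) :
    ∃ s : ℝ → ℝ, s 0 = 0 ∧ ∀ᶠ t in 𝓝 (0 : ℝ), HasDerivAt s (a t) t := by
  refine ⟨fun t => ∫ r in (0 : ℝ)..t, a r, by simp, ?_⟩
  filter_upwards [Ioo_mem_nhds (neg_lt_zero.2 hδ) hδ] with t ht
  have hsub : uIcc 0 t ⊆ Ioo (-δ) δ := by
    intro x hx
    rcases mem_uIcc.1 hx with h | h
    · exact ⟨by linarith [h.1], by linarith [h.2, ht.2]⟩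
    · exact ⟨by linarith [h.1, ht.1], by linarith [h.2]⟩
  exact intervalIntegral.integral_hasDerivAt_right (ha.mono hsub).intervalIntegrable
    (ha.stronglyMeasurableAtFilter isOpen_Ioo t ht) (ha.continuousAt (isOpen_Ioo.mem_nhds ht))

variable {a B b₁ b₀ s : ℝ → ℝ} {y : Fin 4 → ℝ → ℝ}

/-- Uniqueness for a linear system whose Lipschitz constant `κ t` stays bounded near `0`. It serves
to show that the curve of vertical lines stays in the span of its jet at `0`. -/
lemma SolvesSystem.eventually_eq_zero (hy : SolvesSystem a B b₁ b₀ y) (ha : ContinuousAt a 0)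
    (hB : ContinuousAt B 0) (h₁ : ContinuousAt b₁ 0) (h₀ : ContinuousAt b₀ 0)
    (hy0 : ∀ k, y k 0 = 0) : ∀ᶠ t in 𝓝 (0 : ℝ), ∀ k, y k t = 0 := by
  let v : ℝ → (Fin 4 → ℝ) → (Fin 4 → ℝ) := fun t w =>
    ![a t * w 1, a t * w 2, a t * w 3, a t * (B t * w 2 + b₁ t * w 1 + b₀ t * w 0)]
  let κ : ℝ → ℝ := fun t => |a t| * (1 + |B t| + |b₁ t| + |b₀ t|)
  have hκ : ContinuousAt κ 0 := by fun_prop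
  have hκb : ∀ᶠ t in 𝓝 (0 : ℝ), κ t < κ 0 + 1 := hκ.tendsto.eventually (gt_mem_nhds (by linarith))
  have hκ0 : 0 ≤ κ 0 + 1 := by positivity
  have hlip : ∀ᶠ t in 𝓝 (0 : ℝ), LipschitzOnWith ⟨κ 0 + 1, hκ0⟩ (v t) univ := by
    filter_upwards [hκb] with t ht
    refine LipschitzWith.lipschitzOnWith (LipschitzWith.of_dist_le_mul fun w w' => ?_)
    have hd : ∀ k, |w k - w' k| ≤ dist w w' := fun k => by
      rw [← Real.dist_eq]; exact dist_le_pi_dist w w' k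
    have hd0 : 0 ≤ dist w w' := dist_nonneg
    have hA : |a t| ≤ κ t := by
      refine le_mul_of_one_le_right (abs_nonneg _) ?_
      have := abs_nonneg (B t); have := abs_nonneg (b₁ t); have := abs_nonneg (b₀ t)
      linarith
    have hle : ∀ k, |a t * w k - a t * w' k| ≤ (κ 0 + 1) * dist w w' := fun k => by
      rw [← mul_sub, abs_mul]
      exact mul_le_mul (hA.trans ht.le) (hd k) (abs_nonneg _) hκ0
    refine (dist_pi_le_iff (by positivity)).2 fun k => ?_
    rw [Real.dist_eq]
    fin_cases k
    · exact hle 1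
    · exact hle 2
    · exact hle 3
    · change |a t * (B t * w 2 + b₁ t * w 1 + b₀ t * w 0) -
        a t * (B t * w' 2 + b₁ t * w' 1 + b₀ t * w' 0)| ≤ _
      have h1 : |B t * (w 2 - w' 2) + b₁ t * (w 1 - w' 1) + b₀ t * (w 0 - w' 0)| ≤
          (1 + |B t| + |b₁ t| + |b₀ t|) * dist w w' := by
        refine (abs_add_three _ _ _).trans ?_
        rw [abs_mul, abs_mul, abs_mul]
        have e1 := mul_le_mul_of_nonneg_left (hd 2) (abs_nonneg (B t))
        have e2 := mul_le_mul_of_nonneg_left (hd 1) (abs_nonneg (b₁ t))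
        have e3 := mul_le_mul_of_nonneg_left (hd 0) (abs_nonneg (b₀ t))
        linarith
      have h2 : a t * (B t * w 2 + b₁ t * w 1 + b₀ t * w 0) -
          a t * (B t * w' 2 + b₁ t * w' 1 + b₀ t * w' 0) =
          a t * (B t * (w 2 - w' 2) + b₁ t * (w 1 - w' 1) + b₀ t * (w 0 - w' 0)) := by ring
      rw [h2, abs_mul]
      calc |a t| * |B t * (w 2 - w' 2) + b₁ t * (w 1 - w' 1) + b₀ t * (w 0 - w' 0)|
          ≤ |a t| * ((1 + |B t| + |b₁ t| + |b₀ t|) * dist w w') :=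
            mul_le_mul_of_nonneg_left h1 (abs_nonneg _)
        _ = κ t * dist w w' := by rw [← mul_assoc]
        _ ≤ (κ 0 + 1) * dist w w' := mul_le_mul_of_nonneg_right ht.le hd0
  have h := ODE_solution_unique_of_eventually (v := v) (s := fun _ => univ)
    (f := fun t k => y k t) (g := fun _ => 0) (t₀ := 0) hlip
    (by
      filter_upwards [hy.deriv_zero, hy.deriv_one, hy.deriv_two, hy.deriv_three]
        with t t0 t1 t2 t3
      refine ⟨hasDerivAt_pi.2 fun k => ?_, mem_univ _⟩
      fin_cases k
      · exact t0
      · exact t1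
      · exact t2
      · exact t3)
    (by
      refine Filter.Eventually.of_forall fun t => ⟨?_, mem_univ _⟩
      have : v t 0 = 0 := by
        ext k
        fin_cases k <;> simp [v]
      rw [this]
      exact hasDerivAt_const _ _)
    (by ext k; exact hy0 k)
  filter_upwards [h] with t ht k
  exact congrFun ht k

/-- One step of bootstrapping: the polynomial in `hz` is the `s`-derivative of the one in the
conclusion, so integration gains one order. -/
lemma VanishesTo.sub_polynomial {x z : ℝ → ℝ} {n : ℕ} (ha : ContinuousAt a 0)
    (hs : ∀ᶠ t in 𝓝 (0 : ℝ), HasDerivAt s (a t) t) (hs0 : s 0 = 0)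
    (hx : ∀ᶠ t in 𝓝 (0 : ℝ), HasDerivAt x (a t * z t) t) (c₁ c₂ c₃ c₄ c₅ : ℝ)
    (hz : VanishesTo n (fun t => z t -
      (c₁ + 2 * c₂ * s t + 3 * c₃ * s t ^ 2 + 4 * c₄ * s t ^ 3 + 5 * c₅ * s t ^ 4))) :
    VanishesTo (n + 1) (fun t => x t -
      (x 0 + c₁ * s t + c₂ * s t ^ 2 + c₃ * s t ^ 3 + c₄ * s t ^ 4 + c₅ * s t ^ 5)) := by
  refine VanishesTo.primitive (f' := fun t => a t * (z t -
      (c₁ + 2 * c₂ * s t + 3 * c₃ * s t ^ 2 + 4 * c₄ * s t ^ 3 + 5 * c₅ * s t ^ 4))) ?_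
    (by simp [hs0]) ?_
  · filter_upwards [hs, hx] with t ht hxt
    refine (hxt.sub (((((hasDerivAt_const t (x 0)).add (ht.const_mul c₁)).add
      ((ht.pow 2).const_mul c₂)).add ((ht.pow 3).const_mul c₃)).add
      ((ht.pow 4).const_mul c₄) |>.add ((ht.pow 5).const_mul c₅))).congr_deriv ?_
    norm_num
    ring
  · have := (VanishesTo.of_continuousAt ha).mul hz
    rwa [zero_add] at this

namespace SolvesSystem

/-- Four integrations starting from a bounded fourth derivative. Order 4 suffices: in the osculating
form this coordinate is multiplied only by one of order 3, and products are needed modulo order 7.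
-/
lemma vanishesTo_of_one (hy : SolvesSystem a B b₁ b₀ y) (ha : ContinuousAt a 0)
    (hB : ContinuousAt B 0) (h₁ : ContinuousAt b₁ 0) (h₀ : ContinuousAt b₀ 0)
    (hs : ∀ᶠ t in 𝓝 (0 : ℝ), HasDerivAt s (a t) t) (hs0 : s 0 = 0)
    (y0 : y 0 0 = 0) (y1 : y 1 0 = 1) (y2 : y 2 0 = 0) (y3 : y 3 0 = 0) :
    VanishesTo 4 (fun t => y 0 t - s t) := by
  have c0 := hy.deriv_zero.self_of_nhds.continuousAt
  have c1 := hy.deriv_one.self_of_nhds.continuousAt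
  have c2 := hy.deriv_two.self_of_nhds.continuousAt
  have d3 : VanishesTo 1 (fun t => y 3 t) := by
    have := VanishesTo.sub_polynomial ha hs hs0 hy.deriv_three 0 0 0 0 0 (n := 0)
      (.of_continuousAt (by have := hs.self_of_nhds.continuousAt; fun_prop))
    exact this.congr fun t => by rw [y3]; ring
  have d2 : VanishesTo 2 (fun t => y 2 t) :=
    (VanishesTo.sub_polynomial ha hs hs0 hy.deriv_two 0 0 0 0 0 (n := 1)
      (d3.congr fun t => by ring)).congr fun t => by rw [y2]; ring
  have d1 : VanishesTo 3 (fun t => y 1 t - 1) :=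
    (VanishesTo.sub_polynomial ha hs hs0 hy.deriv_one 0 0 0 0 0 (n := 2)
      (d2.congr fun t => by ring)).congr fun t => by rw [y1]; ring
  exact (VanishesTo.sub_polynomial ha hs hs0 hy.deriv_zero 1 0 0 0 0 (n := 3)
      (d1.congr fun t => by ring)).congr fun t => by rw [y0]; ring

/-- A first pass bounds the jet of the solution. Put back into the equation, it gives a fourth
derivative `B 0 + O(t)`, as the terms with `b₁` and `b₀` already vanish at `0`; four integrations
produce the correction in `s ^ 4`. -/
lemma vanishesTo_of_two (hy : SolvesSystem a B b₁ b₀ y) (ha : ContinuousAt a 0)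
    (hB : VanishesTo 1 (fun t => B t - B 0)) (hBc : ContinuousAt B 0)
    (h₁ : ContinuousAt b₁ 0) (h₀ : ContinuousAt b₀ 0)
    (hs : ∀ᶠ t in 𝓝 (0 : ℝ), HasDerivAt s (a t) t) (hs0 : s 0 = 0)
    (y0 : y 0 0 = 0) (y1 : y 1 0 = 0) (y2 : y 2 0 = 1) (y3 : y 3 0 = 0) :
    VanishesTo 5 (fun t => y 0 t - (s t ^ 2 / 2 + B 0 * s t ^ 4 / 24)) := by
  have c0 := hy.deriv_zero.self_of_nhds.continuousAt
  have c1 := hy.deriv_one.self_of_nhds.continuousAt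
  have c2 := hy.deriv_two.self_of_nhds.continuousAt
  have d3 : VanishesTo 1 (fun t => y 3 t) := by
    have := VanishesTo.sub_polynomial ha hs hs0 hy.deriv_three 0 0 0 0 0 (n := 0)
      (.of_continuousAt (by have := hs.self_of_nhds.continuousAt; fun_prop))
    exact this.congr fun t => by rw [y3]; ring
  have d2 : VanishesTo 2 (fun t => y 2 t - 1) :=
    (VanishesTo.sub_polynomial ha hs hs0 hy.deriv_two 0 0 0 0 0 (n := 1)
      (d3.congr fun t => by ring)).congr fun t => by rw [y2]; ring
  have d1' : VanishesTo 1 (fun t => y 1 t) := by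
    have := VanishesTo.of_hasDerivAt hy.deriv_one.self_of_nhds
    exact this.congr fun t => by rw [y1]; ring
  have d0' : VanishesTo 1 (fun t => y 0 t) := by
    have := VanishesTo.of_hasDerivAt hy.deriv_zero.self_of_nhds
    exact this.congr fun t => by rw [y0]; ring
  have e3 : VanishesTo 2 (fun t => y 3 t - B 0 * s t) := by
    have := VanishesTo.sub_polynomial ha hs hs0 hy.deriv_three (B 0) 0 0 0 0 (n := 1) <| by
      have t1 := (VanishesTo.of_continuousAt hBc).mul (d2.mono one_le_two)
      have t2 := (VanishesTo.of_continuousAt h₁).mul d1'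
      have t3 := (VanishesTo.of_continuousAt h₀).mul d0'
      exact (((t1.add t2).add t3).add hB).congr fun t => by ring
    exact this.congr fun t => by rw [y3]; ring
  have e2 : VanishesTo 3 (fun t => y 2 t - (1 + B 0 / 2 * s t ^ 2)) :=
    (VanishesTo.sub_polynomial ha hs hs0 hy.deriv_two 0 (B 0 / 2) 0 0 0 (n := 2)
      (e3.congr fun t => by ring)).congr fun t => by rw [y2]; ring
  have e1 : VanishesTo 4 (fun t => y 1 t - (s t + B 0 / 6 * s t ^ 3)) :=
    (VanishesTo.sub_polynomial ha hs hs0 hy.deriv_one 1 0 (B 0 / 6) 0 0 (n := 3)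
      (e2.congr fun t => by ring)).congr fun t => by rw [y1]; ring
  exact (VanishesTo.sub_polynomial ha hs hs0 hy.deriv_zero 0 (1 / 2) 0 (B 0 / 24) 0 (n := 4)
      (e1.congr fun t => by ring)).congr fun t => by rw [y0]; ring

/-- The same two passes, one order further: the second derivative is `s + O(t ^ 2)` and the lower
ones are `O(t ^ 2)`, so to the order kept only `B 0` matters. -/
lemma vanishesTo_of_three (hy : SolvesSystem a B b₁ b₀ y) (ha : ContinuousAt a 0)
    (hB : VanishesTo 1 (fun t => B t - B 0)) (hBc : ContinuousAt B 0)
    (h₁ : ContinuousAt b₁ 0) (h₀ : ContinuousAt b₀ 0)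
    (hs : ∀ᶠ t in 𝓝 (0 : ℝ), HasDerivAt s (a t) t) (hs0 : s 0 = 0)
    (y0 : y 0 0 = 0) (y1 : y 1 0 = 0) (y2 : y 2 0 = 0) (y3 : y 3 0 = 1) :
    VanishesTo 6 (fun t => y 0 t - (s t ^ 3 / 6 + B 0 * s t ^ 5 / 120)) := by
  have c0 := hy.deriv_zero.self_of_nhds.continuousAt
  have c1 := hy.deriv_one.self_of_nhds.continuousAt
  have c2 := hy.deriv_two.self_of_nhds.continuousAt
  have s1 : VanishesTo 1 s := by
    have := VanishesTo.of_hasDerivAt hs.self_of_nhds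
    exact this.congr fun t => by rw [hs0]; ring
  have d3 : VanishesTo 1 (fun t => y 3 t - 1) := by
    have := VanishesTo.sub_polynomial ha hs hs0 hy.deriv_three 0 0 0 0 0 (n := 0)
      (.of_continuousAt (by have := hs.self_of_nhds.continuousAt; fun_prop))
    exact this.congr fun t => by rw [y3]; ring
  have d2 : VanishesTo 2 (fun t => y 2 t - s t) :=
    (VanishesTo.sub_polynomial ha hs hs0 hy.deriv_two 1 0 0 0 0 (n := 1)
      (d3.congr fun t => by ring)).congr fun t => by rw [y2]; ring
  have d1 : VanishesTo 3 (fun t => y 1 t - s t ^ 2 / 2) :=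
    (VanishesTo.sub_polynomial ha hs hs0 hy.deriv_one 0 (1 / 2) 0 0 0 (n := 2)
      (d2.congr fun t => by ring)).congr fun t => by rw [y1]; ring
  have d0 : VanishesTo 4 (fun t => y 0 t - s t ^ 3 / 6) :=
    (VanishesTo.sub_polynomial ha hs hs0 hy.deriv_zero 0 0 (1 / 6) 0 0 (n := 3)
      (d1.congr fun t => by ring)).congr fun t => by rw [y0]; ring
  have d1' : VanishesTo 2 (fun t => y 1 t) :=
    ((d1.mono (by norm_num)).add ((s1.pow 2).const_mul (1 / 2))).congr fun t => by ring
  have d0' : VanishesTo 2 (fun t => y 0 t) :=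
    ((d0.mono (by norm_num)).add (((s1.pow 3).mono (m := 2) (by norm_num)).const_mul
      (1 / 6))).congr fun t => by ring
  have e3 : VanishesTo 3 (fun t => y 3 t - (1 + B 0 / 2 * s t ^ 2)) := by
    have := VanishesTo.sub_polynomial ha hs hs0 hy.deriv_three 0 (B 0 / 2) 0 0 0 (n := 2) <| by
      have t1 := (VanishesTo.of_continuousAt hBc).mul d2
      have t2 := (VanishesTo.of_continuousAt h₁).mul d1'
      have t3 := (VanishesTo.of_continuousAt h₀).mul d0'
      exact (((t1.add t2).add t3).add (hB.mul s1)).congr fun t => by ring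
    exact this.congr fun t => by rw [y3]; ring
  have e2 : VanishesTo 4 (fun t => y 2 t - (s t + B 0 / 6 * s t ^ 3)) :=
    (VanishesTo.sub_polynomial ha hs hs0 hy.deriv_two 1 0 (B 0 / 6) 0 0 (n := 3)
      (e3.congr fun t => by ring)).congr fun t => by rw [y2]; ring
  have e1 : VanishesTo 5 (fun t => y 1 t - (s t ^ 2 / 2 + B 0 / 24 * s t ^ 4)) :=
    (VanishesTo.sub_polynomial ha hs hs0 hy.deriv_one 0 (1 / 2) 0 (B 0 / 24) 0 (n := 4)
      (e2.congr fun t => by ring)).congr fun t => by rw [y1]; ring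
  exact (VanishesTo.sub_polynomial ha hs hs0 hy.deriv_zero 0 0 (1 / 6) 0 (B 0 / 120) (n := 5)
      (e1.congr fun t => by ring)).congr fun t => by rw [y0]; ring

end SolvesSystem

end LinearSystem

/-! ### The conic with contact of order four. -/

section OsculatingConic

variable {s x₁ x₂ x₃ : ℝ → ℝ} {β : ℝ}

/-- The threshold is 7 because the curve with coordinates `x₁, x₂, x₃` vanishes simply at `0`:
contact `O(t ^ 5)` for its quotient by `t` means `O(t ^ 7)` for the curve itself. -/
lemma vanishesTo_seven_products (s1 : VanishesTo 1 s)
    (h₁ : VanishesTo 4 (fun t => x₁ t - s t))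
    (h₂ : VanishesTo 5 (fun t => x₂ t - (s t ^ 2 / 2 + β * s t ^ 4 / 24)))
    (h₃ : VanishesTo 6 (fun t => x₃ t - (s t ^ 3 / 6 + β * s t ^ 5 / 120))) :
    VanishesTo 7 (fun t => x₁ t * x₃ t - (s t ^ 4 / 6 + β * s t ^ 6 / 120)) ∧
    VanishesTo 7 (fun t => x₂ t ^ 2 - (s t ^ 4 / 4 + β * s t ^ 6 / 24)) ∧
    VanishesTo 7 (fun t => x₂ t * x₃ t - s t ^ 5 / 12) ∧
    VanishesTo 7 (fun t => x₃ t ^ 2 - s t ^ 6 / 36) := by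
  have x1 : VanishesTo 1 x₁ := ((h₁.mono (by norm_num)).add s1).congr fun t => by ring
  have x2 : VanishesTo 2 x₂ := ((h₂.mono (m := 2) (by norm_num)).add
    (((s1.pow 2).const_mul (1 / 2)).add
      (((s1.pow 4).mono (m := 2) (by norm_num)).const_mul (β / 24)))).congr fun t => by ring
  have p3 : VanishesTo 3 (fun t => s t ^ 3 / 6 + β * s t ^ 5 / 120) :=
    (((s1.pow 3).const_mul (1 / 6)).add
      (((s1.pow 5).mono (m := 3) (by norm_num)).const_mul (β / 120))).congr fun t => by ring
  have x3 : VanishesTo 3 x₃ := ((h₃.mono (m := 3) (by norm_num)).add p3).congr fun t => by ring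
  have p2 : VanishesTo 2 (fun t => s t ^ 2 / 2 + β * s t ^ 4 / 24) :=
    (((s1.pow 2).const_mul (1 / 2)).add
      (((s1.pow 4).mono (m := 2) (by norm_num)).const_mul (β / 24))).congr fun t => by ring
  refine ⟨?_, ?_, ?_, ?_⟩
  · exact ((h₁.mul x3).add (s1.mul h₃)).congr fun t => by ring
  · exact ((h₂.mul x2).add ((p2.mul h₂).add
      (((s1.pow 8).mono (m := 7) (by norm_num)).const_mul (β ^ 2 / 576)))).congr fun t => by ring
  · exact ((((h₂.mul x3).mono (m := 7) (by norm_num)).add ((p2.mul h₃).mono (m := 7)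
      (by norm_num))).add ((((s1.pow 7).const_mul (β / 240 + β / 144)).add
      (((s1.pow 9).mono (m := 7) (by norm_num)).const_mul (β ^ 2 / 2880))))).congr
      fun t => by ring
  · exact ((((h₃.mul x3).mono (m := 7) (by norm_num)).add ((p3.mul h₃).mono (m := 7)
      (by norm_num))).add ((((s1.pow 8).mono (m := 7) (by norm_num)).const_mul (β / 360)).add
      (((s1.pow 10).mono (m := 7) (by norm_num)).const_mul (β ^ 2 / 14400)))).congr
      fun t => by ring

/-- The constants `2/3` and `7/10` cancel `s ^ 4` and `s ^ 6`: `-1/6 + (2/3)(1/4) = 0` and `-1/120 +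
(2/3)(1/24) - (7/10)(1/36) = 0`. No `s ^ 5` occurs. -/
lemma vanishesTo_osculating (s1 : VanishesTo 1 s)
    (h₁ : VanishesTo 4 (fun t => x₁ t - s t))
    (h₂ : VanishesTo 5 (fun t => x₂ t - (s t ^ 2 / 2 + β * s t ^ 4 / 24)))
    (h₃ : VanishesTo 6 (fun t => x₃ t - (s t ^ 3 / 6 + β * s t ^ 5 / 120))) :
    VanishesTo 7 (fun t => -(x₁ t * x₃ t) + 2 / 3 * x₂ t ^ 2 - 7 / 10 * β * x₃ t ^ 2) := by
  obtain ⟨q13, q22, -, q33⟩ := vanishesTo_seven_products s1 h₁ h₂ h₃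
  exact (((q22.const_mul (2 / 3)).sub q13).sub (q33.const_mul (7 / 10 * β))).congr
    fun t => by ring

/-- The coefficients of `s ^ 2, …, s ^ 6` give five successive conditions on six unknowns; all are
expressed through `c₁₃`. -/
lemma osculating_unique {a c₁₁ c₁₂ c₁₃ c₂₂ c₂₃ c₃₃ : ℝ} (hs : HasDerivAt s a 0) (hs0 : s 0 = 0)
    (ha : a ≠ 0) (h₁ : VanishesTo 4 (fun t => x₁ t - s t))
    (h₂ : VanishesTo 5 (fun t => x₂ t - (s t ^ 2 / 2 + β * s t ^ 4 / 24)))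
    (h₃ : VanishesTo 6 (fun t => x₃ t - (s t ^ 3 / 6 + β * s t ^ 5 / 120)))
    (h : VanishesTo 7 (fun t => c₁₁ * x₁ t ^ 2 + c₁₂ * (x₁ t * x₂ t) + c₁₃ * (x₁ t * x₃ t) +
      c₂₂ * x₂ t ^ 2 + c₂₃ * (x₂ t * x₃ t) + c₃₃ * x₃ t ^ 2)) :
    c₁₁ = 0 ∧ c₁₂ = 0 ∧ c₂₂ = -(2 / 3) * c₁₃ ∧ c₂₃ = 0 ∧ c₃₃ = 7 / 10 * β * c₁₃ := by
  have s1 : VanishesTo 1 s := by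
    have := VanishesTo.of_hasDerivAt hs
    exact this.congr fun t => by rw [hs0]; ring
  obtain ⟨q13, q22, q23, q33⟩ := vanishesTo_seven_products s1 h₁ h₂ h₃
  have x1 : VanishesTo 1 x₁ := ((h₁.mono (by norm_num)).add s1).congr fun t => by ring
  have x2 : VanishesTo 2 x₂ := ((h₂.mono (m := 2) (by norm_num)).add
    (((s1.pow 2).const_mul (1 / 2)).add
      (((s1.pow 4).mono (m := 2) (by norm_num)).const_mul (β / 24)))).congr fun t => by ring
  have r : VanishesTo 7 (fun t => c₁₁ * x₁ t ^ 2 + c₁₂ * (x₁ t * x₂ t) +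
      (c₁₃ / 6 + c₂₂ / 4) * s t ^ 4 + c₂₃ / 12 * s t ^ 5 +
      (c₁₃ * β / 120 + c₂₂ * β / 24 + c₃₃ / 36) * s t ^ 6) :=
    (h.sub ((((q13.const_mul c₁₃).add (q22.const_mul c₂₂)).add (q23.const_mul c₂₃)).add
      (q33.const_mul c₃₃))).congr fun t => by ring
  have e11 : c₁₁ = 0 := by
    refine VanishesTo.coeff_eq_zero (n := 2) hs hs0 ha ?_
    have t1 := ((h₁.mul x1).add (s1.mul h₁)).mono (m := 3) (by norm_num)
    have t2 := (x1.mul x2).const_mul c₁₂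
    have t4 := ((s1.pow 4).mono (m := 3) (by norm_num)).const_mul (c₁₃ / 6 + c₂₂ / 4)
    have t5 := ((s1.pow 5).mono (m := 3) (by norm_num)).const_mul (c₂₃ / 12)
    have t6 := ((s1.pow 6).mono (m := 3) (by norm_num)).const_mul
      (c₁₃ * β / 120 + c₂₂ * β / 24 + c₃₃ / 36)
    exact ((((((r.mono (m := 3) (by norm_num)).sub (t1.const_mul c₁₁)).sub t2).sub t4).sub
      t5).sub t6).congr fun t => by ring
  subst e11
  have e12 : c₁₂ / 2 = 0 := by
    refine VanishesTo.coeff_eq_zero (n := 3) hs hs0 ha ?_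
    have t1 := ((h₁.mul x2).add ((s1.mul h₂).mono (m := 6) (by norm_num))).mono (m := 4)
      (by norm_num)
    have t2 := ((s1.pow 5).mono (m := 4) (by norm_num)).const_mul (c₁₂ * β / 24)
    have t4 := (s1.pow 4).const_mul (c₁₃ / 6 + c₂₂ / 4)
    have t5 := ((s1.pow 5).mono (m := 4) (by norm_num)).const_mul (c₂₃ / 12)
    have t6 := ((s1.pow 6).mono (m := 4) (by norm_num)).const_mul
      (c₁₃ * β / 120 + c₂₂ * β / 24 + c₃₃ / 36)
    exact ((((((r.mono (m := 4) (by norm_num)).sub (t1.const_mul c₁₂)).sub t2).sub t4).sub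
      t5).sub t6).congr fun t => by ring
  have e12' : c₁₂ = 0 := by linarith
  subst e12'
  have e4 : c₁₃ / 6 + c₂₂ / 4 = 0 := by
    refine VanishesTo.coeff_eq_zero (n := 4) hs hs0 ha ?_
    have t5 := (s1.pow 5).const_mul (c₂₃ / 12)
    have t6 := ((s1.pow 6).mono (m := 5) (by norm_num)).const_mul
      (c₁₃ * β / 120 + c₂₂ * β / 24 + c₃₃ / 36)
    exact (((r.mono (m := 5) (by norm_num)).sub t5).sub t6).congr fun t => by ring
  rw [e4] at r
  have e5 : c₂₃ / 12 = 0 := by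
    refine VanishesTo.coeff_eq_zero (n := 5) hs hs0 ha ?_
    have t6 := (s1.pow 6).const_mul (c₁₃ * β / 120 + c₂₂ * β / 24 + c₃₃ / 36)
    exact ((r.mono (m := 6) (by norm_num)).sub t6).congr fun t => by ring
  rw [e5] at r
  have e6 : c₁₃ * β / 120 + c₂₂ * β / 24 + c₃₃ / 36 = 0 := by
    refine VanishesTo.coeff_eq_zero (n := 6) hs hs0 ha ?_
    exact r.congr fun t => by ring
  have e22 : c₂₂ = -(2 / 3) * c₁₃ := by linarith
  refine ⟨rfl, rfl, e22, by linarith, ?_⟩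
  rw [e22] at e6
  linarith

end OsculatingConic

/-! ### Brackets with combinations of fields. -/

section LeibnizSums

variable {E : Type} [NormedAddCommGroup E] [NormedSpace ℝ E]

lemma lieBracket_sum_smul_right {ι : Type} [Fintype ι] {V : E → E} {f : ι → E → ℝ}
    {W : ι → E → E} {x : E} (hf : ∀ i, DifferentiableAt ℝ (f i) x)
    (hW : ∀ i, DifferentiableAt ℝ (W i) x) :
    VectorField.lieBracket ℝ V (fun y => ∑ i, f i y • W i y) x =
      ∑ i, ((fderiv ℝ (f i) x (V x)) • W i x + f i x • VectorField.lieBracket ℝ V (W i) x) := by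
  have h : HasFDerivAt (fun y => ∑ i, f i y • W i y)
      (∑ i, (f i x • fderiv ℝ (W i) x + (fderiv ℝ (f i) x).smulRight (W i x))) x :=
    HasFDerivAt.fun_sum fun i _ => (hf i).hasFDerivAt.smul (hW i).hasFDerivAt
  simp only [VectorField.lieBracket]
  rw [h.fderiv, map_sum, _root_.sum_apply, ← Finset.sum_sub_distrib]
  refine Finset.sum_congr rfl fun i _ => ?_
  simp only [_root_.add_apply, _root_.smul_apply, ContinuousLinearMap.smulRight_apply, map_smul]
  module

end LeibnizSums

/-! ### Adapted frames and their structure functions. -/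

section Frames

/-- `Y 0, …, Y 4` is, over `V`, an adapted frame of the distribution spanned by `Y 0, Y 1`. -/
structure AdaptedFrame (Y : Fin 5 → E5 → E5) (V : Set E5) : Prop where
  isOpen : IsOpen V
  smooth : ∀ i, ContDiffOn ℝ ∞ (Y i) V
  indep : ∀ y ∈ V, LinearIndependent ℝ (fun i => Y i y)
  bracket01 : ∀ y ∈ V, VectorField.lieBracket ℝ (Y 0) (Y 1) y - Y 2 y ∈
    Submodule.span ℝ {Y 0 y, Y 1 y}
  bracket02 : ∀ y ∈ V, VectorField.lieBracket ℝ (Y 0) (Y 2) y - Y 3 y ∈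
    Submodule.span ℝ {Y 0 y, Y 1 y, Y 2 y}
  bracket12 : ∀ y ∈ V, VectorField.lieBracket ℝ (Y 1) (Y 2) y - Y 4 y ∈
    Submodule.span ℝ {Y 0 y, Y 1 y, Y 2 y}

/-- The linear map with the frame as columns. -/
noncomputable def frameMap (Y : Fin 5 → E5 → E5) (y : E5) : (Fin 5 → ℝ) →L[ℝ] E5 :=
  ∑ i, (ContinuousLinearMap.proj (R := ℝ) (φ := fun _ : Fin 5 => ℝ) i).smulRight (Y i y)

/-- The coframe dual to `Y`. -/
noncomputable def coframe (Y : Fin 5 → E5 → E5) (i : Fin 5) (y : E5) : E5 →L[ℝ] ℝ :=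
  (ContinuousLinearMap.proj (R := ℝ) (φ := fun _ : Fin 5 => ℝ) i).comp (frameMap Y y).inverse

/-- The structure functions of the frame. -/
noncomputable def structureFun (Y : Fin 5 → E5 → E5) (i j k : Fin 5) (y : E5) : ℝ :=
  coframe Y k y (VectorField.lieBracket ℝ (Y i) (Y j) y)

lemma frameMap_apply (Y : Fin 5 → E5 → E5) (y : E5) (x : Fin 5 → ℝ) :
    frameMap Y y x = ∑ i, x i • Y i y := by
  simp [frameMap, _root_.sum_apply]

lemma isInvertible_frameMap {Y : Fin 5 → E5 → E5} {y : E5}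
    (h : LinearIndependent ℝ (fun i => Y i y)) : (frameMap Y y).IsInvertible := by
  let b := basisOfLinearIndependentOfCardEqFinrank h (by simp)
  refine ⟨b.equivFun.symm.toContinuousLinearEquiv, ?_⟩
  ext x
  simp [frameMap_apply, b, Module.Basis.equivFun_symm_apply]

namespace AdaptedFrame

variable {Y : Fin 5 → E5 → E5} {V : Set E5} (hY : AdaptedFrame Y V) {y : E5}
include hY

lemma sum_coframe (hy : y ∈ V) (v : E5) : ∑ i, coframe Y i y v • Y i y = v := by
  obtain ⟨e, he⟩ := isInvertible_frameMap (hY.indep y hy)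
  have h1 : (frameMap Y y) ((frameMap Y y).inverse v) = v := by
    rw [← he, ContinuousLinearMap.inverse_equiv]
    exact e.apply_symm_apply v
  rw [frameMap_apply] at h1
  exact h1

lemma coframe_apply (hy : y ∈ V) (i j : Fin 5) :
    coframe Y i y (Y j y) = if j = i then 1 else 0 := by
  have h1 := hY.sum_coframe hy (Y j y)
  have h2 : ∑ k, (coframe Y k y (Y j y) - if j = k then 1 else 0) • Y k y = 0 := by
    simp only [sub_smul, Finset.sum_sub_distrib, h1, ite_smul, one_smul, zero_smul,
      Finset.sum_ite_eq, Finset.mem_univ, if_true, sub_self]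
  have := Fintype.linearIndependent_iff.1 (hY.indep y hy) _ h2 i
  linarith

lemma contDiffAt (hy : y ∈ V) (i : Fin 5) : ContDiffAt ℝ ∞ (Y i) y :=
  (hY.smooth i).contDiffAt (hY.isOpen.mem_nhds hy)

lemma differentiableAt (hy : y ∈ V) (i : Fin 5) : DifferentiableAt ℝ (Y i) y :=
  (hY.contDiffAt hy i).differentiableAt (by simp)

lemma contDiffAt_coframe (hy : y ∈ V) (i : Fin 5) : ContDiffAt ℝ ∞ (coframe Y i) y := by
  have h1 : ContDiffAt ℝ ∞ (frameMap Y) y := by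
    unfold frameMap
    exact ContDiffAt.sum fun i _ => contDiffAt_const.smulRight (hY.contDiffAt hy i)
  obtain ⟨e, he⟩ := isInvertible_frameMap (hY.indep y hy)
  have h2 : ContDiffAt ℝ ∞ (fun y => (frameMap Y y).inverse) y := by
    refine ContDiffAt.comp (g := ContinuousLinearMap.inverse) y ?_ h1
    rw [← he]
    exact contDiffAt_map_inverse e
  exact contDiffAt_const.clm_comp h2

lemma contDiffAt_bracket (hy : y ∈ V) (i j : Fin 5) :
    ContDiffAt ℝ ∞ (VectorField.lieBracket ℝ (Y i) (Y j)) y :=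
  (hY.contDiffAt hy i).lieBracket_vectorField (hY.contDiffAt hy j) (by simp)

lemma contDiffAt_structureFun (hy : y ∈ V) (i j k : Fin 5) :
    ContDiffAt ℝ ∞ (structureFun Y i j k) y :=
  (hY.contDiffAt_coframe hy k).clm_apply (hY.contDiffAt_bracket hy i j)

lemma bracket_eq (hy : y ∈ V) (i j : Fin 5) :
    VectorField.lieBracket ℝ (Y i) (Y j) y = ∑ k, structureFun Y i j k y • Y k y :=
  (hY.sum_coframe hy _).symm

omit hY in
lemma structureFun_swap (i j k : Fin 5) (y : E5) :
    structureFun Y i j k y = -structureFun Y j i k y := by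
  rw [structureFun, VectorField.lieBracket_swap, map_neg, structureFun]

omit hY in
lemma structureFun_self (i k : Fin 5) (y : E5) : structureFun Y i i k y = 0 := by
  have := structureFun_swap (Y := Y) i i k y
  linarith

lemma coframe_span_two (hy : y ∈ V) {v : E5} (hv : v ∈ Submodule.span ℝ {Y 0 y, Y 1 y})
    {k : Fin 5} (hk : 2 ≤ k) : coframe Y k y v = 0 := by
  have h0 : k ≠ 0 := by rintro rfl; exact absurd hk (by decide)
  have h1 : k ≠ 1 := by rintro rfl; exact absurd hk (by decide)
  obtain ⟨r, t, rfl⟩ := Submodule.mem_span_pair.1 hv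
  simp [hY.coframe_apply hy, h0.symm, h1.symm]

lemma coframe_span_three (hy : y ∈ V) {v : E5}
    (hv : v ∈ Submodule.span ℝ {Y 0 y, Y 1 y, Y 2 y}) {k : Fin 5} (hk : 3 ≤ k) :
    coframe Y k y v = 0 := by
  have h0 : k ≠ 0 := by rintro rfl; exact absurd hk (by decide)
  have h1 : k ≠ 1 := by rintro rfl; exact absurd hk (by decide)
  have h2 : k ≠ 2 := by rintro rfl; exact absurd hk (by decide)
  obtain ⟨r, s, t, rfl⟩ := Submodule.mem_span_triple.1 hv
  simp [hY.coframe_apply hy, h0.symm, h1.symm, h2.symm]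

lemma structureFun_01 (hy : y ∈ V) {k : Fin 5} (hk : 2 ≤ k) :
    structureFun Y 0 1 k y = if 2 = k then 1 else 0 := by
  have h := hY.coframe_span_two hy (hY.bracket01 y hy) hk
  rw [map_sub, hY.coframe_apply hy] at h
  exact sub_eq_zero.1 h

lemma structureFun_02 (hy : y ∈ V) {k : Fin 5} (hk : 3 ≤ k) :
    structureFun Y 0 2 k y = if 3 = k then 1 else 0 := by
  have h := hY.coframe_span_three hy (hY.bracket02 y hy) hk
  rw [map_sub, hY.coframe_apply hy] at h
  exact sub_eq_zero.1 h

lemma structureFun_12 (hy : y ∈ V) {k : Fin 5} (hk : 3 ≤ k) :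
    structureFun Y 1 2 k y = if 4 = k then 1 else 0 := by
  have h := hY.coframe_span_three hy (hY.bracket12 y hy) hk
  rw [map_sub, hY.coframe_apply hy] at h
  exact sub_eq_zero.1 h

/-- The components of an iterated bracket. -/
lemma coframe_bracket (hy : y ∈ V) (i p q k : Fin 5) :
    coframe Y k y (VectorField.lieBracket ℝ (Y i) (VectorField.lieBracket ℝ (Y p) (Y q)) y) =
      fderiv ℝ (structureFun Y p q k) y (Y i y) +
        ∑ j, structureFun Y p q j y * structureFun Y i j k y := by
  have h1 : VectorField.lieBracket ℝ (Y p) (Y q) =ᶠ[𝓝 y]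
      fun x => ∑ j, structureFun Y p q j x • Y j x := by
    filter_upwards [hY.isOpen.mem_nhds hy] with x hx using hY.bracket_eq hx p q
  rw [Filter.EventuallyEq.lieBracket_vectorField_eq Filter.EventuallyEq.rfl h1,
    lieBracket_sum_smul_right
      (fun j => (hY.contDiffAt_structureFun hy p q j).differentiableAt (by simp))
      (fun j => hY.differentiableAt hy j), map_sum]
  simp only [map_add, map_smul, hY.coframe_apply hy, Finset.sum_add_distrib, smul_eq_mul,
    mul_ite, mul_one, mul_zero, Finset.sum_ite_eq', Finset.mem_univ, if_true]
  rfl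

lemma fderiv_structureFun_eq_zero (hy : y ∈ V) {p q k : Fin 5} {c : ℝ}
    (h : ∀ x ∈ V, structureFun Y p q k x = c) (v : E5) :
    fderiv ℝ (structureFun Y p q k) y v = 0 := by
  have : structureFun Y p q k =ᶠ[𝓝 y] fun _ => c := by
    filter_upwards [hY.isOpen.mem_nhds hy] with x hx using h x hx
  rw [this.fderiv_eq]
  simp

lemma jacobi (hy : y ∈ V) (k : Fin 5) :
    coframe Y k y (VectorField.lieBracket ℝ (Y 0) (VectorField.lieBracket ℝ (Y 1) (Y 2)) y) =
      -coframe Y k y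
        (VectorField.lieBracket ℝ (Y 2) (VectorField.lieBracket ℝ (Y 0) (Y 1)) y) +
      coframe Y k y
        (VectorField.lieBracket ℝ (Y 1) (VectorField.lieBracket ℝ (Y 0) (Y 2)) y) := by
  rw [VectorField.leibniz_identity_lieBracket minSmoothness_two_le_infty (hY.contDiffAt hy 0)
    (hY.contDiffAt hy 1) (hY.contDiffAt hy 2), map_add,
    VectorField.lieBracket_swap (V := VectorField.lieBracket ℝ (Y 0) (Y 1)), map_neg]

/-- The component along `Y 3` of the Jacobi identity for `Y 0, Y 1, Y 2`. The structure functions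
that would be differentiated are constant for an adapted frame, so the relation is algebraic. With
`jacobi_four` it removes the third bracket from the fourth. -/
lemma jacobi_three (hy : y ∈ V) : structureFun Y 1 2 2 y + structureFun Y 0 4 3 y =
    structureFun Y 0 1 0 y + structureFun Y 1 3 3 y := by
  have h := hY.jacobi hy 3
  rw [hY.coframe_bracket hy, hY.coframe_bracket hy, hY.coframe_bracket hy,
    hY.fderiv_structureFun_eq_zero hy fun x hx => hY.structureFun_12 hx (k := 3) (by decide),
    hY.fderiv_structureFun_eq_zero hy fun x hx => hY.structureFun_01 hx (k := 3) (by decide),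
    hY.fderiv_structureFun_eq_zero hy fun x hx => hY.structureFun_02 hx (k := 3) (by decide)] at h
  simp only [Fin.sum_univ_five] at h
  have e1 := hY.structureFun_01 hy (k := 2) le_rfl
  have e2 := hY.structureFun_01 hy (k := 3) (by decide)
  have e3 := hY.structureFun_01 hy (k := 4) (by decide)
  have e4 := hY.structureFun_02 hy (k := 3) le_rfl
  have e5 := hY.structureFun_02 hy (k := 4) (by decide)
  have e6 := hY.structureFun_12 hy (k := 3) le_rfl
  have e7 := hY.structureFun_12 hy (k := 4) (by decide)
  rw [structureFun_swap 2 0, structureFun_swap 2 1, structureFun_swap 1 0] at h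
  simp [e1, e2, e3, e4, e5, e6, e7, structureFun_self] at h
  linarith

lemma jacobi_four (hy : y ∈ V) : structureFun Y 0 4 4 y =
    structureFun Y 0 1 1 y + structureFun Y 0 2 2 y + structureFun Y 1 3 4 y := by
  have h := hY.jacobi hy 4
  rw [hY.coframe_bracket hy, hY.coframe_bracket hy, hY.coframe_bracket hy,
    hY.fderiv_structureFun_eq_zero hy fun x hx => hY.structureFun_12 hx (k := 4) (by decide),
    hY.fderiv_structureFun_eq_zero hy fun x hx => hY.structureFun_01 hx (k := 4) (by decide),
    hY.fderiv_structureFun_eq_zero hy fun x hx => hY.structureFun_02 hx (k := 4) (by decide)] at h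
  simp only [Fin.sum_univ_five] at h
  have e1 := hY.structureFun_01 hy (k := 2) le_rfl
  have e2 := hY.structureFun_01 hy (k := 3) (by decide)
  have e3 := hY.structureFun_01 hy (k := 4) (by decide)
  have e4 := hY.structureFun_02 hy (k := 3) le_rfl
  have e5 := hY.structureFun_02 hy (k := 4) (by decide)
  have e6 := hY.structureFun_12 hy (k := 3) le_rfl
  have e7 := hY.structureFun_12 hy (k := 4) (by decide)
  rw [structureFun_swap 2 0, structureFun_swap 2 1, structureFun_swap 1 0] at h
  simp [e1, e2, e3, e4, e5, e6, e7, structureFun_self] at h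
  linarith

end AdaptedFrame

end Frames

/-! ### The characteristic field in the coordinates (y, u₄, u₅). -/

section ReducedFields

/-- The coordinates `(y, u₄, u₅)` on the annihilator of the square of the distribution. -/
abbrev N7 : Type := E5 × ℝ × ℝ

/-- The coordinate domain on which `u₅` does not vanish. -/
def regularDomain (V : Set E5) : Set N7 := {z | z.1 ∈ V ∧ z.2.2 ≠ 0}

variable (Y : Fin 5 → E5 → E5)

/-- The derivative of `u₄` or `u₅` along the characteristic field. -/
noncomputable def alpha (j : Fin 5) (z : N7) : ℝ :=
  z.2.1 * (structureFun Y 1 j 3 z.1 * z.2.1 + structureFun Y 1 j 4 z.1 * z.2.2) -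
    z.2.2 * (structureFun Y 0 j 3 z.1 * z.2.1 + structureFun Y 0 j 4 z.1 * z.2.2)

/-- The partial derivative of `alpha` with respect to `u₄`. -/
noncomputable def alphaA (j : Fin 5) (z : N7) : ℝ :=
  2 * z.2.1 * structureFun Y 1 j 3 z.1 + z.2.2 * structureFun Y 1 j 4 z.1 -
    z.2.2 * structureFun Y 0 j 3 z.1

/-- The partial derivative of `alpha` with respect to `u₅`. -/
noncomputable def alphaB (j : Fin 5) (z : N7) : ℝ :=
  z.2.1 * structureFun Y 1 j 4 z.1 - z.2.1 * structureFun Y 0 j 3 z.1 -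
    2 * z.2.2 * structureFun Y 0 j 4 z.1

/-- The derivative of `alpha` along the frame field `Y k`. -/
noncomputable def alphaY (j k : Fin 5) (z : N7) : ℝ :=
  z.2.1 * (fderiv ℝ (structureFun Y 1 j 3) z.1 (Y k z.1) * z.2.1 +
      fderiv ℝ (structureFun Y 1 j 4) z.1 (Y k z.1) * z.2.2) -
    z.2.2 * (fderiv ℝ (structureFun Y 0 j 3) z.1 (Y k z.1) * z.2.1 +
      fderiv ℝ (structureFun Y 0 j 4) z.1 (Y k z.1) * z.2.2)

/-- The characteristic field in the coordinates `(y, u₄, u₅)`. -/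
noncomputable def hRed (z : N7) : N7 :=
  (z.2.1 • Y 1 z.1 - z.2.2 • Y 0 z.1, alpha Y 3 z, alpha Y 4 z)

/-- A basis of the contact hyperplane: the vertical field `ε₁`, three horizontal fields, the
characteristic field and the Euler field. -/
noncomputable def contactBasis : Fin 6 → N7 → N7 :=
  ![fun z => (0, z.2.2⁻¹, 0), fun z => (z.2.2⁻¹ • Y 1 z.1, 0, 0), fun z => (Y 2 z.1, 0, 0),
    fun z => (z.2.1 • Y 4 z.1 - z.2.2 • Y 3 z.1, 0, 0), hRed Y, fun z => (0, z.2.1, z.2.2)]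

/-- The coefficients in the contact basis of the vector with horizontal coordinates `x` and
vertical coordinates `s`, `t`. -/
noncomputable def contactCoef (z : N7) (x : Fin 5 → ℝ) (s t : ℝ) : Fin 6 → ℝ :=
  ![z.2.2 * (s - (t + x 0 / z.2.2 * alpha Y 4 z) / z.2.2 * z.2.1 + x 0 / z.2.2 * alpha Y 3 z),
    z.2.2 * x 1 + z.2.1 * x 0, x 2, -x 3 / z.2.2, -x 0 / z.2.2,
    (t + x 0 / z.2.2 * alpha Y 4 z) / z.2.2]

/-- The condition `hx` is `ς = 0`: it makes the part along `Y 3, Y 4` a multiple of `u₄ Y 4 - u₅ Y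
3`. The component along `Y 0` is absorbed by `hRed`, which brings `alpha` into the vertical
coefficients. -/
lemma sum_contactCoef {z : N7} (hz : z.2.2 ≠ 0) {x : Fin 5 → ℝ} (s t : ℝ)
    (hx : z.2.1 * x 3 + z.2.2 * x 4 = 0) :
    ∑ i, contactCoef Y z x s t i • contactBasis Y i z = (∑ i, x i • Y i z.1, s, t) := by
  have h4 : x 4 = -(z.2.1 * x 3) / z.2.2 := by
    field_simp
    linarith
  simp only [Fin.sum_univ_six, Fin.sum_univ_five, contactCoef, contactBasis, h4]
  refine Prod.ext ?_ (Prod.ext ?_ ?_) <;> simp [hRed]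
  · match_scalars <;> field_simp <;> ring
  · field_simp
    ring
  · field_simp
    ring

/-- The horizontal coordinates of the bracket of the characteristic field with a member of the
contact basis. -/
noncomputable def bracketHor (z : N7) : Fin 6 → Fin 5 → ℝ :=
  ![![0, -z.2.2⁻¹, 0, 0, 0],
    fun k => -structureFun Y 0 1 k z.1 - if 1 = k then alpha Y 4 z / z.2.2 ^ 2 else 0,
    fun k => z.2.1 * structureFun Y 1 2 k z.1 - z.2.2 * structureFun Y 0 2 k z.1,
    fun k => z.2.1 * (z.2.1 * structureFun Y 1 4 k z.1 - z.2.2 * structureFun Y 0 4 k z.1) -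
      z.2.2 * (z.2.1 * structureFun Y 1 3 k z.1 - z.2.2 * structureFun Y 0 3 k z.1) +
      (if 4 = k then alpha Y 3 z else 0) - if 3 = k then alpha Y 4 z else 0,
    0, ![z.2.2, -z.2.1, 0, 0, 0]]

/-- The vertical coordinates of the bracket of the characteristic field with a member of the
contact basis; `j = 3` and `j = 4` correspond to `u₄` and `u₅`. -/
noncomputable def bracketVert (j : Fin 5) (z : N7) : Fin 6 → ℝ :=
  ![-(if 3 = j then alpha Y 4 z / z.2.2 ^ 2 else 0) - z.2.2⁻¹ * alphaA Y j z,
    -z.2.2⁻¹ * alphaY Y j 1 z, -alphaY Y j 2 z,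
    -z.2.1 * alphaY Y j 4 z + z.2.2 * alphaY Y j 3 z, 0, -alpha Y j z]

/-- The coefficients in the contact basis of the bracket of the characteristic field with the
member `j` of this basis. -/
noncomputable def adCoef (j i : Fin 6) (z : N7) : ℝ :=
  contactCoef Y z (bracketHor Y z j) (bracketVert Y 3 z j) (bracketVert Y 4 z j) i

variable {Y} {V : Set E5}

lemma AdaptedFrame.isOpen_regularDomain (hY : AdaptedFrame Y V) : IsOpen (regularDomain V) :=
  (hY.isOpen.preimage continuous_fst).inter
    (isOpen_ne.preimage (continuous_snd.comp continuous_snd))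

namespace AdaptedFrame

variable (hY : AdaptedFrame Y V) {z : N7}
include hY

omit hY in
lemma contDiffOn_comp_fst {F : Type} [NormedAddCommGroup F] [NormedSpace ℝ F] {g : E5 → F}
    (hg : ∀ y ∈ V, ContDiffAt ℝ ∞ g y) :
    ContDiffOn ℝ ∞ (fun z : N7 => g z.1) (Prod.fst ⁻¹' V) := fun z hz =>
  ((hg z.1 hz).comp z contDiffAt_fst).contDiffWithinAt

lemma hasFDerivAt_alpha (hz : z.1 ∈ V) (j : Fin 5) : ∃ L : N7 →L[ℝ] ℝ,
    HasFDerivAt (alpha Y j) L z ∧ ∀ v : N7, L v = v.2.1 * alphaA Y j z + v.2.2 * alphaB Y j z +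
      (z.2.1 * (fderiv ℝ (structureFun Y 1 j 3) z.1 v.1 * z.2.1 +
        fderiv ℝ (structureFun Y 1 j 4) z.1 v.1 * z.2.2) -
      z.2.2 * (fderiv ℝ (structureFun Y 0 j 3) z.1 v.1 * z.2.1 +
        fderiv ℝ (structureFun Y 0 j 4) z.1 v.1 * z.2.2)) := by
  have hc : ∀ p q k, HasFDerivAt (fun z : N7 => structureFun Y p q k z.1)
      ((fderiv ℝ (structureFun Y p q k) z.1).comp (ContinuousLinearMap.fst ℝ _ _)) z :=
    fun p q k => ((hY.contDiffAt_structureFun hz p q k).differentiableAt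
      (by simp)).hasFDerivAt.comp z hasFDerivAt_fst
  have ha : HasFDerivAt (fun z : N7 => z.2.1) ((ContinuousLinearMap.fst ℝ _ _).comp
    (ContinuousLinearMap.snd ℝ E5 (ℝ × ℝ))) z := hasFDerivAt_fst.comp z hasFDerivAt_snd
  have hb : HasFDerivAt (fun z : N7 => z.2.2) ((ContinuousLinearMap.snd ℝ _ _).comp
    (ContinuousLinearMap.snd ℝ E5 (ℝ × ℝ))) z := hasFDerivAt_snd.comp z hasFDerivAt_snd
  refine ⟨_, (ha.mul (((hc 1 j 3).mul ha).add ((hc 1 j 4).mul hb))).sub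
    (hb.mul (((hc 0 j 3).mul ha).add ((hc 0 j 4).mul hb))), fun v => ?_⟩
  simp [alphaA, alphaB]
  ring

lemma fderiv_alpha (hz : z.1 ∈ V) (j : Fin 5) (v : N7) :
    fderiv ℝ (alpha Y j) z v = v.2.1 * alphaA Y j z + v.2.2 * alphaB Y j z +
      (z.2.1 * (fderiv ℝ (structureFun Y 1 j 3) z.1 v.1 * z.2.1 +
        fderiv ℝ (structureFun Y 1 j 4) z.1 v.1 * z.2.2) -
      z.2.2 * (fderiv ℝ (structureFun Y 0 j 3) z.1 v.1 * z.2.1 +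
        fderiv ℝ (structureFun Y 0 j 4) z.1 v.1 * z.2.2)) := by
  obtain ⟨L, hL, h⟩ := hY.hasFDerivAt_alpha hz j
  rw [hL.fderiv, h]

lemma hasFDerivAt_frame (hz : z.1 ∈ V) (k : Fin 5) : HasFDerivAt (fun z : N7 => Y k z.1)
    ((fderiv ℝ (Y k) z.1).comp (ContinuousLinearMap.fst ℝ _ _)) z :=
  (hY.differentiableAt hz k).hasFDerivAt.comp z hasFDerivAt_fst

lemma hasFDerivAt_hRed (hz : z.1 ∈ V) : ∃ L : N7 →L[ℝ] N7, HasFDerivAt (hRed Y) L z ∧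
    ∀ v : N7, L v = (z.2.1 • fderiv ℝ (Y 1) z.1 v.1 + v.2.1 • Y 1 z.1 -
      (z.2.2 • fderiv ℝ (Y 0) z.1 v.1 + v.2.2 • Y 0 z.1),
      fderiv ℝ (alpha Y 3) z v, fderiv ℝ (alpha Y 4) z v) := by
  have ha : HasFDerivAt (fun z : N7 => z.2.1) ((ContinuousLinearMap.fst ℝ _ _).comp
    (ContinuousLinearMap.snd ℝ E5 (ℝ × ℝ))) z := hasFDerivAt_fst.comp z hasFDerivAt_snd
  have hb : HasFDerivAt (fun z : N7 => z.2.2) ((ContinuousLinearMap.snd ℝ _ _).comp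
    (ContinuousLinearMap.snd ℝ E5 (ℝ × ℝ))) z := hasFDerivAt_snd.comp z hasFDerivAt_snd
  have hα : ∀ j, HasFDerivAt (alpha Y j) (fderiv ℝ (alpha Y j) z) z := fun j => by
    obtain ⟨L, hL, -⟩ := hY.hasFDerivAt_alpha hz j
    exact hL.differentiableAt.hasFDerivAt
  refine ⟨_, ((ha.smul (hY.hasFDerivAt_frame hz 1)).sub
    (hb.smul (hY.hasFDerivAt_frame hz 0))).prodMk ((hα 3).prodMk (hα 4)), fun v => ?_⟩
  simp

lemma lieBracket_hRed_lift (hz : z.1 ∈ V) (k : Fin 5) :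
    VectorField.lieBracket ℝ (hRed Y) (fun z => (Y k z.1, 0, 0)) z =
      (∑ i, (z.2.1 * structureFun Y 1 k i z.1 - z.2.2 * structureFun Y 0 k i z.1) • Y i z.1,
        -alphaY Y 3 k z, -alphaY Y 4 k z) := by
  obtain ⟨L, hL, h⟩ := hY.hasFDerivAt_hRed hz
  have h1 : HasFDerivAt (fun z : N7 => ((Y k z.1, 0, 0) : N7)) _ z :=
    (hY.hasFDerivAt_frame hz k).prodMk (hasFDerivAt_const ((0, 0) : ℝ × ℝ) z)
  have h2 : ∑ i, (z.2.1 * structureFun Y 1 k i z.1 - z.2.2 * structureFun Y 0 k i z.1) • Y i z.1 =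
      z.2.1 • VectorField.lieBracket ℝ (Y 1) (Y k) z.1 -
        z.2.2 • VectorField.lieBracket ℝ (Y 0) (Y k) z.1 := by
    rw [hY.bracket_eq hz, hY.bracket_eq hz, Finset.smul_sum, Finset.smul_sum,
      ← Finset.sum_sub_distrib]
    exact Finset.sum_congr rfl fun i _ => by rw [sub_smul, mul_smul, mul_smul]
  rw [VectorField.lieBracket, hL.fderiv, h1.fderiv, h, h2]
  simp only [VectorField.lieBracket, hRed]
  ext1
  · simp
    module
  · ext1 <;> simp [hY.fderiv_alpha hz, alphaY]

lemma lieBracket_hRed_const (hz : z.1 ∈ V) :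
    VectorField.lieBracket ℝ (hRed Y) (fun _ => ((0, 1, 0) : N7)) z =
      (-Y 1 z.1, -alphaA Y 3 z, -alphaA Y 4 z) := by
  obtain ⟨L, hL, h⟩ := hY.hasFDerivAt_hRed hz
  rw [VectorField.lieBracket, hL.fderiv, h]
  simp [hY.fderiv_alpha hz]

lemma lieBracket_hRed_basis (hz : z ∈ regularDomain V) (j : Fin 6) :
    VectorField.lieBracket ℝ (hRed Y) (contactBasis Y j) z =
      (∑ i, bracketHor Y z j i • Y i z.1, bracketVert Y 3 z j, bracketVert Y 4 z j) := by
  obtain ⟨hzV, hb0⟩ := hz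
  have ha : HasFDerivAt (fun z : N7 => z.2.1) ((ContinuousLinearMap.fst ℝ _ _).comp
    (ContinuousLinearMap.snd ℝ E5 (ℝ × ℝ))) z := hasFDerivAt_fst.comp z hasFDerivAt_snd
  have hb : HasFDerivAt (fun z : N7 => z.2.2) ((ContinuousLinearMap.snd ℝ _ _).comp
    (ContinuousLinearMap.snd ℝ E5 (ℝ × ℝ))) z := hasFDerivAt_snd.comp z hasFDerivAt_snd
  have hbi : HasFDerivAt (fun z : N7 => z.2.2⁻¹) _ z :=
    (hasDerivAt_inv hb0).hasFDerivAt.comp z hb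
  have hlift : ∀ k, DifferentiableAt ℝ (fun z : N7 => ((Y k z.1, 0, 0) : N7)) z := fun k =>
    ((hY.hasFDerivAt_frame hzV k).prodMk
      (hasFDerivAt_const ((0, 0) : ℝ × ℝ) z)).differentiableAt
  fin_cases j
  · have e : contactBasis Y 0 = fun z => z.2.2⁻¹ • ((0, 1, 0) : N7) := by
      funext z; simp [contactBasis]
    change VectorField.lieBracket ℝ (hRed Y) (contactBasis Y 0) z = _
    rw [e, VectorField.lieBracket_smul_right hbi.differentiableAt (differentiableAt_const _),
      hY.lieBracket_hRed_const hzV, hbi.fderiv]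
    simp [bracketHor, bracketVert, Fin.sum_univ_five, hRed]
    field_simp
    ring
  · have e : contactBasis Y 1 = fun z => z.2.2⁻¹ • ((Y 1 z.1, 0, 0) : N7) := by
      funext z; simp [contactBasis]
    change VectorField.lieBracket ℝ (hRed Y) (contactBasis Y 1) z = _
    rw [e, VectorField.lieBracket_smul_right hbi.differentiableAt (hlift 1),
      hY.lieBracket_hRed_lift hzV, hbi.fderiv]
    simp [bracketHor, bracketVert, Fin.sum_univ_five, hRed, AdaptedFrame.structureFun_self]
    match_scalars <;> field_simp
    ring
  · change VectorField.lieBracket ℝ (hRed Y) (fun z => (Y 2 z.1, 0, 0)) z = _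
    rw [hY.lieBracket_hRed_lift hzV]
    simp [bracketHor, bracketVert]
  · have e : contactBasis Y 3 = fun z => ∑ i : Fin 2,
        (![fun z : N7 => z.2.1, fun z : N7 => -z.2.2] : Fin 2 → N7 → ℝ) i z •
        (![fun z : N7 => ((Y 4 z.1, 0, 0) : N7), fun z : N7 => ((Y 3 z.1, 0, 0) : N7)] :
          Fin 2 → N7 → N7) i z := by
      funext z; simp [contactBasis, sub_eq_add_neg]
    change VectorField.lieBracket ℝ (hRed Y) (contactBasis Y 3) z = _
    have hbn : HasFDerivAt (fun z : N7 => -z.2.2) _ z := hb.neg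
    rw [e, lieBracket_sum_smul_right
      (by intro i; fin_cases i <;> [exact ha.differentiableAt; exact hb.neg.differentiableAt])
      (by intro i; fin_cases i <;> [exact hlift 4; exact hlift 3]), Fin.sum_univ_two]
    simp only [Matrix.cons_val_zero, Matrix.cons_val_one]
    rw [hY.lieBracket_hRed_lift hzV, hY.lieBracket_hRed_lift hzV, hbn.fderiv, ha.fderiv]
    refine Prod.ext ?_ (Prod.ext ?_ ?_) <;>
      simp [bracketHor, bracketVert, Fin.sum_univ_five, hRed]
    match_scalars <;> ring
  · change VectorField.lieBracket ℝ (hRed Y) (hRed Y) z = _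
    rw [VectorField.lieBracket_self]
    simp [bracketHor, bracketVert]
    rfl
  -- For the Euler field, homogeneity of `hRed` gives `[h, e] = -h`.
  · obtain ⟨L, hL, h⟩ := hY.hasFDerivAt_hRed hzV
    have h1 : HasFDerivAt (fun z : N7 => ((0, z.2.1, z.2.2) : N7)) _ z :=
      (hasFDerivAt_const (0 : E5) z).prodMk (ha.prodMk hb)
    change VectorField.lieBracket ℝ (hRed Y) (fun z : N7 => ((0, z.2.1, z.2.2) : N7)) z = _
    rw [VectorField.lieBracket, hL.fderiv, h1.fderiv, h]
    simp [bracketHor, bracketVert, Fin.sum_univ_five, hRed, hY.fderiv_alpha hzV, alphaA, alphaB,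
      alpha]
    refine ⟨?_, ?_, ?_⟩
    · abel
    · ring
    · ring

/-- Since `h` lies in `ς = 0` and in the kernel of `σ = dς`, the operator `ad h` preserves this
hyperplane; here it is checked on components. This is what allows the brackets to be expanded in the
contact basis. -/
lemma bracketHor_contact (hz : z.1 ∈ V) (j : Fin 6) :
    z.2.1 * bracketHor Y z j 3 + z.2.2 * bracketHor Y z j 4 = 0 := by
  have e2 := hY.structureFun_01 hz (k := 3) (by decide)
  have e3 := hY.structureFun_01 hz (k := 4) (by decide)
  have e4 := hY.structureFun_02 hz (k := 3) le_rfl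
  have e5 := hY.structureFun_02 hz (k := 4) (by decide)
  have e6 := hY.structureFun_12 hz (k := 3) le_rfl
  have e7 := hY.structureFun_12 hz (k := 4) (by decide)
  fin_cases j <;> simp [bracketHor, e2, e3, e4, e5, e6, e7, alpha] <;> ring

lemma lieBracket_hRed_contactBasis (hz : z ∈ regularDomain V) (j : Fin 6) :
    VectorField.lieBracket ℝ (hRed Y) (contactBasis Y j) z =
      ∑ i, adCoef Y j i z • contactBasis Y i z := by
  rw [hY.lieBracket_hRed_basis hz]
  exact (sum_contactCoef Y hz.2 _ _ (hY.bracketHor_contact hz.1 j)).symm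

end AdaptedFrame

end ReducedFields

/-! ### Iterated brackets as a recursion on coefficients. -/

section AdCoefficients

variable (Y : Fin 5 → E5 → E5)

/-- The iterated brackets of the characteristic field with the vertical field. -/
noncomputable def adRed (k : ℕ) : N7 → N7 :=
  (fun W => VectorField.lieBracket ℝ (hRed Y) W)^[k] (contactBasis Y 0)

/-- The coefficients of `adRed Y k` in the contact basis. -/
noncomputable def iterCoef : ℕ → Fin 6 → N7 → ℝ
  | 0 => fun i _ => if i = 0 then 1 else 0
  | k + 1 => fun i z => fderiv ℝ (iterCoef k i) z (hRed Y z) +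
      ∑ j, iterCoef k j z * adCoef Y j i z

variable {Y} {V : Set E5}

namespace AdaptedFrame

variable (hY : AdaptedFrame Y V)
include hY

lemma contDiffOn_structureFun_fst (i j k : Fin 5) :
    ContDiffOn ℝ ∞ (fun z : N7 => structureFun Y i j k z.1) (regularDomain V) :=
  (contDiffOn_comp_fst fun _ hy => hY.contDiffAt_structureFun hy i j k).mono fun _ h => h.1

lemma contDiffOn_frame_fst (i : Fin 5) :
    ContDiffOn ℝ ∞ (fun z : N7 => Y i z.1) (regularDomain V) :=
  (contDiffOn_comp_fst fun _ hy => hY.contDiffAt hy i).mono fun _ h => h.1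

lemma contDiffOn_fderiv_structureFun_fst (p i j k : Fin 5) :
    ContDiffOn ℝ ∞ (fun z : N7 => fderiv ℝ (structureFun Y i j k) z.1 (Y p z.1))
      (regularDomain V) :=
  (contDiffOn_comp_fst (g := fun y => fderiv ℝ (structureFun Y i j k) y (Y p y)) fun _ hy =>
    ((hY.contDiffAt_structureFun hy i j k).fderiv_right (by simp)).clm_apply
      (hY.contDiffAt hy p)).mono fun _ h => h.1

omit hY in
lemma contDiffOn_inv_snd :
    ContDiffOn ℝ ∞ (fun z : N7 => z.2.2⁻¹) (regularDomain V) :=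
  (contDiff_snd.comp contDiff_snd).contDiffOn.inv fun _ h => h.2

lemma contDiffOn_alpha (j : Fin 5) : ContDiffOn ℝ ∞ (alpha Y j) (regularDomain V) := by
  have hc := hY.contDiffOn_structureFun_fst
  unfold alpha
  fun_prop (disch := assumption)

lemma contDiffOn_hRed : ContDiffOn ℝ ∞ (hRed Y) (regularDomain V) := by
  have h1 := hY.contDiffOn_alpha 3
  have h2 := hY.contDiffOn_alpha 4
  have h3 := hY.contDiffOn_frame_fst 1
  have h4 := hY.contDiffOn_frame_fst 0
  have ha : ContDiffOn ℝ ∞ (fun z : N7 => z.2.1) (regularDomain V) := by fun_prop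
  have hb : ContDiffOn ℝ ∞ (fun z : N7 => z.2.2) (regularDomain V) := by fun_prop
  exact ((ha.smul h3).sub (hb.smul h4)).prodMk (h1.prodMk h2)

lemma contDiffOn_contactBasis (i : Fin 6) :
    ContDiffOn ℝ ∞ (contactBasis Y i) (regularDomain V) := by
  have h1 := hY.contDiffOn_frame_fst
  have h2 := contDiffOn_inv_snd (V := V)
  have ha : ContDiffOn ℝ ∞ (fun z : N7 => z.2.1) (regularDomain V) := by fun_prop
  have hb : ContDiffOn ℝ ∞ (fun z : N7 => z.2.2) (regularDomain V) := by fun_prop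
  have h0 : ContDiffOn ℝ ∞ (fun _ : N7 => ((0, 0) : ℝ × ℝ)) (regularDomain V) := contDiffOn_const
  fin_cases i
  · change ContDiffOn ℝ ∞ (fun z : N7 => ((0, z.2.2⁻¹, 0) : N7)) _
    fun_prop (disch := assumption)
  · exact (h2.smul (h1 1)).prodMk h0
  · exact (h1 2).prodMk h0
  · exact ((ha.smul (h1 4)).sub (hb.smul (h1 3))).prodMk h0
  · exact hY.contDiffOn_hRed
  · change ContDiffOn ℝ ∞ (fun z : N7 => ((0, z.2.1, z.2.2) : N7)) _
    fun_prop

omit hY in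
lemma contDiffOn_contactCoef {x : N7 → Fin 5 → ℝ} {s t : N7 → ℝ}
    (h3 : ContDiffOn ℝ ∞ (alpha Y 3) (regularDomain V))
    (h4 : ContDiffOn ℝ ∞ (alpha Y 4) (regularDomain V))
    (hx : ∀ k, ContDiffOn ℝ ∞ (fun z => x z k) (regularDomain V))
    (hs : ContDiffOn ℝ ∞ s (regularDomain V)) (ht : ContDiffOn ℝ ∞ t (regularDomain V))
    (i : Fin 6) :
    ContDiffOn ℝ ∞ (fun z => contactCoef Y z (x z) (s z) (t z) i) (regularDomain V) := by
  have hb := contDiffOn_inv_snd (V := V)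
  simp only [contactCoef, div_eq_mul_inv]
  fin_cases i <;> simp <;> fun_prop (disch := assumption)

lemma contDiffOn_adCoef (j i : Fin 6) : ContDiffOn ℝ ∞ (adCoef Y j i) (regularDomain V) := by
  have hb := contDiffOn_inv_snd (V := V)
  have hc := hY.contDiffOn_structureFun_fst
  have hd := hY.contDiffOn_fderiv_structureFun_fst
  have hα := hY.contDiffOn_alpha
  have hA : ∀ k, ContDiffOn ℝ ∞ (alphaA Y k) (regularDomain V) := by
    intro k
    unfold alphaA
    fun_prop (disch := assumption)
  have hD : ∀ k p, ContDiffOn ℝ ∞ (alphaY Y k p) (regularDomain V) := by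
    intro k p
    unfold alphaY
    fun_prop (disch := assumption)
  unfold adCoef
  refine contDiffOn_contactCoef (hα 3) (hα 4) (fun k => ?_) ?_ ?_ i
  · fin_cases j
    · simp only [bracketHor]
      fin_cases k <;> simp <;> fun_prop (disch := assumption)
    · simp [bracketHor, div_eq_mul_inv, ← inv_pow]
      split_ifs <;> fun_prop (disch := assumption)
    · simp [bracketHor]
      fun_prop (disch := assumption)
    · simp [bracketHor]
      split_ifs <;> fun_prop (disch := assumption)
    · simp [bracketHor]
      fun_prop
    · simp only [bracketHor]
      fin_cases k <;> simp <;> fun_prop (disch := assumption)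
  · fin_cases j <;> simp [bracketVert, div_eq_mul_inv, ← inv_pow] <;>
      fun_prop (disch := assumption)
  · fin_cases j <;> simp [bracketVert] <;>
      fun_prop (disch := assumption)

lemma contDiffOn_fderiv_hRed {f : N7 → ℝ} (hf : ContDiffOn ℝ ∞ f (regularDomain V)) :
    ContDiffOn ℝ ∞ (fun z => fderiv ℝ f z (hRed Y z)) (regularDomain V) :=
  (hf.fderiv_of_isOpen hY.isOpen_regularDomain (by simp)).clm_apply hY.contDiffOn_hRed

lemma contDiffOn_iterCoef (k : ℕ) (i : Fin 6) :
    ContDiffOn ℝ ∞ (iterCoef Y k i) (regularDomain V) := by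
  induction k generalizing i with
  | zero => exact contDiffOn_const
  | succ k ih =>
    exact (hY.contDiffOn_fderiv_hRed (ih i)).add
      (ContDiffOn.sum fun j _ => (ih j).mul (hY.contDiffOn_adCoef j i))

/-- The recursion of `iterCoef` is the Leibniz rule: `h` differentiates the coefficients, and
`adCoef` expands the brackets of the basis fields. -/
lemma adRed_eq (k : ℕ) {z : N7} (hz : z ∈ regularDomain V) :
    adRed Y k z = ∑ i, iterCoef Y k i z • contactBasis Y i z := by
  induction k generalizing z with
  | zero => simp [adRed, iterCoef]
  | succ k ih =>
    have h1 : adRed Y (k + 1) = VectorField.lieBracket ℝ (hRed Y) (adRed Y k) := by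
      rw [adRed, Function.iterate_succ_apply']
      rfl
    have h2 : adRed Y k =ᶠ[𝓝 z] fun z => ∑ i, iterCoef Y k i z • contactBasis Y i z := by
      filter_upwards [hY.isOpen_regularDomain.mem_nhds hz] with x hx using ih hx
    have hn := hY.isOpen_regularDomain.mem_nhds hz
    rw [h1, Filter.EventuallyEq.lieBracket_vectorField_eq Filter.EventuallyEq.rfl h2,
      lieBracket_sum_smul_right
        (fun i => ((hY.contDiffOn_iterCoef k i).contDiffAt hn).differentiableAt (by simp))
        (fun i => ((hY.contDiffOn_contactBasis i).contDiffAt hn).differentiableAt (by simp))]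
    simp only [iterCoef, add_smul, Finset.sum_add_distrib, Finset.sum_smul]
    congr 1
    rw [Finset.sum_comm]
    refine Finset.sum_congr rfl fun j _ => ?_
    rw [hY.lieBracket_hRed_contactBasis hz, Finset.smul_sum]
    exact Finset.sum_congr rfl fun i _ => smul_smul _ _ _

lemma contDiffOn_adRed (k : ℕ) : ContDiffOn ℝ ∞ (adRed Y k) (regularDomain V) :=
  (ContDiffOn.sum fun i _ => (hY.contDiffOn_iterCoef k i).smul
    (hY.contDiffOn_contactBasis i)).congr fun _ hz => hY.adRed_eq k hz

end AdaptedFrame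

end AdCoefficients

/-! ### Explicit computation of l₁, l₂, Q and B₂. -/

section InvariantForms

variable (Y : Fin 5 → E5 → E5)

/-- The coefficients of the form `l₁` of the frame `Y`. -/
noncomputable def coefOne (y : E5) : Fin 2 → ℝ :=
  let c := fun i j k => structureFun Y i j k y
  ![c 0 1 0 - c 0 4 3 + 2 * c 1 3 3 + c 1 4 4,
    c 0 1 1 - c 0 3 3 - 2 * c 0 4 4 + c 1 3 4]

/-- The coefficients of the form `l₂` of the frame `Y`. -/
noncomputable def coefTwo (y : E5) : Fin 2 → ℝ :=
  let c := fun i j k => structureFun Y i j k y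
  ![-c 0 1 0 + c 0 4 3 + c 1 2 2 - 2 * c 1 3 3 - c 1 4 4,
    -c 0 1 1 - c 0 2 2 + c 0 3 3 + 2 * c 0 4 4 - c 1 3 4]

/-- The coefficients of the form `Q` of the frame `Y`. -/
noncomputable def coefQ (y : E5) : Fin 3 → ℝ :=
  let c := fun i j k => structureFun Y i j k y
  let d := fun p i j k => fderiv ℝ (structureFun Y i j k) y (Y p y)
  ![c 0 1 0 * c 0 4 3 - 2 * c 0 1 0 * c 1 3 3 - c 0 1 0 * c 1 4 4 - (c 0 1 0) ^ 2 - c 0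
      3 3 * c 1 4 3 + c 0 4 3 * c 1 3 3 + 2 * c 0 4 3 * c 1 4 4 - (c 0 4 3) ^ 2 - 4 * c 0
      4 4 * c 1 4 3 + c 1 2 0 - c 1 3 3 * c 1 4 4 + c 1 3 4 * c 1 4 3 - (c 1 4 4) ^ 2 + d
      0 1 4 3 + d 1 0 1 0 - 2 * d 1 0 4 3 + 3 * d 1 1 3 3 + 2 * d 1 1 4 4,
    -2 * c 0 1 0 * c 0 1 1 + c 0 1 0 * c 0 3 3 + 2 * c 0 1 0 * c 0 4 4 - c 0 1 0 * c 1 3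
      4 + c 0 1 1 * c 0 4 3 - 2 * c 0 1 1 * c 1 3 3 - c 0 1 1 * c 1 4 4 - c 0 2 0 + 2 * c
      0 3 3 * c 0 4 3 - 2 * c 0 3 3 * c 1 4 4 + 2 * c 0 3 4 * c 1 4 3 - 2 * c 0 4 3 * c 1
      3 4 + 6 * c 0 4 4 * c 1 3 3 + c 1 2 1 + 2 * c 1 3 4 * c 1 4 4 - d 0 0 1 0 + d 0 0 4
      3 - 4 * d 0 1 3 3 - d 0 1 4 4 + d 1 0 1 1 - d 1 0 3 3 - 4 * d 1 0 4 4 + d 1 1 3 4,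
    c 0 1 1 * c 0 3 3 + 2 * c 0 1 1 * c 0 4 4 - c 0 1 1 * c 1 3 4 - (c 0 1 1) ^ 2 - c 0
      2 1 - c 0 3 3 * c 0 4 4 + 2 * c 0 3 3 * c 1 3 4 - (c 0 3 3) ^ 2 + c 0 3 4 * c 0 4 3
      - 4 * c 0 3 4 * c 1 3 3 - c 0 3 4 * c 1 4 4 + c 0 4 4 * c 1 3 4 - (c 1 3 4) ^ 2 - d
      0 0 1 1 + 2 * d 0 0 3 3 + 3 * d 0 0 4 4 - 2 * d 0 1 3 4 + d 1 0 3 4]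

/-- The coefficients of the form `B₂` of the frame `Y`. -/
noncomputable def coefB (y : E5) : Fin 3 → ℝ :=
  let c := fun i j k => structureFun Y i j k y
  let d := fun p i j k => fderiv ℝ (structureFun Y i j k) y (Y p y)
  ![-c 0 1 0 * c 0 4 3 - c 0 1 0 * c 1 2 2 + c 0 1 0 * c 1 3 3 + c 0 1 0 * c 1 4 4 + (c
      0 1 0) ^ 2 - c 0 1 1 * c 1 4 3 - c 0 2 2 * c 1 4 3 + 2 * c 0 3 3 * c 1 4 3 + c 0 4 3
      * c 1 2 2 - 2 * c 0 4 3 * c 1 4 4 + (c 0 4 3) ^ 2 + 6 * c 0 4 4 * c 1 4 3 - c 1 2 0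
      - c 1 2 2 * c 1 3 3 - c 1 2 2 * c 1 4 4 + (c 1 2 2) ^ 2 - 2 * (c 1 3 3) ^ 2 - 2 * c
      1 3 4 * c 1 4 3 + c 1 4 2 + (c 1 4 4) ^ 2 - d 0 1 4 3 - 2 * d 1 0 1 0 + 3 * d 1 0 4
      3 + d 1 1 2 2 - 5 * d 1 1 3 3 - 3 * d 1 1 4 4,
    2 * c 0 1 0 * c 0 1 1 + c 0 1 0 * c 0 2 2 - 2 * c 0 1 0 * c 0 4 4 - c 0 1 1 * c 1 2
      2 + 2 * c 0 1 1 * c 1 3 3 + c 0 2 0 - 2 * c 0 2 2 * c 1 2 2 + 2 * c 0 2 2 * c 1 3 3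
      - 4 * c 0 3 3 * c 0 4 3 + 2 * c 0 3 3 * c 1 3 3 + 4 * c 0 3 3 * c 1 4 4 - 2 * c 0 3
      4 * c 1 4 3 - c 0 4 2 - 2 * c 0 4 3 * c 0 4 4 + 4 * c 0 4 3 * c 1 3 4 + 2 * c 0 4 4
      * c 1 2 2 - 6 * c 0 4 4 * c 1 3 3 + 2 * c 0 4 4 * c 1 4 4 - c 1 2 1 - c 1 3 2 - 2 *
      c 1 3 3 * c 1 3 4 - 4 * c 1 3 4 * c 1 4 4 + 2 * d 0 0 1 0 - 2 * d 0 0 4 3 - d 0 1 2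
      2 + 6 * d 0 1 3 3 + 2 * d 0 1 4 4 - 2 * d 1 0 1 1 - d 1 0 2 2 + 2 * d 1 0 3 3 + 6 *
      d 1 0 4 4 - 2 * d 1 1 3 4,
    c 0 1 0 * c 0 3 4 + c 0 1 1 * c 0 2 2 - c 0 1 1 * c 0 3 3 - c 0 1 1 * c 0 4 4 + c 0
      1 1 * c 1 3 4 + (c 0 1 1) ^ 2 + c 0 2 1 - c 0 2 2 * c 0 3 3 - c 0 2 2 * c 0 4 4 + c
      0 2 2 * c 1 3 4 + (c 0 2 2) ^ 2 + c 0 3 2 - 2 * c 0 3 3 * c 1 3 4 + (c 0 3 3) ^ 2 -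
      2 * c 0 3 4 * c 0 4 3 - c 0 3 4 * c 1 2 2 + 6 * c 0 3 4 * c 1 3 3 + 2 * c 0 3 4 * c
      1 4 4 - 2 * (c 0 4 4) ^ 2 + (c 1 3 4) ^ 2 + 2 * d 0 0 1 1 + d 0 0 2 2 - 3 * d 0 0 3
      3 - 5 * d 0 0 4 4 + 3 * d 0 1 3 4 - d 1 0 3 4]

/-- The linear form with the given coefficients. -/
noncomputable def linearOf (c : Fin 2 → ℝ) : (Fin 2 → ℝ) →ₗ[ℝ] ℝ :=
  c 0 • LinearMap.proj 0 + c 1 • LinearMap.proj 1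

/-- The quadratic form with the given coefficients. -/
noncomputable def quadraticOf (c : Fin 3 → ℝ) : QuadraticForm ℝ (Fin 2 → ℝ) :=
  c 0 • QuadraticMap.linMulLin (LinearMap.proj 0) (LinearMap.proj 0) +
    c 1 • QuadraticMap.linMulLin (LinearMap.proj 0) (LinearMap.proj 1) +
    c 2 • QuadraticMap.linMulLin (LinearMap.proj 1) (LinearMap.proj 1)

lemma linearOf_apply (c : Fin 2 → ℝ) (u v : ℝ) : linearOf c ![u, v] = c 0 * u + c 1 * v := by
  simp [linearOf]

lemma quadraticOf_apply (c : Fin 3 → ℝ) (u v : ℝ) :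
    quadraticOf c ![u, v] = c 0 * u ^ 2 + c 1 * (u * v) + c 2 * v ^ 2 := by
  simp [quadraticOf, QuadraticMap.linMulLin_apply]
  ring

/-- The `ε₁`-coefficient of the first bracket. -/
noncomputable def betaCoef (z : N7) : ℝ :=
  z.2.1 ^ 2 * structureFun Y 1 4 3 z.1 / z.2.2 - 2 * z.2.1 * structureFun Y 1 3 3 z.1 +
    z.2.2 * (structureFun Y 0 4 4 z.1 - structureFun Y 1 3 4 z.1 + structureFun Y 0 3 3 z.1)

variable {Y} {V : Set E5}

/-- Since `[h, h] = 0` and `[h, e] = -h`, the components along `h` and the Euler field never feed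
back into the other four (see also `adCoef_five`). -/
lemma adCoef_four (z : N7) {i : Fin 6} (hi : i ≤ 3) : adCoef Y 4 i z = 0 := by
  fin_cases i <;> simp [adCoef, contactCoef, bracketHor, bracketVert] at hi ⊢

lemma adCoef_five {z : N7} (hz : z.2.2 ≠ 0) {i : Fin 6} (hi : i ≤ 3) : adCoef Y 5 i z = 0 := by
  fin_cases i <;> simp [adCoef, contactCoef, bracketHor, bracketVert] at hi ⊢
  · right
    field_simp
    ring
  · ring

lemma adCoef_zero_zero {z : N7} (hz : z.2.2 ≠ 0) : adCoef Y 0 0 z = betaCoef Y z := by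
  simp [adCoef, contactCoef, bracketHor, bracketVert, betaCoef, alphaA, alpha]
  field_simp
  ring

lemma adCoef_zero_one {z : N7} (hz : z.2.2 ≠ 0) : adCoef Y 0 1 z = -1 := by
  simp [adCoef, contactCoef, bracketHor, hz]

lemma adCoef_zero_of_le (z : N7) {i : Fin 6} (hi : 2 ≤ i) (hi' : i ≤ 4) :
    adCoef Y 0 i z = 0 := by
  fin_cases i <;> simp [adCoef, contactCoef, bracketHor] at hi hi' ⊢

namespace AdaptedFrame

variable (hY : AdaptedFrame Y V) {z : N7}
include hY

/-- With `adCoef_zero_one` and `adCoef_two_three`: `ad h` climbs through `ε₁`, `u₅⁻¹ Y 1`, `Y 2`,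
`u₄ Y 4 - u₅ Y 3` with the constant leading coefficients -1, -1, 1. -/
lemma adCoef_one_two (hz : z ∈ regularDomain V) : adCoef Y 1 2 z = -1 := by
  simp [adCoef, contactCoef, bracketHor, hY.structureFun_01 hz.1 (k := 2) le_rfl]

lemma adCoef_one_three (hz : z ∈ regularDomain V) : adCoef Y 1 3 z = 0 := by
  simp [adCoef, contactCoef, bracketHor, hY.structureFun_01 hz.1 (k := 3) (by decide)]

lemma adCoef_two_three (hz : z ∈ regularDomain V) : adCoef Y 2 3 z = 1 := by
  simp [adCoef, contactCoef, bracketHor, hY.structureFun_02 hz.1 (k := 3) (by decide),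
    hY.structureFun_12 hz.1 (k := 3) (by decide), hz.2]

lemma hasFDerivAt_structureFun_hRed (hz : z ∈ regularDomain V) (i j k : Fin 5) :
    ∃ L : N7 →L[ℝ] ℝ, HasFDerivAt (fun z : N7 => structureFun Y i j k z.1) L z ∧
      L (hRed Y z) = z.2.1 * fderiv ℝ (structureFun Y i j k) z.1 (Y 1 z.1) -
        z.2.2 * fderiv ℝ (structureFun Y i j k) z.1 (Y 0 z.1) := by
  refine ⟨_, ((hY.contDiffAt_structureFun hz.1 i j k).differentiableAt
      (by simp)).hasFDerivAt.comp z hasFDerivAt_fst, ?_⟩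
  simp [hRed]

omit hY in
lemma hasFDerivAt_snd_fst : HasFDerivAt (fun z : N7 => z.2.1)
    ((ContinuousLinearMap.fst ℝ _ _).comp (ContinuousLinearMap.snd ℝ E5 (ℝ × ℝ))) z :=
  hasFDerivAt_fst.comp z hasFDerivAt_snd

omit hY in
lemma hasFDerivAt_snd_snd : HasFDerivAt (fun z : N7 => z.2.2)
    ((ContinuousLinearMap.snd ℝ _ _).comp (ContinuousLinearMap.snd ℝ E5 (ℝ × ℝ))) z :=
  hasFDerivAt_snd.comp z hasFDerivAt_snd

lemma iterCoef_succ (hz : z ∈ regularDomain V) {k : ℕ} {i : Fin 6} {g : N7 → ℝ}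
    (h : ∀ z ∈ regularDomain V, iterCoef Y k i z = g z) :
    iterCoef Y (k + 1) i z = fderiv ℝ g z (hRed Y z) + ∑ j, iterCoef Y k j z * adCoef Y j i z := by
  have : iterCoef Y k i =ᶠ[𝓝 z] g := by
    filter_upwards [hY.isOpen_regularDomain.mem_nhds hz] with x hx using h x hx
  rw [← this.fderiv_eq]
  rfl

omit hY in
lemma iterCoef_one (z : N7) (i : Fin 6) : iterCoef Y 1 i z = adCoef Y 0 i z := by
  simp [iterCoef]

omit hY in
lemma iterCoef_one_one (hz : z ∈ regularDomain V) : iterCoef Y 1 1 z = -1 := by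
  rw [iterCoef_one, adCoef_zero_one hz.2]

lemma iterCoef_two_zero (hz : z ∈ regularDomain V) :
    iterCoef Y 2 0 z = fderiv ℝ (betaCoef Y) z (hRed Y z) + betaCoef Y z ^ 2 - adCoef Y 1 0 z := by
  rw [hY.iterCoef_succ hz (g := betaCoef Y)
    fun x hx => by rw [iterCoef_one, adCoef_zero_zero hx.2]]
  simp [Fin.sum_univ_six, iterCoef_one, adCoef_zero_one hz.2, adCoef_zero_zero hz.2,
    adCoef_zero_of_le, adCoef_five hz.2]
  ring

/-- The terms with denominator `u₅` in `betaCoef` and in the diagonal entry `adCoef Y 1 1` cancel,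
and a linear form remains. -/
lemma iterCoef_two_one (hz : z ∈ regularDomain V) :
    iterCoef Y 2 1 z = linearOf (coefOne Y z.1) ![z.2.1, z.2.2] := by
  rw [hY.iterCoef_succ hz (g := fun _ => -1) fun x hx => iterCoef_one_one hx]
  simp [Fin.sum_univ_six, iterCoef_one, adCoef_zero_one hz.2, adCoef_zero_zero hz.2,
    adCoef_zero_of_le, adCoef_five hz.2, linearOf_apply, coefOne]
  simp [adCoef, contactCoef, bracketHor, betaCoef, alpha]
  have := hz.2
  field_simp
  ring

lemma iterCoef_two_two (hz : z ∈ regularDomain V) : iterCoef Y 2 2 z = 1 := by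
  rw [hY.iterCoef_succ hz (g := fun _ => 0)
    fun x _ => by rw [iterCoef_one, adCoef_zero_of_le] <;> decide]
  simp [Fin.sum_univ_six, iterCoef_one, adCoef_zero_one hz.2, adCoef_zero_zero hz.2,
    adCoef_zero_of_le, adCoef_five hz.2, hY.adCoef_one_two hz]

lemma iterCoef_two_three (hz : z ∈ regularDomain V) : iterCoef Y 2 3 z = 0 := by
  rw [hY.iterCoef_succ hz (g := fun _ => 0)
    fun x _ => by rw [iterCoef_one, adCoef_zero_of_le] <;> decide]
  simp [Fin.sum_univ_six, iterCoef_one, adCoef_zero_one hz.2, adCoef_zero_zero hz.2,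
    adCoef_zero_of_le, adCoef_five hz.2, hY.adCoef_one_three hz]

omit hY in
lemma fderiv_linearOf {c : E5 → Fin 2 → ℝ}
    (hc : ∀ i, DifferentiableAt ℝ (fun y => c y i) z.1) :
    fderiv ℝ (fun z : N7 => linearOf (c z.1) ![z.2.1, z.2.2]) z (hRed Y z) =
      ∑ i : Fin 2, (z.2.1 * fderiv ℝ (fun y => c y i) z.1 (Y 1 z.1) -
        z.2.2 * fderiv ℝ (fun y => c y i) z.1 (Y 0 z.1)) * ![z.2.1, z.2.2] i +
      c z.1 0 * alpha Y 3 z + c z.1 1 * alpha Y 4 z := by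
  have h : ∀ i, HasFDerivAt (fun z : N7 => c z.1 i)
      ((fderiv ℝ (fun y => c y i) z.1).comp (ContinuousLinearMap.fst ℝ _ _)) z :=
    fun i => (hc i).hasFDerivAt.comp z hasFDerivAt_fst
  have h1 := ((h 0).mul (hasFDerivAt_snd_fst (z := z))).add
    ((h 1).mul (hasFDerivAt_snd_snd (z := z)))
  have e : (fun z : N7 => linearOf (c z.1) ![z.2.1, z.2.2]) =
      fun z => c z.1 0 * z.2.1 + c z.1 1 * z.2.2 := by
    funext z
    rw [linearOf_apply]
  rw [e]
  erw [h1.fderiv]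
  simp [hRed]
  ring

lemma fderiv_betaCoef (hz : z ∈ regularDomain V) :
    fderiv ℝ (betaCoef Y) z (hRed Y z) =
      let d := fun i j k => z.2.1 * fderiv ℝ (structureFun Y i j k) z.1 (Y 1 z.1) -
        z.2.2 * fderiv ℝ (structureFun Y i j k) z.1 (Y 0 z.1)
      z.2.1 ^ 2 * z.2.2⁻¹ * d 1 4 3 + (2 * z.2.1 * z.2.2⁻¹ * alpha Y 3 z -
          z.2.1 ^ 2 * z.2.2⁻¹ ^ 2 * alpha Y 4 z) * structureFun Y 1 4 3 z.1 -
        2 * (z.2.1 * d 1 3 3 + alpha Y 3 z * structureFun Y 1 3 3 z.1) +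
        z.2.2 * (d 0 4 4 - d 1 3 4 + d 0 3 3) +
        alpha Y 4 z * (structureFun Y 0 4 4 z.1 - structureFun Y 1 3 4 z.1 +
          structureFun Y 0 3 3 z.1) := by
  obtain ⟨L1, h1, e1⟩ := hY.hasFDerivAt_structureFun_hRed hz 1 4 3
  obtain ⟨L2, h2, e2⟩ := hY.hasFDerivAt_structureFun_hRed hz 1 3 3
  obtain ⟨L3, h3, e3⟩ := hY.hasFDerivAt_structureFun_hRed hz 0 4 4
  obtain ⟨L4, h4, e4⟩ := hY.hasFDerivAt_structureFun_hRed hz 1 3 4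
  obtain ⟨L5, h5, e5⟩ := hY.hasFDerivAt_structureFun_hRed hz 0 3 3
  have hb : HasFDerivAt (fun z : N7 => z.2.2⁻¹) _ z :=
    (hasDerivAt_inv hz.2).hasFDerivAt.comp z hasFDerivAt_snd_snd
  have h := ((((hasFDerivAt_snd_fst (z := z)).mul hasFDerivAt_snd_fst).mul hb).mul h1).sub
    ((hasFDerivAt_snd_fst.const_mul 2).mul h2) |>.add
    (hasFDerivAt_snd_snd.mul ((h3.sub h4).add h5))
  have e : betaCoef Y = fun z : N7 => z.2.1 * z.2.1 * z.2.2⁻¹ * structureFun Y 1 4 3 z.1 -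
      2 * z.2.1 * structureFun Y 1 3 3 z.1 + z.2.2 * (structureFun Y 0 4 4 z.1 -
        structureFun Y 1 3 4 z.1 + structureFun Y 0 3 3 z.1) := by
    funext z
    rw [betaCoef]
    ring
  rw [e]
  erw [h.fderiv]
  simp [e1, e2, e3, e4, e5]
  simp [hRed]
  ring

lemma fderiv_coefOne {y : E5} (hy : y ∈ V) (v : E5) :
    let d := fun i j k => fderiv ℝ (structureFun Y i j k) y v
    fderiv ℝ (fun y => coefOne Y y 0) y v = d 0 1 0 - d 0 4 3 + 2 * d 1 3 3 + d 1 4 4 ∧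
    fderiv ℝ (fun y => coefOne Y y 1) y v = d 0 1 1 - d 0 3 3 - 2 * d 0 4 4 + d 1 3 4 := by
  have h : ∀ i j k, HasFDerivAt (structureFun Y i j k) (fderiv ℝ (structureFun Y i j k) y) y :=
    fun i j k => ((hY.contDiffAt_structureFun hy i j k).differentiableAt (by simp)).hasFDerivAt
  have h1 := (((h 0 1 0).sub (h 0 4 3)).add ((h 1 3 3).const_mul 2)).add (h 1 4 4)
  have h2 := (((h 0 1 1).sub (h 0 3 3)).sub ((h 0 4 4).const_mul 2)).add (h 1 3 4)
  refine ⟨?_, ?_⟩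
  · erw [h1.fderiv]
    simp
  · erw [h2.fderiv]
    simp

lemma fderiv_coefTwo {y : E5} (hy : y ∈ V) (v : E5) :
    let d := fun i j k => fderiv ℝ (structureFun Y i j k) y v
    fderiv ℝ (fun y => coefTwo Y y 0) y v =
      -d 0 1 0 + d 0 4 3 + d 1 2 2 - 2 * d 1 3 3 - d 1 4 4 ∧
    fderiv ℝ (fun y => coefTwo Y y 1) y v =
      -d 0 1 1 - d 0 2 2 + d 0 3 3 + 2 * d 0 4 4 - d 1 3 4 := by
  have h : ∀ i j k, HasFDerivAt (structureFun Y i j k) (fderiv ℝ (structureFun Y i j k) y) y :=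
    fun i j k => ((hY.contDiffAt_structureFun hy i j k).differentiableAt (by simp)).hasFDerivAt
  have h1 := ((((h 0 1 0).neg.add (h 0 4 3)).add (h 1 2 2)).sub
    ((h 1 3 3).const_mul 2)).sub (h 1 4 4)
  have h2 := ((((h 0 1 1).neg.sub (h 0 2 2)).add (h 0 3 3)).add
    ((h 0 4 4).const_mul 2)).sub (h 1 3 4)
  refine ⟨?_, ?_⟩
  · erw [h1.fderiv]
    simp
  · erw [h2.fderiv]
    simp

lemma differentiableAt_coefOne {y : E5} (hy : y ∈ V) (i : Fin 2) :
    DifferentiableAt ℝ (fun y => coefOne Y y i) y := by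
  have h : ∀ i j k, DifferentiableAt ℝ (structureFun Y i j k) y :=
    fun i j k => (hY.contDiffAt_structureFun hy i j k).differentiableAt (by simp)
  fin_cases i <;> simp [coefOne] <;> fun_prop (disch := assumption)

lemma differentiableAt_coefTwo {y : E5} (hy : y ∈ V) (i : Fin 2) :
    DifferentiableAt ℝ (fun y => coefTwo Y y i) y := by
  have h : ∀ i j k, DifferentiableAt ℝ (structureFun Y i j k) y :=
    fun i j k => (hY.contDiffAt_structureFun hy i j k).differentiableAt (by simp)
  fin_cases i <;> simp [coefTwo] <;> fun_prop (disch := assumption)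

/-- The `ε₁`-component of the second bracket feeds back here through `adCoef Y 0 1 = -1`, so
`betaCoef` and its derivative along `h` enter; all negative powers of `u₅` cancel. -/
lemma iterCoef_three_one (hz : z ∈ regularDomain V) :
    iterCoef Y 3 1 z = quadraticOf (coefQ Y z.1) ![z.2.1, z.2.2] := by
  rw [hY.iterCoef_succ hz fun x hx => hY.iterCoef_two_one hx,
    fderiv_linearOf fun i => hY.differentiableAt_coefOne hz.1 i, Fin.sum_univ_six,
    Fin.sum_univ_two, (hY.fderiv_coefOne hz.1 _).1, (hY.fderiv_coefOne hz.1 _).2,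
    (hY.fderiv_coefOne hz.1 _).1, (hY.fderiv_coefOne hz.1 _).2, hY.iterCoef_two_zero hz,
    hY.iterCoef_two_one hz, hY.iterCoef_two_two hz, hY.iterCoef_two_three hz,
    adCoef_zero_one hz.2, adCoef_four z (by decide), adCoef_five hz.2 (by decide),
    hY.fderiv_betaCoef hz, linearOf_apply, quadraticOf_apply]
  have h0 := hz.2
  simp [adCoef, contactCoef, bracketHor, bracketVert, betaCoef, alpha, alphaY,
    coefOne, coefQ]
  field_simp
  ring

lemma iterCoef_three_two (hz : z ∈ regularDomain V) :
    iterCoef Y 3 2 z = linearOf (coefTwo Y z.1) ![z.2.1, z.2.2] := by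
  rw [hY.iterCoef_succ hz fun x hx => hY.iterCoef_two_two hx, Fin.sum_univ_six,
    hY.iterCoef_two_one hz, hY.iterCoef_two_two hz, hY.iterCoef_two_three hz,
    hY.adCoef_one_two hz, adCoef_zero_of_le z le_rfl (by decide), adCoef_four z (by decide),
    adCoef_five hz.2 (by decide), linearOf_apply, linearOf_apply]
  simp [adCoef, contactCoef, bracketHor, coefOne, coefTwo]
  ring

lemma iterCoef_three_three (hz : z ∈ regularDomain V) : iterCoef Y 3 3 z = 1 := by
  rw [hY.iterCoef_succ hz fun x hx => hY.iterCoef_two_three hx, Fin.sum_univ_six,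
    hY.iterCoef_two_two hz, hY.iterCoef_two_three hz, hY.adCoef_one_three hz,
    hY.adCoef_two_three hz, adCoef_zero_of_le z (by decide) (by decide),
    adCoef_four z (by decide), adCoef_five hz.2 (by decide)]
  simp

lemma iterCoef_four_two (hz : z ∈ regularDomain V) :
    iterCoef Y 4 2 z = quadraticOf (coefB Y z.1) ![z.2.1, z.2.2] := by
  rw [hY.iterCoef_succ hz fun x hx => hY.iterCoef_three_two hx,
    fderiv_linearOf fun i => hY.differentiableAt_coefTwo hz.1 i, Fin.sum_univ_six,
    Fin.sum_univ_two, (hY.fderiv_coefTwo hz.1 _).1, (hY.fderiv_coefTwo hz.1 _).2,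
    (hY.fderiv_coefTwo hz.1 _).1, (hY.fderiv_coefTwo hz.1 _).2, hY.iterCoef_three_one hz,
    hY.iterCoef_three_two hz, hY.iterCoef_three_three hz, hY.adCoef_one_two hz,
    adCoef_zero_of_le z le_rfl (by decide), adCoef_four z (by decide),
    adCoef_five hz.2 (by decide), linearOf_apply, quadraticOf_apply, quadraticOf_apply]
  simp [adCoef, contactCoef, bracketHor, alpha, coefTwo, coefQ, coefB]
  ring

/-- This is the purpose of normalizing the vertical field as `u₅⁻¹ ∂_{u₄}`: the coefficient becomes
a combination of two Jacobi relations, and the fourth order equation has no third order term. -/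
lemma iterCoef_four_three (hz : z ∈ regularDomain V) : iterCoef Y 4 3 z = 0 := by
  rw [hY.iterCoef_succ hz fun x hx => hY.iterCoef_three_three hx, Fin.sum_univ_six,
    hY.iterCoef_three_two hz, hY.iterCoef_three_three hz, hY.adCoef_one_three hz,
    hY.adCoef_two_three hz, adCoef_zero_of_le z (by decide) (by decide),
    adCoef_four z (by decide), adCoef_five hz.2 (by decide), linearOf_apply]
  have h3 := hY.jacobi_three hz.1
  have h4 := hY.jacobi_four hz.1
  have h0 := hz.2
  simp [adCoef, contactCoef, bracketHor, alpha, coefTwo]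
  field_simp
  linear_combination z.2.2 * z.2.1 * h3 + z.2.2 ^ 2 * h4

end AdaptedFrame

end InvariantForms

/-! ### The linear relation satisfied by the fourth bracket. -/

section ReducedSystem

variable {Y : Fin 5 → E5 → E5} {V : Set E5}

/-- The coefficient of the first bracket in the expansion of the fourth one. -/
noncomputable def bOneCoef (Y : Fin 5 → E5 → E5) (z : N7) : ℝ :=
  iterCoef Y 4 2 z * iterCoef Y 2 1 z - iterCoef Y 4 1 z

/-- The coefficient of `ε₁` in the expansion of the fourth bracket. -/
noncomputable def bZeroCoef (Y : Fin 5 → E5 → E5) (z : N7) : ℝ :=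
  iterCoef Y 4 0 z - iterCoef Y 4 2 z * iterCoef Y 2 0 z - bOneCoef Y z * iterCoef Y 1 0 z

/-- The span of the characteristic field and of the Euler field. -/
noncomputable def leafSpan (Y : Fin 5 → E5 → E5) (z : N7) : Submodule ℝ N7 :=
  Submodule.span ℝ {hRed Y z, ((0, z.2.1, z.2.2) : N7)}

namespace AdaptedFrame

variable (hY : AdaptedFrame Y V) {z : N7}
include hY

lemma contDiffOn_bOneCoef : ContDiffOn ℝ ∞ (bOneCoef Y) (regularDomain V) :=
  ((hY.contDiffOn_iterCoef 4 2).mul (hY.contDiffOn_iterCoef 2 1)).sub (hY.contDiffOn_iterCoef 4 1)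

lemma contDiffOn_bZeroCoef : ContDiffOn ℝ ∞ (bZeroCoef Y) (regularDomain V) :=
  ((hY.contDiffOn_iterCoef 4 0).sub
    ((hY.contDiffOn_iterCoef 4 2).mul (hY.contDiffOn_iterCoef 2 0))).sub
    (hY.contDiffOn_bOneCoef.mul (hY.contDiffOn_iterCoef 1 0))

omit hY in
lemma adRed_zero (z : N7) : adRed Y 0 z = (0, z.2.2⁻¹, 0) := rfl

lemma adRed_one (hz : z ∈ regularDomain V) : ∃ r s t : ℝ,
    adRed Y 1 z = r • adRed Y 0 z + ((-(1 / z.2.2)) • Y 1 z.1, 0, 0) +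
      s • hRed Y z + t • (0, z.2.1, z.2.2) := by
  refine ⟨iterCoef Y 1 0 z, iterCoef Y 1 4 z, iterCoef Y 1 5 z, ?_⟩
  rw [hY.adRed_eq 1 hz, Fin.sum_univ_six, iterCoef_one_one hz,
    show iterCoef Y 1 2 z = 0 by rw [iterCoef_one, adCoef_zero_of_le] <;> decide,
    show iterCoef Y 1 3 z = 0 by rw [iterCoef_one, adCoef_zero_of_le] <;> decide]
  simp [contactBasis, adRed_zero]

lemma adRed_two (hz : z ∈ regularDomain V) : ∃ r s t : ℝ,
    adRed Y 2 z = r • adRed Y 0 z +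
      ((linearOf (coefOne Y z.1) ![z.2.1, z.2.2] / z.2.2) • Y 1 z.1 + Y 2 z.1, 0, 0) +
      s • hRed Y z + t • (0, z.2.1, z.2.2) := by
  refine ⟨iterCoef Y 2 0 z, iterCoef Y 2 4 z, iterCoef Y 2 5 z, ?_⟩
  rw [hY.adRed_eq 2 hz, Fin.sum_univ_six, hY.iterCoef_two_one hz, hY.iterCoef_two_two hz,
    hY.iterCoef_two_three hz]
  simp [contactBasis, adRed_zero, smul_smul, div_eq_mul_inv]

lemma adRed_three (hz : z ∈ regularDomain V) : ∃ r s t : ℝ,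
    adRed Y 3 z = r • adRed Y 0 z +
      ((quadraticOf (coefQ Y z.1) ![z.2.1, z.2.2] / z.2.2) • Y 1 z.1 +
        linearOf (coefTwo Y z.1) ![z.2.1, z.2.2] • Y 2 z.1 + z.2.1 • Y 4 z.1 - z.2.2 • Y 3 z.1,
        0, 0) +
      s • hRed Y z + t • (0, z.2.1, z.2.2) := by
  refine ⟨iterCoef Y 3 0 z, iterCoef Y 3 4 z, iterCoef Y 3 5 z, ?_⟩
  rw [hY.adRed_eq 3 hz, Fin.sum_univ_six, hY.iterCoef_three_one hz, hY.iterCoef_three_two hz,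
    hY.iterCoef_three_three hz]
  simp [contactBasis, adRed_zero, smul_smul, div_eq_mul_inv]
  abel

/-- The coefficients come from matching components along `contactBasis 2`, then `1`, then `0`, where
the second and first brackets have leading coefficients 1 and -1. Along `contactBasis 3` nothing is
left, by `iterCoef_four_three`. -/
lemma adRed_four (hz : z ∈ regularDomain V) :
    adRed Y 4 z - (iterCoef Y 4 2 z • adRed Y 2 z + bOneCoef Y z • adRed Y 1 z +
      bZeroCoef Y z • adRed Y 0 z) ∈ leafSpan Y z := by
  refine Submodule.mem_span_pair.2
    ⟨iterCoef Y 4 4 z - iterCoef Y 4 2 z * iterCoef Y 2 4 z - bOneCoef Y z * iterCoef Y 1 4 z,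
      iterCoef Y 4 5 z - iterCoef Y 4 2 z * iterCoef Y 2 5 z - bOneCoef Y z * iterCoef Y 1 5 z, ?_⟩
  have e0 : adRed Y 0 z = contactBasis Y 0 z := rfl
  have e4 : hRed Y z = contactBasis Y 4 z := rfl
  have e5 : ((0, z.2.1, z.2.2) : N7) = contactBasis Y 5 z := rfl
  rw [hY.adRed_eq 4 hz, hY.adRed_eq 2 hz, hY.adRed_eq 1 hz, Fin.sum_univ_six, Fin.sum_univ_six,
    Fin.sum_univ_six, hY.iterCoef_four_three hz, hY.iterCoef_two_two hz, hY.iterCoef_two_three hz,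
    iterCoef_one_one hz, e0, e4, e5,
    show iterCoef Y 1 2 z = 0 by rw [iterCoef_one, adCoef_zero_of_le] <;> decide,
    show iterCoef Y 1 3 z = 0 by rw [iterCoef_one, adCoef_zero_of_le] <;> decide, bZeroCoef,
    bOneCoef]
  module

/-- The vertical field, its first three brackets, the characteristic field and the Euler field
span the contact hyperplane. -/
lemma exists_adRed_eq (hz : z ∈ regularDomain V) {v : N7}
    (hv : z.2.1 * coframe Y 3 z.1 v.1 + z.2.2 * coframe Y 4 z.1 v.1 = 0) :
    ∃ (x : Fin 4 → ℝ) (s t : ℝ), v = ∑ k : Fin 4, x k • adRed Y k z + s • hRed Y z +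
      t • (0, z.2.1, z.2.2) := by
  have h1 := sum_contactCoef Y hz.2 (x := fun i => coframe Y i z.1 v.1) v.2.1 v.2.2 hv
  rw [hY.sum_coframe hz.1] at h1
  set C := contactCoef Y z (fun i => coframe Y i z.1 v.1) v.2.1 v.2.2
  have h2 : v = ∑ i, C i • contactBasis Y i z := h1.symm
  -- The brackets are triangular in the contact basis with diagonal entries 1, -1, 1, 1, so the
  -- coefficients are solved for from the last one downwards.
  let x3 := C 3
  let x2 := C 2 - iterCoef Y 3 2 z * x3
  let x1 := -(C 1 - iterCoef Y 3 1 z * x3 - iterCoef Y 2 1 z * x2)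
  let x0 := C 0 - iterCoef Y 3 0 z * x3 - iterCoef Y 2 0 z * x2 - iterCoef Y 1 0 z * x1
  refine ⟨![x0, x1, x2, x3],
    C 4 - iterCoef Y 3 4 z * x3 - iterCoef Y 2 4 z * x2 - iterCoef Y 1 4 z * x1,
    C 5 - iterCoef Y 3 5 z * x3 - iterCoef Y 2 5 z * x2 - iterCoef Y 1 5 z * x1, ?_⟩
  have e0 : adRed Y 0 z = contactBasis Y 0 z := rfl
  have e4 : hRed Y z = contactBasis Y 4 z := rfl
  have e5 : ((0, z.2.1, z.2.2) : N7) = contactBasis Y 5 z := rfl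
  rw [h2, Fin.sum_univ_four, Fin.sum_univ_six]
  simp only [Matrix.cons_val, Fin.isValue, Fin.val_zero, Fin.val_one, Fin.val_two,
    show ((3 : Fin 4) : ℕ) = 3 from rfl]
  rw [hY.adRed_eq 3 hz, hY.adRed_eq 2 hz, hY.adRed_eq 1 hz, Fin.sum_univ_six, Fin.sum_univ_six,
    Fin.sum_univ_six, hY.iterCoef_three_three hz, hY.iterCoef_two_two hz, hY.iterCoef_two_three hz,
    iterCoef_one_one hz, e0, e4, e5,
    show iterCoef Y 1 2 z = 0 by rw [iterCoef_one, adCoef_zero_of_le] <;> decide,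
    show iterCoef Y 1 3 z = 0 by rw [iterCoef_one, adCoef_zero_of_le] <;> decide]
  module

/-- Linear independence of the vertical field and its brackets modulo the leaf. -/
lemma eq_zero_of_sum_adRed_mem (hz : z ∈ regularDomain V) {x : Fin 4 → ℝ}
    (h : ∑ k : Fin 4, x k • adRed Y k z ∈ leafSpan Y z) : x = 0 := by
  obtain ⟨r1, s1, t1, e1⟩ := hY.adRed_one hz
  obtain ⟨r2, s2, t2, e2⟩ := hY.adRed_two hz
  obtain ⟨r3, s3, t3, e3⟩ := hY.adRed_three hz
  obtain ⟨s, t, h⟩ := Submodule.mem_span_pair.1 h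
  rw [Fin.sum_univ_four] at h
  simp only [Fin.isValue, Fin.val_zero, Fin.val_one, Fin.val_two,
    show ((3 : Fin 4) : ℕ) = 3 from rfl] at h
  rw [e1, e2, e3, adRed_zero] at h
  have hb := hz.2
  have hf : ∀ i, coframe Y i z.1 _ = coframe Y i z.1 _ := fun i =>
    congrArg (fun v : N7 => coframe Y i z.1 v.1) h
  have h3 := hf 3
  have h2 := hf 2
  have h1 := hf 1
  have h0 := hf 0
  have ha := congrArg (fun v : N7 => v.2.1) h
  have hc := congrArg (fun v : N7 => v.2.2) h
  simp [hRed, hY.coframe_apply hz.1] at h3 h2 h1 h0 ha hc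
  have x3 : x 3 = 0 := by tauto
  rw [x3] at h2 h1 h0 ha hc
  simp at h2 h1 h0 ha hc
  rw [← h2] at h1 h0 ha hc
  simp at h1 h0 ha hc
  have x1 : x 1 = 0 := by
    have hb2 : z.2.2 * (s - x 1 * s1) = 0 := by linarith
    have hs : s - x 1 * s1 = 0 := (mul_eq_zero.1 hb2).resolve_left hb
    have : x 1 * z.2.2⁻¹ = 0 := by linear_combination h1 - z.2.1 * hs
    simpa [hb] using this
  rw [x1] at h0 ha hc
  simp at h0 ha hc
  have hs : s = 0 := by tauto
  rw [hs] at ha hc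
  simp at ha hc
  have ht : t = 0 := by tauto
  rw [ht] at ha
  simp at ha
  have x0 : x 0 = 0 := by tauto
  ext k
  fin_cases k
  exacts [x0, x1, h2.symm, x3]

end AdaptedFrame

end ReducedSystem

/-! ### The conormal manifold and its characteristic lines. -/

section ConormalGeometry

lemma symp_add_right (w a b : Phase) : symp w (a + b) = symp w a + symp w b := by
  simp [symp]
  ring

lemma symp_smul_right (w a : Phase) (r : ℝ) : symp w (r • a) = r * symp w a := by
  simp [symp]
  ring

/-- `S` is, over `V`, the annihilator without zero section of the span of `Y 0, Y 1, Y 2`. -/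
def IsConormal (S : Set Phase) (Y : Fin 5 → E5 → E5) (V : Set E5) : Prop :=
  ∀ μ : Phase, μ.1 ∈ V → (μ ∈ S ↔ μ.2 ≠ 0 ∧ μ.2 (Y 0 μ.1) = 0 ∧ μ.2 (Y 1 μ.1) = 0 ∧
    μ.2 (Y 2 μ.1) = 0)

variable (Y : Fin 5 → E5 → E5)

/-- The parametrization of the annihilator by the coordinates `(y, u₄, u₅)`. -/
noncomputable def conormalLift (z : N7) : Phase :=
  (z.1, z.2.1 • coframe Y 3 z.1 + z.2.2 • coframe Y 4 z.1)

/-- The coordinates `(y, u₄, u₅)` of a covector. -/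
def conormalCoord (μ : Phase) : N7 := (μ.1, μ.2 (Y 3 μ.1), μ.2 (Y 4 μ.1))

/-- The characteristic field on the cotangent bundle. -/
noncomputable def hAmb (μ : Phase) : Phase :=
  μ.2 (Y 3 μ.1) • hamLift (Y 1) μ - μ.2 (Y 4 μ.1) • hamLift (Y 0) μ

variable {Y} {V : Set E5} {S : Set Phase}

namespace AdaptedFrame

variable (hY : AdaptedFrame Y V) {z : N7}
include hY

lemma conormalCoord_lift (hz : z.1 ∈ V) : conormalCoord Y (conormalLift Y z) = z := by
  refine Prod.ext rfl (Prod.ext ?_ ?_) <;>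
    simp [conormalCoord, conormalLift, hY.coframe_apply hz]

lemma conormalLift_coord (hS : IsConormal S Y V) {μ : Phase} (hμ : μ.1 ∈ V) (hμS : μ ∈ S) :
    conormalLift Y (conormalCoord Y μ) = μ := by
  obtain ⟨-, h0, h1, h2⟩ := (hS μ hμ).1 hμS
  refine Prod.ext rfl (ContinuousLinearMap.ext fun v => ?_)
  conv_rhs => rw [← hY.sum_coframe hμ v]
  simp [conormalLift, conormalCoord, Fin.sum_univ_five, h0, h1, h2]
  ring

lemma conormalLift_mem (hS : IsConormal S Y V) (hz : z.1 ∈ V) (h0 : z.2 ≠ 0) :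
    conormalLift Y z ∈ S := by
  refine (hS _ hz).2 ⟨fun h => h0 ?_, ?_, ?_, ?_⟩
  · have := hY.conormalCoord_lift hz
    rw [← this]
    simp [conormalCoord, h]
  all_goals simp [conormalLift, hY.coframe_apply hz]

lemma contDiffAt_conormalLift (hz : z.1 ∈ V) : ContDiffAt ℝ ∞ (conormalLift Y) z := by
  have h : ∀ i, ContDiffAt ℝ ∞ (fun z : N7 => coframe Y i z.1) z := fun i =>
    (hY.contDiffAt_coframe hz i).comp z contDiffAt_fst
  unfold conormalLift
  fun_prop (disch := assumption)

lemma contDiffAt_frame_apply {μ : Phase} (hμ : μ.1 ∈ V) (i : Fin 5) :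
    ContDiffAt ℝ ∞ (fun μ : Phase => μ.2 (Y i μ.1)) μ :=
  contDiffAt_snd.clm_apply ((hY.contDiffAt hμ i).comp μ contDiffAt_fst)

lemma contDiffAt_conormalCoord {μ : Phase} (hμ : μ.1 ∈ V) :
    ContDiffAt ℝ ∞ (conormalCoord Y) μ :=
  contDiffAt_fst.prodMk ((hY.contDiffAt_frame_apply hμ 3).prodMk (hY.contDiffAt_frame_apply hμ 4))

lemma fderiv_conormalLift (hz : z.1 ∈ V) (v : N7) :
    fderiv ℝ (conormalLift Y) z v = (v.1,
      z.2.1 • fderiv ℝ (coframe Y 3) z.1 v.1 + z.2.2 • fderiv ℝ (coframe Y 4) z.1 v.1 +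
        v.2.1 • coframe Y 3 z.1 + v.2.2 • coframe Y 4 z.1) := by
  have h : ∀ i, HasFDerivAt (fun z : N7 => coframe Y i z.1)
      ((fderiv ℝ (coframe Y i) z.1).comp (ContinuousLinearMap.fst ℝ _ _)) z := fun i =>
    ((hY.contDiffAt_coframe hz i).differentiableAt (by simp)).hasFDerivAt.comp z hasFDerivAt_fst
  have h1 : HasFDerivAt (conormalLift Y) _ z :=
    (hasFDerivAt_fst (𝕜 := ℝ) (E := E5) (F := ℝ × ℝ)).prodMk
      ((hasFDerivAt_snd_fst.smul (h 3)).add (hasFDerivAt_snd_snd.smul (h 4)))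
  rw [h1.fderiv]
  refine Prod.ext rfl ?_
  simp
  abel

/-- The differential of the coframe. -/
lemma fderiv_coframe_sub {y : E5} (hy : y ∈ V) (i j k : Fin 5) :
    fderiv ℝ (coframe Y k) y (Y i y) (Y j y) - fderiv ℝ (coframe Y k) y (Y j y) (Y i y) =
      -structureFun Y i j k y := by
  have key : ∀ i j, fderiv ℝ (coframe Y k) y (Y i y) (Y j y) =
      -coframe Y k y (fderiv ℝ (Y j) y (Y i y)) := by
    intro i j
    have h1 := ((hY.contDiffAt_coframe hy k).differentiableAt (by simp)).hasFDerivAt.clm_apply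
      (hY.differentiableAt hy j).hasFDerivAt
    have h2 : (fun x => coframe Y k x (Y j x)) =ᶠ[𝓝 y] fun _ => if j = k then 1 else 0 := by
      filter_upwards [hY.isOpen.mem_nhds hy] with x hx using hY.coframe_apply hx k j
    have h3 := congrArg (fun L => L (Y i y)) (h1.fderiv.symm.trans h2.fderiv_eq)
    simp at h3
    linarith
  rw [key, key, structureFun, VectorField.lieBracket, map_sub]
  ring

omit hY in
lemma alpha_eq (j : Fin 5) (z : N7) : alpha Y j z =
    z.2.1 * (z.2.1 * structureFun Y 1 j 3 z.1 + z.2.2 * structureFun Y 1 j 4 z.1) -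
      z.2.2 * (z.2.1 * structureFun Y 0 j 3 z.1 + z.2.2 * structureFun Y 0 j 4 z.1) := by
  rw [alpha]
  ring

/-- On the conormal, `alpha Y j` is the derivative along `h` of the impulse of `Y j`. Its vanishing
for the three defining impulses says that `h` is tangent to the conormal. -/
lemma alpha_eq_zero (hz : z.1 ∈ V) {j : Fin 5} (hj : j ≤ 2) : alpha Y j z = 0 := by
  have e2 := hY.structureFun_01 hz (k := 3) (by decide)
  have e3 := hY.structureFun_01 hz (k := 4) (by decide)
  have e4 := hY.structureFun_02 hz (k := 3) le_rfl
  have e5 := hY.structureFun_02 hz (k := 4) (by decide)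
  have e6 := hY.structureFun_12 hz (k := 3) le_rfl
  have e7 := hY.structureFun_12 hz (k := 4) (by decide)
  have e8 := structureFun_swap (Y := Y) 1 0 3 z.1
  have e9 := structureFun_swap (Y := Y) 1 0 4 z.1
  fin_cases j <;> simp [alpha, e2, e3, e4, e5, e6, e7, e8, e9, structureFun_self] at hj ⊢
  ring

lemma alpha_eq_ite (hz : z.1 ∈ V) (j : Fin 5) :
    alpha Y j z = (if j = 3 then alpha Y 3 z else 0) + if j = 4 then alpha Y 4 z else 0 := by
  by_cases h : j ≤ 2
  · rw [hY.alpha_eq_zero hz h, if_neg (by rintro rfl; revert h; decide),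
      if_neg (by rintro rfl; revert h; decide), add_zero]
  · obtain rfl | rfl : j = 3 ∨ j = 4 := by omega
    · simp
    · simp

/-- The fields `hRed` and `hAmb` are related by the parametrization. -/
lemma fderiv_conormalLift_hRed (hz : z.1 ∈ V) :
    fderiv ℝ (conormalLift Y) z (hRed Y z) = hAmb Y (conormalLift Y z) := by
  have hc := hY.conormalCoord_lift hz
  have h3 : (conormalLift Y z).2 (Y 3 (conormalLift Y z).1) = z.2.1 :=
    congrArg (fun z : N7 => z.2.1) hc
  have h4 : (conormalLift Y z).2 (Y 4 (conormalLift Y z).1) = z.2.2 :=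
    congrArg (fun z : N7 => z.2.2) hc
  rw [hY.fderiv_conormalLift hz, hAmb, h3, h4]
  refine Prod.ext rfl (ContinuousLinearMap.ext fun v => ?_)
  rw [← hY.sum_coframe hz v, map_sum, map_sum]
  refine Finset.sum_congr rfl fun j _ => ?_
  rw [map_smul, map_smul]
  congr 1
  have d : ∀ i k, coframe Y k z.1 (fderiv ℝ (Y i) z.1 (Y j z.1)) =
      -fderiv ℝ (coframe Y k) z.1 (Y i z.1) (Y j z.1) - structureFun Y i j k z.1 := by
    intro i k
    have h1 := ((hY.contDiffAt_coframe hz k).differentiableAt (by simp)).hasFDerivAt.clm_apply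
      (hY.differentiableAt hz i).hasFDerivAt
    have h2 : (fun x => coframe Y k x (Y i x)) =ᶠ[𝓝 z.1] fun _ => if i = k then 1 else 0 := by
      filter_upwards [hY.isOpen.mem_nhds hz] with x hx using hY.coframe_apply hx k i
    have h3 := congrArg (fun L => L (Y j z.1)) (h1.fderiv.symm.trans h2.fderiv_eq)
    simp at h3
    linarith [hY.fderiv_coframe_sub hz i j k]
  have e3 := hY.alpha_eq_ite hz j
  have e4 := alpha_eq (Y := Y) j z
  simp [hRed, hamLift, conormalLift, hY.coframe_apply hz, d, -neg_smul]
  linear_combination e4 - e3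

/-- A curve in `S` is, near its origin, the lift of its own coordinates; conversely a straight line
in the coordinates lifts to a curve in `S`. -/
lemma tangentTo_lift (hS : IsConormal S Y V) (hz : z.1 ∈ V) (h0 : z.2 ≠ 0) :
    tangentTo S (conormalLift Y z) = LinearMap.range (fderiv ℝ (conormalLift Y) z).toLinearMap := by
  have hd := (hY.contDiffAt_conormalLift hz).differentiableAt (by simp)
  refine le_antisymm (Submodule.span_le.2 ?_) ?_
  · rintro w ⟨c, hc0, hc, hcS⟩
    have hV : ∀ᶠ t in 𝓝 (0 : ℝ), (c t).1 ∈ V := by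
      have h1 : ContinuousAt (fun t => (c t).1) 0 := continuousAt_fst.comp hc.continuousAt
      exact h1.eventually_mem (hY.isOpen.mem_nhds (by rw [hc0]; exact hz))
    have h1 : c =ᶠ[𝓝 0] fun t => conormalLift Y (conormalCoord Y (c t)) := by
      filter_upwards [hV, hcS] with t ht htS using (hY.conormalLift_coord hS ht htS).symm
    have hcd : HasFDerivAt (conormalCoord Y) (fderiv ℝ (conormalCoord Y) (c 0)) (c 0) := by
      rw [hc0]
      exact ((hY.contDiffAt_conormalCoord (μ := conormalLift Y z) hz).differentiableAt
        (by simp)).hasFDerivAt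
    have e : conormalCoord Y (c 0) = z := by rw [hc0, hY.conormalCoord_lift hz]
    have h2 := (e.symm ▸ hd.hasFDerivAt : HasFDerivAt (conormalLift Y)
      (fderiv ℝ (conormalLift Y) z) (conormalCoord Y (c 0))).comp_hasDerivAt 0
      (hcd.comp_hasDerivAt 0 hc)
    have h3 := hc.unique (h2.congr_of_eventuallyEq h1)
    rw [h3]
    exact ⟨_, rfl⟩
  · rintro _ ⟨v, rfl⟩
    refine Submodule.subset_span ⟨fun t => conormalLift Y (z + t • v), by simp, ?_, ?_⟩
    · have h1 : HasDerivAt (fun t : ℝ => z + t • v) v 0 := by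
        simpa using ((hasDerivAt_id (0 : ℝ)).smul_const v).const_add z
      have h2 : HasFDerivAt (conormalLift Y) (fderiv ℝ (conormalLift Y) z) (z + (0 : ℝ) • v) := by
        simpa using hd.hasFDerivAt
      exact h2.comp_hasDerivAt 0 h1
    · have h1 : ContinuousAt (fun t : ℝ => z + t • v) 0 := by fun_prop
      have h2 : {z : N7 | z.1 ∈ V ∧ z.2 ≠ 0} ∈ 𝓝 (z + (0 : ℝ) • v) := by
        refine IsOpen.mem_nhds ?_ (by simpa using ⟨hz, h0⟩)
        exact (hY.isOpen.preimage continuous_fst).inter (isOpen_ne.preimage continuous_snd)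
      filter_upwards [h1.eventually_mem h2] with t ht using hY.conormalLift_mem hS ht.1 ht.2

lemma fderiv_conormalLift_injective (hz : z.1 ∈ V) :
    Function.Injective (fderiv ℝ (conormalLift Y) z) := by
  rw [injective_iff_map_eq_zero]
  intro v hv
  rw [hY.fderiv_conormalLift hz] at hv
  have h1 : v.1 = 0 := congrArg Prod.fst hv
  have h2 := congrArg Prod.snd hv
  have h3 := congrArg (fun L : E5 →L[ℝ] ℝ => L (Y 3 z.1)) h2
  have h4 := congrArg (fun L : E5 →L[ℝ] ℝ => L (Y 4 z.1)) h2
  simp [h1, hY.coframe_apply hz] at h3 h4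
  exact Prod.ext h1 (Prod.ext h3 h4)

omit hY in
lemma fderiv_conormalLift_euler (hY : AdaptedFrame Y V) (hz : z.1 ∈ V) :
    fderiv ℝ (conormalLift Y) z (0, z.2.1, z.2.2) = euler (conormalLift Y z) := by
  rw [hY.fderiv_conormalLift hz]
  refine Prod.ext rfl ?_
  simp [euler, conormalLift]

lemma mem_vertSpace_lift (hS : IsConormal S Y V) (hz : z.1 ∈ V) (h0 : z.2 ≠ 0) {w : Phase} :
    w ∈ vertSpace S (conormalLift Y z) ↔
      ∃ v : N7, fderiv ℝ (conormalLift Y) z v = w ∧ v.1 = 0 := by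
  rw [vertSpace, hY.tangentTo_lift hS hz h0]
  constructor
  · rintro ⟨⟨v, rfl⟩, h⟩
    refine ⟨v, rfl, ?_⟩
    have h1 : (fderiv ℝ (conormalLift Y) z v).1 = 0 := h
    rwa [hY.fderiv_conormalLift hz] at h1
  · rintro ⟨v, rfl, h⟩
    refine ⟨⟨v, rfl⟩, ?_⟩
    change (fderiv ℝ (conormalLift Y) z v).1 = 0
    rw [hY.fderiv_conormalLift hz, h]

lemma mem_contactSpace_lift (hS : IsConormal S Y V) (hz : z.1 ∈ V) (h0 : z.2 ≠ 0) {w : Phase} :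
    w ∈ contactSpace S (conormalLift Y z) ↔
      ∃ v : N7, fderiv ℝ (conormalLift Y) z v = w ∧
        z.2.1 * coframe Y 3 z.1 v.1 + z.2.2 * coframe Y 4 z.1 v.1 = 0 := by
  have key : ∀ v, liouville (conormalLift Y z) (fderiv ℝ (conormalLift Y) z v) =
      z.2.1 * coframe Y 3 z.1 v.1 + z.2.2 * coframe Y 4 z.1 v.1 := by
    intro v
    rw [hY.fderiv_conormalLift hz]
    simp [liouville, conormalLift]
  rw [contactSpace, hY.tangentTo_lift hS hz h0]
  constructor
  · rintro ⟨⟨v, rfl⟩, h⟩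
    exact ⟨v, rfl, by rw [← key]; exact h⟩
  · rintro ⟨v, rfl, h⟩
    exact ⟨⟨v, rfl⟩, (key v).trans h⟩

/-- In the frame, `σ` on `S` is given by structure functions. Pairing a kernel vector with vertical
directions kills its components along `Y 3, Y 4`; pairing with `Y 0, Y 1` kills the one along `Y 2`;
pairing with `Y 2` makes the rest proportional to `u₄ Y 1 - u₅ Y 0`; pairing with `Y 3, Y 4` fixes
the vertical part. -/
lemma charSpace_lift (hS : IsConormal S Y V) (hz : z.1 ∈ V) (h0 : z.2 ≠ 0) :
    charSpace S (conormalLift Y z) =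
      Submodule.span ℝ {fderiv ℝ (conormalLift Y) z (hRed Y z)} := by
  have hsymp : ∀ v v' : N7, symp (fderiv ℝ (conormalLift Y) z v)
      (fderiv ℝ (conormalLift Y) z v') =
      z.2.1 * (fderiv ℝ (coframe Y 3) z.1 v.1 v'.1 - fderiv ℝ (coframe Y 3) z.1 v'.1 v.1) +
      z.2.2 * (fderiv ℝ (coframe Y 4) z.1 v.1 v'.1 - fderiv ℝ (coframe Y 4) z.1 v'.1 v.1) +
      v.2.1 * coframe Y 3 z.1 v'.1 + v.2.2 * coframe Y 4 z.1 v'.1 -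
      v'.2.1 * coframe Y 3 z.1 v.1 - v'.2.2 * coframe Y 4 z.1 v.1 := by
    intro v v'
    rw [hY.fderiv_conormalLift hz, hY.fderiv_conormalLift hz]
    simp [symp]
    ring
  have hframe : ∀ (x : Fin 5 → ℝ) (s t : ℝ) (j : Fin 5),
      symp (fderiv ℝ (conormalLift Y) z (∑ i, x i • Y i z.1, s, t))
        (fderiv ℝ (conormalLift Y) z (Y j z.1, 0, 0)) =
      -∑ i, x i * (z.2.1 * structureFun Y i j 3 z.1 + z.2.2 * structureFun Y i j 4 z.1) +
        (if j = 3 then s else 0) + if j = 4 then t else 0 := by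
    intro x s t j
    rw [hsymp]
    simp only [map_sum, map_smul, _root_.sum_apply, _root_.smul_apply, ← Finset.sum_sub_distrib,
      ← smul_sub, hY.fderiv_coframe_sub hz, Finset.mul_sum, ← Finset.sum_neg_distrib,
      ← Finset.sum_add_distrib, hY.coframe_apply hz]
    simp [Fin.sum_univ_five]
    ring
  ext w
  constructor
  · rintro ⟨hw, hw'⟩
    rw [hY.tangentTo_lift hS hz h0] at hw hw'
    obtain ⟨v, rfl⟩ := hw
    replace hw' : ∀ v', symp (fderiv ℝ (conormalLift Y) z v) (fderiv ℝ (conormalLift Y) z v') = 0 :=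
      fun v' => hw' _ ⟨v', rfl⟩
    have k3 : coframe Y 3 z.1 v.1 = 0 := by
      have := hw' (0, 1, 0)
      rw [hsymp] at this
      simpa using this
    have k4 : coframe Y 4 z.1 v.1 = 0 := by
      have := hw' (0, 0, 1)
      rw [hsymp] at this
      simpa using this
    set x : Fin 5 → ℝ := fun i => coframe Y i z.1 v.1 with hx
    have hv : v = (∑ i, x i • Y i z.1, v.2.1, v.2.2) := by
      rw [hx, hY.sum_coframe hz]
    have hj : ∀ j, -∑ i, x i * (z.2.1 * structureFun Y i j 3 z.1 +
        z.2.2 * structureFun Y i j 4 z.1) +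
        (if j = 3 then v.2.1 else 0) + (if j = 4 then v.2.2 else 0) = 0 := by
      intro j
      rw [← hframe, ← hv]
      exact hw' _
    have hx3 : x 3 = 0 := k3
    have hx4 : x 4 = 0 := k4
    have j0 := hj 0
    have j1 := hj 1
    have j2 := hj 2
    have j3 := hj 3
    have j4 := hj 4
    have e2 := hY.structureFun_01 hz (k := 3) (by decide)
    have e3 := hY.structureFun_01 hz (k := 4) (by decide)
    have e4 := hY.structureFun_02 hz (k := 3) le_rfl
    have e5 := hY.structureFun_02 hz (k := 4) (by decide)
    have e6 := hY.structureFun_12 hz (k := 3) le_rfl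
    have e7 := hY.structureFun_12 hz (k := 4) (by decide)
    have e8 := fun k => structureFun_swap (Y := Y) 1 0 k z.1
    have e9 := fun k => structureFun_swap (Y := Y) 2 0 k z.1
    have e10 := fun k => structureFun_swap (Y := Y) 2 1 k z.1
    simp only [Fin.sum_univ_five, hx3, hx4] at j0 j1 j2 j3 j4
    simp [e2, e3, e4, e5, e6, e7, e8, e9, e10, structureFun_self] at j0 j1 j2 j3 j4
    have hab : z.2.1 ^ 2 + z.2.2 ^ 2 ≠ 0 := by
      intro h
      refine h0 (Prod.ext ?_ ?_)
      · change z.2.1 = 0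
        nlinarith [sq_nonneg z.2.1, sq_nonneg z.2.2]
      · change z.2.2 = 0
        nlinarith [sq_nonneg z.2.1, sq_nonneg z.2.2]
    have hx2 : x 2 = 0 := by
      rcases j0 with h | h
      · exact h
      · rcases j1 with h' | h'
        · exact h'
        · simp [h, h'] at hab
    simp only [hx2] at j3 j4 j2
    simp at j3 j4 j2
    -- The coefficient of the projection of `(x 0, x 1)` to the direction `(-u₅, u₄)`; this formula
    -- also covers `u₅ = 0`.
    set r := (z.2.1 * x 1 - z.2.2 * x 0) / (z.2.1 ^ 2 + z.2.2 ^ 2) with hr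
    have x0 : x 0 = -(z.2.2 * r) := by
      rw [hr]
      field_simp
      linear_combination (-z.2.1) * j2
    have x1 : x 1 = z.2.1 * r := by
      rw [hr]
      field_simp
      linear_combination (-z.2.2) * j2
    refine Submodule.mem_span_singleton.2 ⟨r, ?_⟩
    rw [← map_smul]
    have hrv : r • hRed Y z = v := by
      rw [hv]
      refine Prod.ext ?_ (Prod.ext ?_ ?_)
      · simp [hRed, Fin.sum_univ_five, hx2, hx3, hx4, x0, x1]
        module
      · simp [hRed, alpha]
        rw [x0, x1] at j3
        linear_combination -j3
      · simp [hRed, alpha]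
        rw [x0, x1] at j4
        linear_combination -j4
    rw [hrv]
    rfl
  · intro h
    obtain ⟨r, rfl⟩ := Submodule.mem_span_singleton.1 h
    refine Submodule.smul_mem _ r ⟨?_, ?_⟩
    · rw [hY.tangentTo_lift hS hz h0]
      exact ⟨_, rfl⟩
    · rw [hY.tangentTo_lift hS hz h0]
      rintro _ ⟨v, rfl⟩
      have hj : ∀ j, symp (fderiv ℝ (conormalLift Y) z (hRed Y z))
          (fderiv ℝ (conormalLift Y) z (Y j z.1, 0, 0)) = 0 := by
        intro j
        have e : hRed Y z = (∑ i, (![-z.2.2, z.2.1, 0, 0, 0] : Fin 5 → ℝ) i • Y i z.1,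
            alpha Y 3 z, alpha Y 4 z) := by
          simp [hRed, Fin.sum_univ_five]
          abel
        rw [e, hframe]
        have e1 := hY.alpha_eq_ite hz j
        have e2 := alpha_eq (Y := Y) j z
        simp [Fin.sum_univ_five]
        linear_combination e2 - e1
      have e : v = ∑ j, coframe Y j z.1 v.1 • ((Y j z.1, 0, 0) : N7) + (0, v.2) := by
        refine Prod.ext ?_ ?_
        · conv_lhs => rw [← hY.sum_coframe hz v.1]
          simp [Fin.sum_univ_five]
        · simp [Fin.sum_univ_five]
      change symp _ (fderiv ℝ (conormalLift Y) z v) = 0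
      rw [e]
      simp only [Fin.sum_univ_five, map_add, map_smul, symp_add_right, symp_smul_right, hj]
      rw [hsymp]
      simp [hRed, hY.coframe_apply hz]

end AdaptedFrame

end ConormalGeometry

/-! ### Brackets on the cotangent bundle against brackets on the conormal. -/

section AmbientBrackets

/-- The iterated brackets of the characteristic field with `ε₁` on the cotangent bundle. -/
noncomputable def adAmb (Y : Fin 5 → E5 → E5) (θ : E5 → E5 →L[ℝ] ℝ) (k : ℕ) : Phase → Phase :=
  (fun W => VectorField.lieBracket ℝ (hAmb Y) W)^[k]
    (fun μ => (0, (μ.2 (Y 4 μ.1))⁻¹ • θ μ.1))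

variable {Y : Fin 5 → E5 → E5} {V : Set E5} {S : Set Phase} {θ : E5 → E5 →L[ℝ] ℝ}

lemma adAmb_succ (k : ℕ) :
    adAmb Y θ (k + 1) = VectorField.lieBracket ℝ (hAmb Y) (adAmb Y θ k) := by
  rw [adAmb, Function.iterate_succ_apply']
  rfl

lemma adRed_succ (k : ℕ) :
    adRed Y (k + 1) = VectorField.lieBracket ℝ (hRed Y) (adRed Y k) := by
  rw [adRed, Function.iterate_succ_apply']
  rfl

namespace AdaptedFrame

variable (hY : AdaptedFrame Y V)
include hY

lemma contDiffAt_hAmb {μ : Phase} (hμ : μ.1 ∈ V) : ContDiffAt ℝ ∞ (hAmb Y) μ := by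
  have h : ∀ i, ContDiffAt ℝ ∞ (hamLift (Y i)) μ := fun i =>
    ((hY.contDiffAt hμ i).comp μ contDiffAt_fst).prodMk
      (contDiffAt_snd.clm_comp (((hY.contDiffAt hμ i).fderiv_right
        (m := ∞) (by simp)).comp μ contDiffAt_fst)).neg
  exact ((hY.contDiffAt_frame_apply hμ 3).smul (h 1)).sub
    ((hY.contDiffAt_frame_apply hμ 4).smul (h 0))

lemma eq_coframe_of_dual {y : E5} (hy : y ∈ V) {L : E5 →L[ℝ] ℝ} {i : Fin 5}
    (hL : ∀ j, L (Y j y) = if j = i then 1 else 0) : L = coframe Y i y := by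
  ext v
  rw [← hY.sum_coframe hy v]
  simp only [map_sum, map_smul, hL, hY.coframe_apply hy]

variable (hθ : ∀ y ∈ V, ∀ j, θ y (Y j y) = if j = 3 then 1 else 0)
include hθ

lemma contDiffAt_adAmb (k : ℕ) {μ : Phase} (hμ : μ.1 ∈ V) (h4 : μ.2 (Y 4 μ.1) ≠ 0) :
    ContDiffAt ℝ ∞ (adAmb Y θ k) μ := by
  induction k generalizing μ with
  | zero =>
    have h1 : ContDiffAt ℝ ∞ θ μ.1 := by
      refine (hY.contDiffAt_coframe hμ 3).congr_of_eventuallyEq ?_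
      filter_upwards [hY.isOpen.mem_nhds hμ] with y hy using hY.eq_coframe_of_dual hy (hθ y hy)
    exact contDiffAt_const.prodMk (((hY.contDiffAt_frame_apply hμ 4).inv h4).smul
      (h1.comp μ contDiffAt_fst))
  | succ k ih =>
    rw [adAmb_succ]
    exact (hY.contDiffAt_hAmb hμ).lieBracket_vectorField (ih hμ h4) (by simp)

/-- The fields `hAmb` and `ε₁` live on the cotangent bundle but are tangent to the conormal, so they
are related to their coordinate versions by the parametrization, and relatedness passes to each
further bracket. -/
lemma fderiv_conormalLift_adRed (k : ℕ) {z : N7} (hz : z ∈ regularDomain V) :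
    fderiv ℝ (conormalLift Y) z (adRed Y k z) = adAmb Y θ k (conormalLift Y z) := by
  have h4 : ∀ z : N7, z ∈ regularDomain V →
      (conormalLift Y z).2 (Y 4 (conormalLift Y z).1) = z.2.2 := fun z hz =>
    congrArg (fun z : N7 => z.2.2) (hY.conormalCoord_lift hz.1)
  induction k generalizing z with
  | zero =>
    rw [hY.fderiv_conormalLift hz.1]
    refine Prod.ext rfl ?_
    change _ = ((conormalLift Y z).2 (Y 4 (conormalLift Y z).1))⁻¹ • θ z.1
    rw [h4 z hz, hY.eq_coframe_of_dual hz.1 (hθ _ hz.1)]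
    simp [adRed_zero]
  | succ k ih =>
    rw [adAmb_succ, adRed_succ]
    have hn := hY.isOpen_regularDomain.mem_nhds hz
    refine fderiv_lieBracket_of_related (hY.contDiffAt_conormalLift hz.1)
      ((hY.contDiffAt_hAmb (μ := conormalLift Y z) hz.1).differentiableAt (by simp))
      ((hY.contDiffAt_adAmb hθ k (μ := conormalLift Y z) hz.1
        (by rw [h4 z hz]; exact hz.2)).differentiableAt (by simp))
      ((hY.contDiffOn_hRed.contDiffAt hn).differentiableAt (by simp))
      (((hY.contDiffOn_adRed k).contDiffAt hn).differentiableAt (by simp)) ?_ ?_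
    · filter_upwards [hn] with x hx using hY.fderiv_conormalLift_hRed hx.1
    · filter_upwards [hn] with x hx using ih hx

/-- The expansions which define the forms `l₁`, `l₂`, `Q`, `B₂`. -/
lemma adAmb_expansions (hS : IsConormal S Y V) {μ : Phase} (hμ : μ.1 ∈ V) (hμS : μ ∈ S)
    (h5 : μ.2 (Y 4 μ.1) ≠ 0) :
    let u₄ := μ.2 (Y 3 μ.1)
    let u₅ := μ.2 (Y 4 μ.1)
    (adAmb Y θ 1 μ).1 - (-(1 / u₅)) • Y 1 μ.1 ∈ Submodule.span ℝ {(hAmb Y μ).1} ∧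
    (adAmb Y θ 2 μ).1 - ((linearOf (coefOne Y μ.1) ![u₄, u₅] / u₅) • Y 1 μ.1 + Y 2 μ.1) ∈
      Submodule.span ℝ {(hAmb Y μ).1} ∧
    (adAmb Y θ 3 μ).1 -
        ((quadraticOf (coefQ Y μ.1) ![u₄, u₅] / u₅) • Y 1 μ.1 +
          linearOf (coefTwo Y μ.1) ![u₄, u₅] • Y 2 μ.1 + u₄ • Y 4 μ.1 - u₅ • Y 3 μ.1) ∈
      Submodule.span ℝ {(hAmb Y μ).1} ∧
    ∃ b₀ b₁ : ℝ,
      adAmb Y θ 4 μ - (quadraticOf (coefB Y μ.1) ![u₄, u₅] • adAmb Y θ 2 μ +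
          b₁ • adAmb Y θ 1 μ + b₀ • adAmb Y θ 0 μ) ∈
        Submodule.span ℝ {hAmb Y μ, euler μ} := by
  set z := conormalCoord Y μ with hzdef
  have hz : z ∈ regularDomain V := ⟨hμ, h5⟩
  have hΨ : conormalLift Y z = μ := hY.conormalLift_coord hS hμ hμS
  have hk : ∀ k, adAmb Y θ k μ = fderiv ℝ (conormalLift Y) z (adRed Y k z) := fun k => by
    rw [hY.fderiv_conormalLift_adRed hθ k hz, hΨ]
  have hh : hAmb Y μ = fderiv ℝ (conormalLift Y) z (hRed Y z) := by
    rw [hY.fderiv_conormalLift_hRed hz.1, hΨ]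
  have he : euler μ = fderiv ℝ (conormalLift Y) z (0, z.2.1, z.2.2) := by
    rw [fderiv_conormalLift_euler hY hz.1, hΨ]
  have hfst : ∀ v, (fderiv ℝ (conormalLift Y) z v).1 = v.1 := fun v => by
    rw [hY.fderiv_conormalLift hz.1]
  simp only [hk, hh, he, hfst]
  refine ⟨?_, ?_, ?_, ?_⟩
  · obtain ⟨r, s, t, h⟩ := hY.adRed_one hz
    refine Submodule.mem_span_singleton.2 ⟨s, ?_⟩
    rw [h]
    simp [adRed_zero, hzdef, conormalCoord]
  · obtain ⟨r, s, t, h⟩ := hY.adRed_two hz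
    refine Submodule.mem_span_singleton.2 ⟨s, ?_⟩
    rw [h]
    simp [adRed_zero, hzdef, conormalCoord]
  · obtain ⟨r, s, t, h⟩ := hY.adRed_three hz
    refine Submodule.mem_span_singleton.2 ⟨s, ?_⟩
    rw [h]
    simp [adRed_zero, hzdef, conormalCoord]
  · refine ⟨bZeroCoef Y z, bOneCoef Y z, ?_⟩
    have h := hY.adRed_four hz
    rw [hY.iterCoef_four_two hz] at h
    obtain ⟨s, t, h⟩ := Submodule.mem_span_pair.1 h
    refine Submodule.mem_span_pair.2 ⟨s, t, ?_⟩
    rw [← map_smul, ← map_smul, ← map_add, h]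
    simp only [map_sub, map_add, map_smul]
    rfl

end AdaptedFrame

end AmbientBrackets

/-! ### The curve of vertical lines in the leaf space. -/

section LeafCurves

variable {Y : Fin 5 → E5 → E5} {V : Set E5}

/-- The images of the iterated brackets under the differential of `f` along the curve `κ`. -/
noncomputable def leafJet (Y : Fin 5 → E5 → E5) (f : N7 → E5) (κ : ℝ → N7) (k : ℕ) (t : ℝ) : E5 :=
  fderiv ℝ f (κ t) (adRed Y k (κ t))

/-- `f` is, over the open set `W`, the projection to the space of leaves. -/
structure IsReducedProjection (Y : Fin 5 → E5 → E5) (W : Set N7) (f : N7 → E5) : Prop where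
  isOpen : IsOpen W
  smooth : ContDiffOn ℝ ∞ f W
  ker : ∀ z ∈ W, ∀ v, fderiv ℝ f z v = 0 ↔ v ∈ leafSpan Y z

variable {W : Set N7} {f : N7 → E5} {κ : ℝ → N7} {a : ℝ → ℝ}

lemma hRed_mem_leafSpan (z : N7) : hRed Y z ∈ leafSpan Y z := Submodule.subset_span (by simp)

lemma euler_mem_leafSpan (z : N7) : ((0, z.2.1, z.2.2) : N7) ∈ leafSpan Y z :=
  Submodule.subset_span (by simp)

namespace IsReducedProjection

variable (hf : IsReducedProjection Y W f) (hY : AdaptedFrame Y V) (hW : W ⊆ regularDomain V)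
include hf hY hW

lemma hasDerivAt_leafJet {t : ℝ} (ht : κ t ∈ W) (hκ : HasDerivAt κ (a t • hRed Y (κ t)) t)
    (k : ℕ) : HasDerivAt (leafJet Y f κ k) (a t • leafJet Y f κ (k + 1) t) t := by
  have hn := hY.isOpen_regularDomain.mem_nhds (hW ht)
  have h := hasDerivAt_fderiv_along (φ := f) (H := hRed Y) (W := adRed Y k)
    (hf.smooth.contDiffAt (hf.isOpen.mem_nhds ht))
    ((hY.contDiffOn_hRed.contDiffAt hn).differentiableAt (by simp))
    (((hY.contDiffOn_adRed k).contDiffAt hn).differentiableAt (by simp))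
    (by filter_upwards [hf.isOpen.mem_nhds ht] with x hx
        exact (hf.ker x hx _).2 (hRed_mem_leafSpan x)) hκ
  rw [← adRed_succ] at h
  exact h

/-- The differential of `f` kills `h` and the Euler field, so the relation among brackets modulo
these two becomes an exact linear equation. -/
lemma leafJet_four {t : ℝ} (ht : κ t ∈ W) : leafJet Y f κ 4 t =
    iterCoef Y 4 2 (κ t) • leafJet Y f κ 2 t + bOneCoef Y (κ t) • leafJet Y f κ 1 t +
      bZeroCoef Y (κ t) • leafJet Y f κ 0 t := by
  have h := (hf.ker _ ht _).2 (hY.adRed_four (hW ht))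
  simp only [map_sub, map_add, map_smul, sub_eq_zero] at h
  exact h

lemma solvesSystem (hκW : ∀ᶠ t in 𝓝 (0 : ℝ), κ t ∈ W)
    (hκ : ∀ᶠ t in 𝓝 (0 : ℝ), HasDerivAt κ (a t • hRed Y (κ t)) t) (ℓ : E5 →L[ℝ] ℝ) :
    SolvesSystem a (fun t => iterCoef Y 4 2 (κ t)) (fun t => bOneCoef Y (κ t))
      (fun t => bZeroCoef Y (κ t)) (fun k t => ℓ (leafJet Y f κ k t)) := by
  have h : ∀ k, ∀ᶠ t in 𝓝 (0 : ℝ), HasDerivAt (fun t => ℓ (leafJet Y f κ k t))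
      (a t * ℓ (leafJet Y f κ (k + 1) t)) t := by
    intro k
    filter_upwards [hκW, hκ] with t ht hd
    have := ℓ.hasFDerivAt.comp_hasDerivAt t (hf.hasDerivAt_leafJet hY hW ht hd k)
    rwa [map_smul, smul_eq_mul] at this
  refine ⟨h 0, h 1, h 2, ?_⟩
  filter_upwards [hκW, h 3] with t ht hd
  rw [hf.leafJet_four hY hW ht] at hd
  simpa using hd

lemma linearIndependent_leafJet {t : ℝ} (ht : κ t ∈ W) {x : Fin 4 → ℝ}
    (h : ∑ k : Fin 4, x k • leafJet Y f κ k t = 0) : x = 0 := by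
  refine hY.eq_zero_of_sum_adRed_mem (hW ht) ((hf.ker _ ht _).1 ?_)
  rw [map_sum]
  simp only [map_smul]
  exact h

/-- The expansion of the curve of the vertical lines in the leaf space. -/
lemma exists_expansion {δ : ℝ} (hδ : 0 < δ) (ha : ContinuousOn a (Ioo (-δ) δ))
    (hκW : ∀ t ∈ Ioo (-δ) δ, κ t ∈ W)
    (hκ : ∀ t ∈ Ioo (-δ) δ, HasDerivAt κ (a t • hRed Y (κ t)) t) :
    ∃ L : E5 →L[ℝ] (Fin 4 → ℝ),
      (∀ k : Fin 4, L (leafJet Y f κ k 0) = Pi.single k 1) ∧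
      (∀ᶠ t in 𝓝 (0 : ℝ), leafJet Y f κ 0 t =
        ∑ k : Fin 4, L (leafJet Y f κ 0 t) k • leafJet Y f κ k 0) ∧
      ∃ s : ℝ → ℝ, s 0 = 0 ∧ HasDerivAt s (a 0) 0 ∧
        VanishesTo 4 (fun t => L (leafJet Y f κ 0 t) 1 - s t) ∧
        VanishesTo 5 (fun t => L (leafJet Y f κ 0 t) 2 -
          (s t ^ 2 / 2 + iterCoef Y 4 2 (κ 0) * s t ^ 4 / 24)) ∧
        VanishesTo 6 (fun t => L (leafJet Y f κ 0 t) 3 -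
          (s t ^ 3 / 6 + iterCoef Y 4 2 (κ 0) * s t ^ 5 / 120)) := by
  have hI : Ioo (-δ) δ ∈ 𝓝 (0 : ℝ) := Ioo_mem_nhds (neg_lt_zero.2 hδ) hδ
  have h0 : (0 : ℝ) ∈ Ioo (-δ) δ := mem_of_mem_nhds hI
  let G := leafJet Y f κ
  let T : (Fin 4 → ℝ) →ₗ[ℝ] E5 := Fintype.linearCombination ℝ fun k : Fin 4 => G k 0
  have hT : ∀ x, T x = ∑ k : Fin 4, x k • G k 0 := fun x => by
    simp [T, Fintype.linearCombination_apply]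
  have hTinj : LinearMap.ker T = ⊥ := by
    refine LinearMap.ker_eq_bot'.2 fun x hx => ?_
    rw [hT] at hx
    exact hf.linearIndependent_leafJet hY hW (hκW 0 h0) hx
  obtain ⟨L, hL⟩ := T.exists_leftInverse_of_injective hTinj
  have hLk : ∀ k : Fin 4, L (G k 0) = Pi.single k 1 := by
    intro k
    have h1 : T (Pi.single k 1) = G k 0 := by
      rw [hT, Finset.sum_eq_single k]
      · simp
      · intro j _ hj
        simp [hj]
      · simp
    rw [← h1]
    exact LinearMap.congr_fun hL _
  have hκW' := Filter.eventually_of_mem hI hκW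
  have hκ' := Filter.eventually_of_mem hI hκ
  have hsys := hf.solvesSystem hY hW hκW' hκ'
  have hca : ContinuousAt a 0 := ha.continuousAt hI
  have hcont : ∀ {g : N7 → ℝ}, ContDiffOn ℝ ∞ g (regularDomain V) →
      DifferentiableAt ℝ (fun t => g (κ t)) 0 := fun {g} hg =>
    ((hg.contDiffAt (hY.isOpen_regularDomain.mem_nhds (hW (hκW 0 h0)))).differentiableAt
      (by simp)).comp (0 : ℝ) (hκ 0 h0).differentiableAt
  have hB := hcont (hY.contDiffOn_iterCoef 4 2)
  have h₁ := (hcont hY.contDiffOn_bOneCoef).continuousAt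
  have h₀ := (hcont hY.contDiffOn_bZeroCoef).continuousAt
  have hB1 := VanishesTo.of_hasDerivAt hB.hasDerivAt
  refine ⟨L.toContinuousLinearMap, hLk, ?_, ?_⟩
  -- `P` vanishes on the span of the jet at `0`. Each component of `P` applied to the curve solves
  -- the system with zero initial data, so the curve stays in that span.
  · let P : E5 →ₗ[ℝ] E5 := LinearMap.id - T ∘ₗ L
    have hP0 : ∀ k : Fin 4, P (G k 0) = 0 := by
      intro k
      have h1 : T (Pi.single k 1) = G k 0 := by
        rw [hT, Finset.sum_eq_single k]
        · simp
        · intro j _ hj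
          simp [hj]
        · simp
      simp [P, hLk, h1]
    have hz : ∀ i : Fin 5, ∀ᶠ t in 𝓝 (0 : ℝ), P (G 0 t) i = 0 := by
      intro i
      let ℓ : E5 →L[ℝ] ℝ := (EuclideanSpace.proj i).comp P.toContinuousLinearMap
      have := (hsys ℓ).eventually_eq_zero hca hB.continuousAt h₁ h₀ fun k => by
        change P (G k 0) i = 0
        rw [hP0 k]
        rfl
      filter_upwards [this] with t ht using ht 0
    filter_upwards [Filter.eventually_all.2 hz] with t ht
    have h1 : P (G 0 t) = 0 := by
      ext i
      exact ht i
    have h2 : G 0 t = T (L (G 0 t)) := by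
      simpa [P, sub_eq_zero] using h1
    rw [hT] at h2
    exact h2
  · obtain ⟨s, hs0, hs⟩ := exists_primitive hδ ha
    let ℓ : Fin 4 → E5 →L[ℝ] ℝ := fun i =>
      (ContinuousLinearMap.proj (R := ℝ) (φ := fun _ : Fin 4 => ℝ) i).comp L.toContinuousLinearMap
    -- The coordinate `i` of the curve is the solution whose jet at `0` is the unit vector `i`.
    have hℓ : ∀ i k : Fin 4, ℓ i (G k 0) = if i = k then 1 else 0 := fun i k => by
      change L (G k 0) i = _
      rw [hLk, Pi.single_apply]
    refine ⟨s, hs0, hs.self_of_nhds, ?_, ?_, ?_⟩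
    · exact (hsys (ℓ 1)).vanishesTo_of_one hca hB.continuousAt h₁ h₀ hs hs0 (hℓ 1 0) (hℓ 1 1)
        (hℓ 1 2) (hℓ 1 3)
    · exact (hsys (ℓ 2)).vanishesTo_of_two hca hB1 hB.continuousAt h₁ h₀ hs hs0 (hℓ 2 0) (hℓ 2 1)
        (hℓ 2 2) (hℓ 2 3)
    · exact (hsys (ℓ 3)).vanishesTo_of_three hca hB1 hB.continuousAt h₁ h₀ hs hs0 (hℓ 3 0) (hℓ 3 1)
        (hℓ 3 2) (hℓ 3 3)

end IsReducedProjection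

end LeafCurves

/-! ### The osculating conic as a quadratic form. -/

section QuadraticForms

lemma quadraticForm_fin_three (b : QuadraticForm ℝ (Fin 3 → ℝ)) :
    ∃ c₁₁ c₁₂ c₁₃ c₂₂ c₂₃ c₃₃ : ℝ, ∀ x : Fin 3 → ℝ, b x = c₁₁ * x 0 ^ 2 + c₁₂ * (x 0 * x 1) +
      c₁₃ * (x 0 * x 2) + c₂₂ * x 1 ^ 2 + c₂₃ * (x 1 * x 2) + c₃₃ * x 2 ^ 2 := by
  let A := QuadraticMap.associated (R := ℝ) b
  let e : Fin 3 → Fin 3 → ℝ := fun i => Pi.single i 1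
  refine ⟨A (e 0) (e 0), A (e 0) (e 1) + A (e 1) (e 0), A (e 0) (e 2) + A (e 2) (e 0),
    A (e 1) (e 1), A (e 1) (e 2) + A (e 2) (e 1), A (e 2) (e 2), fun x => ?_⟩
  have h1 : b x = A x x := (QuadraticMap.associated_eq_self_apply ℝ b x).symm
  have h2 : x = x 0 • e 0 + x 1 • e 1 + x 2 • e 2 := by
    ext i
    fin_cases i <;> simp [e]
  rw [h1]
  conv_lhs => rw [h2]
  simp only [map_add, map_smul, LinearMap.add_apply, LinearMap.smul_apply, smul_eq_mul]
  ring

/-- The quadratic form of the osculating conic in the normal coordinates. -/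
noncomputable def osculatingForm (β : ℝ) : QuadraticForm ℝ (Fin 3 → ℝ) :=
  -QuadraticMap.linMulLin (LinearMap.proj 0) (LinearMap.proj 2) +
    (2 / 3 : ℝ) • QuadraticMap.linMulLin (LinearMap.proj 1) (LinearMap.proj 1) -
    (7 / 10 * β) • QuadraticMap.linMulLin (LinearMap.proj 2) (LinearMap.proj 2)

lemma osculatingForm_apply (β : ℝ) (x : Fin 3 → ℝ) :
    osculatingForm β x = -(x 0 * x 2) + 2 / 3 * x 1 ^ 2 - 7 / 10 * β * x 2 ^ 2 := by
  simp [osculatingForm, QuadraticMap.linMulLin_apply]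
  ring

/-- A conic with contact of order four with a normalized plane curve. -/
lemma osculatingForm_unique {β a : ℝ} {s : ℝ → ℝ} {x : ℝ → Fin 3 → ℝ} (hs : HasDerivAt s a 0)
    (hs0 : s 0 = 0) (ha : a ≠ 0) (h₁ : VanishesTo 4 (fun t => x t 0 - s t))
    (h₂ : VanishesTo 5 (fun t => x t 1 - (s t ^ 2 / 2 + β * s t ^ 4 / 24)))
    (h₃ : VanishesTo 6 (fun t => x t 2 - (s t ^ 3 / 6 + β * s t ^ 5 / 120)))
    {b : QuadraticForm ℝ (Fin 3 → ℝ)} (hb : b ≠ 0) (h : VanishesTo 7 (fun t => b (x t)))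
    (y : Fin 3 → ℝ) : b y = 0 ↔ osculatingForm β y = 0 := by
  obtain ⟨c₁₁, c₁₂, c₁₃, c₂₂, c₂₃, c₃₃, hc⟩ := quadraticForm_fin_three b
  obtain ⟨e₁, e₂, e₃, e₄, e₅⟩ := osculating_unique hs hs0 ha h₁ h₂ h₃
    (h.congr fun t => (hc (x t)).symm)
  have e : ∀ y, b y = -c₁₃ * osculatingForm β y := by
    intro y
    rw [hc, osculatingForm_apply, e₁, e₂, e₃, e₄, e₅]
    ring
  have h13 : -c₁₃ ≠ 0 := by
    intro h0
    refine hb (QuadraticMap.ext fun y => ?_)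
    rw [e, h0, zero_mul]
    rfl
  rw [e, mul_eq_zero, or_iff_right h13]

/-- Rescaling a plane curve to a nonvanishing representative. -/
lemma vanishesTo_seven_of_representative {η x : ℝ → Fin 3 → ℝ} (hη : ContinuousAt η 0)
    (hη0 : η 0 ≠ 0) (hx : ∀ i, VanishesTo 1 (fun t => x t i)) {b : QuadraticForm ℝ (Fin 3 → ℝ)}
    (hb : VanishesTo 5 (fun t => b (η t))) (hx0 : x 0 = 0)
    (h : ∀ᶠ t in 𝓝 (0 : ℝ), t ≠ 0 → ∃ r : ℝ, η t = r • x t) :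
    VanishesTo 7 (fun t => b (x t)) := by
  obtain ⟨i, hi⟩ : ∃ i, η 0 i ≠ 0 := by
    by_contra hcon
    push Not at hcon
    exact hη0 (funext hcon)
  have hc : ContinuousAt (fun t => η t i) 0 := (continuous_apply i).continuousAt.comp hη
  -- Where `η = r • x` this quotient is `r⁻¹`. It vanishes to order one because `η t i` is nonzero
  -- near `0`, so `b (x t)` gains two orders over `b (η t)`.
  have h1 : VanishesTo 1 (fun t => x t i * (η t i)⁻¹) :=
    (hx i).mul (.of_continuousAt (hc.inv₀ hi))
  have h2 := (h1.pow 2).mul hb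
  refine Asymptotics.IsBigO.congr' h2 ?_ Filter.EventuallyEq.rfl
  filter_upwards [hc.eventually_ne hi, h] with t ht hr
  by_cases ht0 : t = 0
  · subst ht0
    simp [hx0]
  · obtain ⟨r, hr⟩ := hr ht0
    have h3 : η t i = r * x t i := by rw [hr]; rfl
    have h4 : b (η t) = r * r * b (x t) := by rw [hr, QuadraticMap.map_smul, smul_eq_mul]
    rw [h3] at ht
    have hr0 : r ≠ 0 := left_ne_zero_of_mul ht
    have hx0 : x t i ≠ 0 := right_ne_zero_of_mul ht
    rw [h4, h3]
    field_simp

end QuadraticForms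

/-! ### Leaf projections in the coordinates (y, u₄, u₅). -/

section LeafSpace

variable {Y : Fin 5 → E5 → E5} {V : Set E5} {S : Set Phase} {φ : Phase → E5} {O : Set Phase}
  {z : N7}

lemma mem_vertical_iff (hz : z.2.2 ≠ 0) {v : N7} (hv : v.1 = 0) :
    v = (z.2.2 * (v.2.1 - v.2.2 / z.2.2 * z.2.1)) • adRed Y 0 z +
      (v.2.2 / z.2.2) • (0, z.2.1, z.2.2) := by
  rw [AdaptedFrame.adRed_zero]
  refine Prod.ext ?_ (Prod.ext ?_ ?_)
  · simp [hv]
  · simp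
    field_simp
    ring
  · simp
    field_simp

namespace AdaptedFrame

variable (hY : AdaptedFrame Y V) (hS : IsConormal S Y V)
include hY hS

omit hS in
lemma fderiv_comp_lift (hz : z ∈ regularDomain V) (hO : IsOpen O) (hφ : ContDiffOn ℝ ∞ φ O)
    (hzO : conormalLift Y z ∈ O) (v : N7) :
    fderiv ℝ (φ ∘ conormalLift Y) z v =
      dMap φ (conormalLift Y z) (fderiv ℝ (conormalLift Y) z v) := by
  rw [fderiv_comp z ((hφ.contDiffAt (hO.mem_nhds hzO)).differentiableAt (by simp))
    ((hY.contDiffAt_conormalLift hz.1).differentiableAt (by simp))]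
  rfl

omit hY hS in
lemma regular_ne_zero (hz : z ∈ regularDomain V) : z.2 ≠ 0 := fun h => hz.2 (by rw [h]; rfl)

omit hS in
/-- The domain on which a leaf projection gives a reduced projection. -/
lemma isOpen_lift_preimage (hO : IsOpen O) :
    IsOpen {z : N7 | z ∈ regularDomain V ∧ conormalLift Y z ∈ O} := by
  have hc : ContinuousOn (conormalLift Y) (regularDomain V) := fun z hz =>
    (hY.contDiffAt_conormalLift hz.1).continuousAt.continuousWithinAt
  exact hc.isOpen_inter_preimage hY.isOpen_regularDomain hO

/-- The differential of `conormalLift` is injective and carries `leafSpan` to the characteristic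
line plus the Euler line. One direction reads off a given leaf projection, the other serves to
construct one. -/
lemma leaf_kernel_iff (hz : z ∈ regularDomain V) (hO : IsOpen O) (hφ : ContDiffOn ℝ ∞ φ O)
    (hzO : conormalLift Y z ∈ O) :
    tangentTo S (conormalLift Y z) ⊓ LinearMap.ker (dMap φ (conormalLift Y z)) =
      charSpace S (conormalLift Y z) ⊔ Submodule.span ℝ {euler (conormalLift Y z)} ↔
    ∀ v, fderiv ℝ (φ ∘ conormalLift Y) z v = 0 ↔ v ∈ leafSpan Y z := by
  set D : N7 →ₗ[ℝ] Phase := (fderiv ℝ (conormalLift Y) z).toLinearMap with hD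
  have hinj : Function.Injective D := hY.fderiv_conormalLift_injective hz.1
  have h1 : charSpace S (conormalLift Y z) ⊔ Submodule.span ℝ {euler (conormalLift Y z)} =
      (leafSpan Y z).map D := by
    rw [hY.charSpace_lift hS hz.1 (regular_ne_zero hz), ← fderiv_conormalLift_euler hY hz.1,
      leafSpan, Submodule.map_span, Set.image_pair, Submodule.span_insert]
    rfl
  rw [h1, hY.tangentTo_lift hS hz.1 (regular_ne_zero hz)]
  simp only [hY.fderiv_comp_lift hz hO hφ hzO]
  constructor
  · intro h v
    have h2 : D v ∈ LinearMap.range D ⊓ LinearMap.ker (dMap φ (conormalLift Y z)) ↔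
        D v ∈ (leafSpan Y z).map D := by rw [← h]
    rw [Submodule.mem_map] at h2
    constructor
    · intro hv
      obtain ⟨u, hu, e⟩ := h2.1 ⟨⟨v, rfl⟩, hv⟩
      rwa [← hinj e]
    · intro hv
      exact (h2.2 ⟨v, hv, rfl⟩).2
  · intro h
    ext w
    constructor
    · rintro ⟨⟨v, rfl⟩, hw⟩
      exact ⟨v, (h v).1 hw, rfl⟩
    · rintro ⟨v, hv, rfl⟩
      exact ⟨⟨v, rfl⟩, (h v).2 hv⟩

lemma isReducedProjection {μ : Phase} (hφ : IsLeafProjection S μ O φ) :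
    IsReducedProjection Y {z | z ∈ regularDomain V ∧ conormalLift Y z ∈ O}
      (φ ∘ conormalLift Y) := by
  obtain ⟨hO, -, hsm, hker⟩ := hφ
  refine ⟨hY.isOpen_lift_preimage hO, fun z hz => ?_, fun z hz => ?_⟩
  · exact ((hsm.contDiffAt (hO.mem_nhds hz.2)).comp z
      (hY.contDiffAt_conormalLift hz.1.1)).contDiffWithinAt
  · exact (hY.leaf_kernel_iff hS hz.1 hO hsm hz.2).1
      (hker _ ⟨hz.2, hY.conormalLift_mem hS hz.1.1 (regular_ne_zero hz.1)⟩)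

/-- Vertical vectors are combinations of `ε₁` and the Euler field, and the latter is killed by the
projection. -/
lemma mem_lineE_iff {μ : Phase} (hφ : IsLeafProjection S μ O φ) (hz : z ∈ regularDomain V)
    (hzO : conormalLift Y z ∈ O) {w : E5} :
    w ∈ lineE S φ (conormalLift Y z) ↔
      ∃ r : ℝ, w = r • fderiv ℝ (φ ∘ conormalLift Y) z (adRed Y 0 z) := by
  have hk := ((hY.isReducedProjection hS hφ).ker z ⟨hz, hzO⟩ _).2 (euler_mem_leafSpan z)
  constructor
  · rintro ⟨u, hu, rfl⟩
    obtain ⟨v, rfl, hv⟩ := (hY.mem_vertSpace_lift hS hz.1 (regular_ne_zero hz)).1 hu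
    refine ⟨z.2.2 * (v.2.1 - v.2.2 / z.2.2 * z.2.1), ?_⟩
    rw [← hY.fderiv_comp_lift hz hφ.1 hφ.2.2.1 hzO]
    conv_lhs => rw [mem_vertical_iff (Y := Y) hz.2 hv]
    rw [map_add, map_smul, map_smul, hk, smul_zero, add_zero]
  · rintro ⟨r, rfl⟩
    rw [hY.fderiv_comp_lift hz hφ.1 hφ.2.2.1 hzO]
    refine Submodule.smul_mem _ r (Submodule.mem_map_of_mem ?_)
    exact (hY.mem_vertSpace_lift hS hz.1 (regular_ne_zero hz)).2 ⟨_, rfl, rfl⟩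

omit hS in
lemma adRed_contact (hz : z ∈ regularDomain V) (k : Fin 4) :
    z.2.1 * coframe Y 3 z.1 (adRed Y k z).1 + z.2.2 * coframe Y 4 z.1 (adRed Y k z).1 = 0 := by
  fin_cases k
  · simp [adRed_zero]
  · obtain ⟨r, s, t, e⟩ := hY.adRed_one hz
    simp only [e]
    simp [hRed, adRed_zero, hY.coframe_apply hz.1]
  · obtain ⟨r, s, t, e⟩ := hY.adRed_two hz
    simp only [e]
    simp [hRed, adRed_zero, hY.coframe_apply hz.1]
  · obtain ⟨r, s, t, e⟩ := hY.adRed_three hz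
    simp only [e]
    simp [hRed, adRed_zero, hY.coframe_apply hz.1]
    ring

lemma mem_leafContact_iff {μ : Phase} (hφ : IsLeafProjection S μ O φ) (hz : z ∈ regularDomain V)
    (hzO : conormalLift Y z ∈ O) {w : E5} :
    w ∈ leafContact S φ (conormalLift Y z) ↔
      ∃ x : Fin 4 → ℝ, w = ∑ k : Fin 4, x k • fderiv ℝ (φ ∘ conormalLift Y) z (adRed Y k z) := by
  have hk := fun v => ((hY.isReducedProjection hS hφ).ker z ⟨hz, hzO⟩ v).2
  constructor
  · rintro ⟨u, hu, rfl⟩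
    obtain ⟨v, rfl, hv⟩ := (hY.mem_contactSpace_lift hS hz.1 (regular_ne_zero hz)).1 hu
    obtain ⟨x, s, t, e⟩ := hY.exists_adRed_eq hz hv
    refine ⟨x, ?_⟩
    rw [← hY.fderiv_comp_lift hz hφ.1 hφ.2.2.1 hzO, e, map_add, map_add, map_smul, map_smul,
      hk _ (hRed_mem_leafSpan z), hk _ (euler_mem_leafSpan z), map_sum]
    simp only [map_smul, smul_zero, add_zero]
  · rintro ⟨x, rfl⟩
    simp only [hY.fderiv_comp_lift hz hφ.1 hφ.2.2.1 hzO]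
    refine Submodule.sum_mem _ fun k _ => Submodule.smul_mem _ _ (Submodule.mem_map_of_mem ?_)
    exact (hY.mem_contactSpace_lift hS hz.1 (regular_ne_zero hz)).2
      ⟨_, rfl, hY.adRed_contact hz k⟩

end AdaptedFrame

end LeafSpace

/-! ### The osculating cone in terms of the brackets. -/

section ConesOfExtremals

/-- The osculating cone in terms of an adapted frame. -/
def frameCone (Y : Fin 5 → E5 → E5) (z : N7) : Set E5 :=
  {v | ∃ (x : Fin 3 → ℝ) (s : ℝ),
    v = ∑ k : Fin 3, x k • (adRed Y (k + 1) z).1 + s • (hRed Y z).1 ∧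
      osculatingForm (iterCoef Y 4 2 z) x = 0}

variable {Y : Fin 5 → E5 → E5} {V : Set E5} {S : Set Phase} {φ : Phase → E5} {O : Set Phase}
  {z : N7}

namespace AdaptedFrame

variable (hY : AdaptedFrame Y V) (hS : IsConormal S Y V)
include hY hS

/-- Dividing by the line of `ε₁` amounts to dropping the coordinate `0` of `L`; the next three
brackets become the unit vectors. -/
lemma exists_reducedEquiv {μ : Phase} (hφ : IsLeafProjection S μ O φ) (hz : z ∈ regularDomain V)
    (hzO : conormalLift Y z ∈ O) {L : E5 →L[ℝ] (Fin 4 → ℝ)}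
    (hL : ∀ k : Fin 4, L (fderiv ℝ (φ ∘ conormalLift Y) z (adRed Y k z)) = Pi.single k 1) :
    ∃ e : ReducedSpace S φ (conormalLift Y z) ≃ₗ[ℝ] (Fin 3 → ℝ),
      ∀ w : leafContact S φ (conormalLift Y z),
        e ((lineIn S φ (conormalLift Y z) (conormalLift Y z)).mkQ w) =
          fun j => L (w : E5) j.succ := by
  let g : leafContact S φ (conormalLift Y z) →ₗ[ℝ] (Fin 3 → ℝ) :=
    LinearMap.funLeft ℝ ℝ Fin.succ ∘ₗ L.toLinearMap ∘ₗ Submodule.subtype _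
  have hLx : ∀ x : Fin 4 → ℝ,
      L (∑ k : Fin 4, x k • fderiv ℝ (φ ∘ conormalLift Y) z (adRed Y k z)) = x := by
    intro x
    simp only [map_sum, map_smul, hL]
    ext i
    simp [Finset.sum_apply, Pi.single_apply]
  have hker : LinearMap.ker g = lineIn S φ (conormalLift Y z) (conormalLift Y z) := by
    ext w
    change _ ↔ (w : E5) ∈ lineE S φ (conormalLift Y z)
    rw [hY.mem_lineE_iff hS hφ hz hzO]
    constructor
    · intro hw
      obtain ⟨x, hx⟩ := (hY.mem_leafContact_iff hS hφ hz hzO).1 w.2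
      have h1 : ∀ j : Fin 3, x j.succ = 0 := fun j => by
        have h2 := congrFun (LinearMap.mem_ker.1 hw) j
        change L (w : E5) j.succ = 0 at h2
        rwa [hx, hLx] at h2
      refine ⟨x 0, ?_⟩
      rw [hx, Fin.sum_univ_succ]
      simp [h1]
    · rintro ⟨r, hr⟩
      refine LinearMap.mem_ker.2 (funext fun j => ?_)
      change L (w : E5) j.succ = 0
      rw [hr, map_smul]
      have := hL 0
      rw [Fin.val_zero] at this
      rw [this]
      simp
  have hsurj : Function.Surjective g := by
    intro x
    refine ⟨⟨∑ k : Fin 4, (Fin.cons 0 x : Fin 4 → ℝ) k •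
      fderiv ℝ (φ ∘ conormalLift Y) z (adRed Y k z),
      (hY.mem_leafContact_iff hS hφ hz hzO).2 ⟨_, rfl⟩⟩, funext fun j => ?_⟩
    change L (∑ k : Fin 4, (Fin.cons 0 x : Fin 4 → ℝ) k •
      fderiv ℝ (φ ∘ conormalLift Y) z (adRed Y k z)) j.succ = x j
    rw [hLx, Fin.cons_succ]
  exact ⟨(Submodule.quotEquivOfEq _ _ hker.symm).trans (g.quotKerEquivOfSurjective hsurj),
    fun w => rfl⟩

/-- A contact vector is a combination of the four brackets, `h` and the Euler field. Passing to the
reduced space kills `ε₁`, `h` and the Euler field; passing to the base kills `ε₁` and the Euler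
field. Only `h` remains as the free direction of the cone. -/
lemma coneOf_eq {μ : Phase} (hφ : IsLeafProjection S μ O φ) (hz : z ∈ regularDomain V)
    (hzO : conormalLift Y z ∈ O) {L : E5 →L[ℝ] (Fin 4 → ℝ)}
    (hL : ∀ k : Fin 4, L (fderiv ℝ (φ ∘ conormalLift Y) z (adRed Y k z)) = Pi.single k 1)
    {e : ReducedSpace S φ (conormalLift Y z) ≃ₗ[ℝ] (Fin 3 → ℝ)}
    (he : ∀ w : leafContact S φ (conormalLift Y z),
        e ((lineIn S φ (conormalLift Y z) (conormalLift Y z)).mkQ w) =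
          fun j => L (w : E5) j.succ)
    {b : QuadraticForm ℝ (ReducedSpace S φ (conormalLift Y z))}
    (hb : ∀ y, b (e.symm y) = 0 ↔ osculatingForm (iterCoef Y 4 2 z) y = 0) :
    coneOf S φ (conormalLift Y z) b = frameCone Y z := by
  have hk := fun v => ((hY.isReducedProjection hS hφ).ker z ⟨hz, hzO⟩ v).2
  have hb' : ∀ r, b r = 0 ↔ osculatingForm (iterCoef Y 4 2 z) (e r) = 0 := fun r => by
    rw [← hb, e.symm_apply_apply]
  have key : ∀ (x : Fin 4 → ℝ) (s t : ℝ), (fun j : Fin 3 => L (dMap φ (conormalLift Y z)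
      (fderiv ℝ (conormalLift Y) z (∑ k : Fin 4, x k • adRed Y k z + s • hRed Y z +
        t • (0, z.2.1, z.2.2)))) j.succ) = fun j => x j.succ := by
    intro x s t
    have h1 := hk _ (hRed_mem_leafSpan z)
    have h2 := hk _ (euler_mem_leafSpan z)
    rw [← hY.fderiv_comp_lift hz hφ.1 hφ.2.2.1 hzO]
    simp only [map_add, h1, h2, smul_zero, add_zero, map_smul, map_sum, hL]
    ext j
    simp [Finset.sum_apply, Pi.single_apply]
  have hfst : ∀ v, (fderiv ℝ (conormalLift Y) z v).1 = v.1 := fun v => by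
    rw [hY.fderiv_conormalLift hz.1]
  ext v
  constructor
  · rintro ⟨w, hw, rfl, hbw⟩
    obtain ⟨u, rfl, hu⟩ := (hY.mem_contactSpace_lift hS hz.1 (regular_ne_zero hz)).1 hw
    obtain ⟨x, s, t, rfl⟩ := hY.exists_adRed_eq hz hu
    rw [hb', he] at hbw
    simp only [key] at hbw
    refine ⟨fun j => x j.succ, s, ?_, hbw⟩
    rw [hfst, Fin.sum_univ_succ]
    simp [adRed_zero, Prod.fst_sum]
  · rintro ⟨x, s, rfl, hx⟩
    have hc : z.2.1 * coframe Y 3 z.1 (∑ k : Fin 4, (Fin.cons 0 x : Fin 4 → ℝ) k • adRed Y k z +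
        s • hRed Y z + (0 : ℝ) • (0, z.2.1, z.2.2)).1 +
        z.2.2 * coframe Y 4 z.1 (∑ k : Fin 4, (Fin.cons 0 x : Fin 4 → ℝ) k • adRed Y k z +
        s • hRed Y z + (0 : ℝ) • (0, z.2.1, z.2.2)).1 = 0 := by
      have h0 := hY.adRed_contact hz
      have h3 : coframe Y 3 z.1 (hRed Y z).1 = 0 := by simp [hRed, hY.coframe_apply hz.1]
      have h4 : coframe Y 4 z.1 (hRed Y z).1 = 0 := by simp [hRed, hY.coframe_apply hz.1]
      simp only [zero_smul, add_zero, Prod.fst_add, Prod.smul_fst, Prod.fst_sum, map_add,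
        map_smul, map_sum, h3, h4, smul_eq_mul, mul_zero, add_zero, Finset.mul_sum,
        ← Finset.sum_add_distrib]
      refine Finset.sum_eq_zero fun k _ => ?_
      linear_combination (Fin.cons 0 x : Fin 4 → ℝ) k * h0 k
    refine ⟨_, (hY.mem_contactSpace_lift hS hz.1 (regular_ne_zero hz)).2 ⟨_, rfl, hc⟩, ?_, ?_⟩
    · rw [hfst, Fin.sum_univ_succ]
      simp [Prod.fst_sum]
    · rw [hb', he]
      simp only [key, Fin.cons_succ]
      exact hx

/-- An abnormal extremal in the coordinates `(y, u₄, u₅)`. -/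
lemma exists_extremal_coord (hz : z ∈ regularDomain V) {δ : ℝ} (hδ : 0 < δ) {c : ℝ → Phase}
    (hc : IsAbnormalExtremal S (conormalLift Y z) δ c) :
    ∃ (δ' : ℝ) (a : ℝ → ℝ), 0 < δ' ∧ δ' ≤ δ ∧ ContinuousOn a (Ioo (-δ') δ') ∧ a 0 ≠ 0 ∧
      conormalCoord Y (c 0) = z ∧ ∀ t ∈ Ioo (-δ') δ',
        conormalLift Y (conormalCoord Y (c t)) = c t ∧ conormalCoord Y (c t) ∈ regularDomain V ∧
        HasDerivAt (fun t => conormalCoord Y (c t)) (a t • hRed Y (conormalCoord Y (c t))) t := by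
  obtain ⟨hc0, hcs, hc⟩ := hc
  have hI : Ioo (-δ) δ ∈ 𝓝 (0 : ℝ) := Ioo_mem_nhds (neg_lt_zero.2 hδ) hδ
  have e0 : conormalCoord Y (c 0) = z := by rw [hc0, hY.conormalCoord_lift hz.1]
  have hcont : ContinuousAt (fun t => conormalCoord Y (c t)) 0 :=
    ContinuousAt.comp (hY.contDiffAt_conormalCoord (μ := c 0)
      (by rw [hc0]; exact hz.1)).continuousAt (hcs.contDiffAt hI).continuousAt
  have hev : ∀ᶠ t in 𝓝 (0 : ℝ), t ∈ Ioo (-δ) δ ∧ conormalCoord Y (c t) ∈ regularDomain V :=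
    (Filter.eventually_of_mem hI fun _ h => h).and
      (hcont.eventually_mem (hY.isOpen_regularDomain.mem_nhds (by rw [e0]; exact hz)))
  obtain ⟨δ', hδ', hball⟩ := Metric.eventually_nhds_iff_ball.1 hev
  rw [Real.ball_eq_Ioo, zero_sub, zero_add] at hball
  have hle : δ' ≤ δ := by
    by_contra hlt
    push Not at hlt
    exact lt_irrefl _ (hball δ ⟨by linarith, hlt⟩).1.2
  let κ : ℝ → N7 := fun t => conormalCoord Y (c t)
  have hκs : ContDiffOn ℝ ∞ κ (Ioo (-δ') δ') := fun t ht =>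
    ((hY.contDiffAt_conormalCoord (μ := c t) (hball t ht).2.1).comp t
      (hcs.contDiffAt (isOpen_Ioo.mem_nhds (hball t ht).1))).contDiffWithinAt
  have hlift : ∀ t ∈ Ioo (-δ') δ', conormalLift Y (κ t) = c t := fun t ht =>
    hY.conormalLift_coord hS (hball t ht).2.1 (hc t (hball t ht).1).1
  have hder : ∀ t ∈ Ioo (-δ') δ', ∃ r : ℝ, r ≠ 0 ∧ HasDerivAt κ (r • hRed Y (κ t)) t := by
    intro t ht
    have hκt := ((hκs.contDiffAt (isOpen_Ioo.mem_nhds ht)).differentiableAt (by simp)).hasDerivAt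
    have h1 : HasDerivAt (fun t => conormalLift Y (κ t))
        (fderiv ℝ (conormalLift Y) (κ t) (deriv κ t)) t :=
      ((hY.contDiffAt_conormalLift (z := κ t) (hball t ht).2.1).differentiableAt
        (by simp)).hasFDerivAt.comp_hasDerivAt t hκt
    have h2 : (fun t => conormalLift Y (κ t)) =ᶠ[𝓝 t] c := by
      filter_upwards [isOpen_Ioo.mem_nhds ht] with x hx using hlift x hx
    have h3 : deriv c t = fderiv ℝ (conormalLift Y) (κ t) (deriv κ t) := by
      rw [← h2.deriv_eq, h1.deriv]
    obtain ⟨-, h4, h5⟩ := hc t (hball t ht).1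
    rw [← hlift t ht, hY.charSpace_lift hS (hball t ht).2.1 (regular_ne_zero (hball t ht).2)] at h4
    obtain ⟨r, hr⟩ := Submodule.mem_span_singleton.1 h4
    have h6 : r • hRed Y (κ t) = deriv κ t := by
      refine hY.fderiv_conormalLift_injective (z := κ t) (hball t ht).2.1 ?_
      rw [map_smul, ← h3, ← hr]
    refine ⟨r, ?_, by rw [h6]; exact hκt⟩
    rintro rfl
    rw [zero_smul] at hr
    exact h5 hr.symm
  -- As `coframe Y 0` takes the value `-u₅` on `hRed`, this recovers the speed by a formula
  -- continuous in `t`.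
  let a : ℝ → ℝ := fun t => -(coframe Y 0 (κ t).1 (deriv κ t).1 * (κ t).2.2⁻¹)
  have ha : ∀ t ∈ Ioo (-δ') δ', ∀ r, HasDerivAt κ (r • hRed Y (κ t)) t → a t = r := by
    intro t ht r hr
    have hb : (κ t).2.2 ≠ 0 := (hball t ht).2.2
    have hV : (κ t).1 ∈ V := (hball t ht).2.1
    simp only [a]
    rw [hr.deriv]
    simp [hRed, hY.coframe_apply hV]
    field_simp
  have h0 : (0 : ℝ) ∈ Ioo (-δ') δ' := ⟨neg_lt_zero.2 hδ', hδ'⟩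
  refine ⟨δ', a, hδ', hle, ?_, ?_, e0, fun t ht => ⟨hlift t ht, (hball t ht).2, ?_⟩⟩
  · intro t ht
    have h1 : ContinuousAt κ t := (hκs.contDiffAt (isOpen_Ioo.mem_nhds ht)).continuousAt
    have h2 : ContinuousAt (deriv κ) t := (hκs.continuousOn_deriv_of_isOpen isOpen_Ioo
      (by simp)).continuousAt (isOpen_Ioo.mem_nhds ht)
    have h3 : ContinuousAt (fun t => coframe Y 0 (κ t).1) t :=
      ContinuousAt.comp (f := fun t => (κ t).1) (hY.contDiffAt_coframe (hball t ht).2.1 0).continuousAt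
        (continuousAt_fst.comp h1)
    have h4 : ContinuousAt (fun t => (κ t).2.2⁻¹) t :=
      (continuousAt_snd.comp (continuousAt_snd.comp h1)).inv₀ (hball t ht).2.2
    exact ((h3.clm_apply (continuousAt_fst.comp h2)).mul h4).neg.continuousWithinAt
  · obtain ⟨r, hr0, hr⟩ := hder 0 h0
    rw [ha 0 h0 r hr]
    exact hr0
  · obtain ⟨r, -, hr⟩ := hder t ht
    rw [ha t ht r hr]
    exact hr

end AdaptedFrame

end ConesOfExtremals

/-! ### Independence of the cone from the choices. -/

section ConesOfExtremals

variable {Y : Fin 5 → E5 → E5} {V : Set E5} {S : Set Phase} {z : N7}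

lemma continuousAt_of_functionals {R : Type} [AddCommGroup R] [Module ℝ R]
    {η : ℝ → R} {δ : ℝ} (hδ : 0 < δ)
    (h : ∀ f : R →ₗ[ℝ] ℝ, ContDiffOn ℝ ∞ (fun t => f (η t)) (Ioo (-δ) δ))
    (e : R →ₗ[ℝ] (Fin 3 → ℝ)) : ContinuousAt (fun t => e (η t)) 0 :=
  continuousAt_pi.2 fun i =>
    ((h (LinearMap.proj i ∘ₗ e)).contDiffAt (Ioo_mem_nhds (neg_lt_zero.2 hδ) hδ)).continuousAt

namespace AdaptedFrame

variable (hY : AdaptedFrame Y V) (hS : IsConormal S Y V)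
include hY hS

/-- The osculating cone does not depend on the choices. -/
theorem coneOf_eq_frameCone (hz : z ∈ regularDomain V) {O : Set Phase} {φ : Phase → E5} {δ : ℝ}
    {c : ℝ → Phase} {η : ℝ → ReducedSpace S φ (conormalLift Y z)}
    {b : QuadraticForm ℝ (ReducedSpace S φ (conormalLift Y z))}
    (hφ : IsLeafProjection S (conormalLift Y z) O φ) (hδ : 0 < δ)
    (hcO : ∀ t ∈ Ioo (-δ) δ, c t ∈ O) (hc : IsAbnormalExtremal S (conormalLift Y z) δ c)
    (hη : IsRepresentative S φ (conormalLift Y z) δ c η) (hb : IsOsculatingForm η b) :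
    coneOf S φ (conormalLift Y z) b = frameCone Y z := by
  obtain ⟨δ', a, hδ', hle, ha, ha0, hκ0, hκ⟩ := hY.exists_extremal_coord hS hz hδ hc
  set κ : ℝ → N7 := fun t => conormalCoord Y (c t) with hκdef
  have hI : Ioo (-δ') δ' ∈ 𝓝 (0 : ℝ) := Ioo_mem_nhds (neg_lt_zero.2 hδ') hδ'
  have hsub : Ioo (-δ') δ' ⊆ Ioo (-δ) δ := Ioo_subset_Ioo (by linarith) hle
  have hW : ∀ t ∈ Ioo (-δ') δ', κ t ∈ {z | z ∈ regularDomain V ∧ conormalLift Y z ∈ O} :=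
    fun t ht => ⟨(hκ t ht).2.1, by rw [(hκ t ht).1]; exact hcO t (hsub ht)⟩
  have hf := hY.isReducedProjection hS hφ
  obtain ⟨L, hL, hexp, s, hs0, hs, v1, v2, v3⟩ :=
    hf.exists_expansion hY (fun _ h => h.1) hδ' ha hW fun t ht => (hκ t ht).2.2
  have hL' : ∀ k : Fin 4, L (fderiv ℝ (φ ∘ conormalLift Y) z (adRed Y k z)) = Pi.single k 1 := by
    intro k
    have := hL k
    rwa [leafJet, show κ 0 = z from hκ0] at this
  have hzO : conormalLift Y z ∈ O := hφ.2.1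
  obtain ⟨e, he⟩ := hY.exists_reducedEquiv hS hφ hz hzO hL'
  let x : ℝ → Fin 3 → ℝ := fun t j => L (leafJet Y (φ ∘ conormalLift Y) κ 0 t) j.succ
  have hβ : iterCoef Y 4 2 (κ 0) = iterCoef Y 4 2 z := by rw [show κ 0 = z from hκ0]
  rw [hβ] at v2 v3
  have s1 : VanishesTo 1 s := (VanishesTo.of_hasDerivAt hs).congr fun t => by rw [hs0, sub_zero]
  have x1 : ∀ i, VanishesTo 1 (fun t => x t i) := by
    intro i
    fin_cases i
    · exact ((v1.mono (by norm_num)).add s1).congr fun t => by simp [x]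
    · refine ((v2.mono (m := 1) (by norm_num)).add
        ((((s1.pow 2).const_mul (1 / 2)).mono (m := 1) (by norm_num)).add
        (((s1.pow 4).const_mul (iterCoef Y 4 2 z / 24)).mono (m := 1) (by norm_num)))).congr
        fun t => ?_
      change L (leafJet Y (φ ∘ conormalLift Y) κ 0 t) 2 = _
      ring
    · refine ((v3.mono (m := 1) (by norm_num)).add
        ((((s1.pow 3).const_mul (1 / 6)).mono (m := 1) (by norm_num)).add
        (((s1.pow 5).const_mul (iterCoef Y 4 2 z / 120)).mono (m := 1) (by norm_num)))).congr
        fun t => ?_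
      change L (leafJet Y (φ ∘ conormalLift Y) κ 0 t) 3 = _
      ring
  have hx0 : x 0 = 0 := by
    funext j
    have h1 := hL 0
    rw [Fin.val_zero] at h1
    simp [x, h1]
  obtain ⟨hηs, hη0, hηmem⟩ := hη
  have h0 : (0 : ℝ) ∈ Ioo (-δ) δ := ⟨neg_lt_zero.2 hδ, hδ⟩
  let b' : QuadraticForm ℝ (Fin 3 → ℝ) := b.comp e.symm.toLinearMap
  have hb'e : ∀ r, b' (e r) = b r := fun r => by
    change b (e.symm (e r)) = b r
    rw [e.symm_apply_apply]
  have hb' : b' ≠ 0 := by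
    intro h
    refine hb.1 (QuadraticMap.ext fun r => ?_)
    rw [← hb'e, h]
    rfl
  have h7 : VanishesTo 7 (fun t => b' (x t)) := by
    refine vanishesTo_seven_of_representative (η := fun t => e (η t))
      (continuousAt_of_functionals hδ hηs e.toLinearMap)
      (fun h => hη0 0 h0 ((map_eq_zero_iff e e.injective).1 h)) x1
      (hb.2.congr_left fun t => (hb'e _).symm) hx0 ?_
    filter_upwards [hI] with t ht ht0
    obtain ⟨w, hw, hwe⟩ := hηmem t (hsub ht) ht0
    have hw' : (w : E5) ∈ lineE S φ (c t) := hw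
    rw [← (hκ t ht).1, hY.mem_lineE_iff hS hφ (hW t ht).1 (hW t ht).2] at hw'
    obtain ⟨r, hr⟩ := hw'
    refine ⟨r, ?_⟩
    rw [← hwe, he, hr]
    funext j
    rw [map_smul]
    rfl
  exact hY.coneOf_eq hS hφ hz hzO hL' he fun y => osculatingForm_unique hs hs0 ha0 v1 v2 v3 hb' h7 y

end AdaptedFrame

end ConesOfExtremals

/-! ### Existence of leaf projections. -/

section Existence

variable {Y : Fin 5 → E5 → E5} {V : Set E5} {S : Set Phase} {z : N7}

lemma exists_surjective_of_finrank {E F : Type} [NormedAddCommGroup E] [NormedSpace ℝ E]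
    [NormedAddCommGroup F] [NormedSpace ℝ F] [FiniteDimensional ℝ E] [FiniteDimensional ℝ F]
    (h : Module.finrank ℝ E = Module.finrank ℝ F + 1) {k : E} (hk : k ≠ 0) :
    ∃ P : E →L[ℝ] F, Function.Surjective P ∧ P k = 0 := by
  have h1 : Module.finrank ℝ (E ⧸ Submodule.span ℝ {k}) = Module.finrank ℝ F := by
    have := Submodule.finrank_quotient_add_finrank (Submodule.span ℝ {k})
    rw [finrank_span_singleton hk] at this
    omega
  let e := LinearEquiv.ofFinrankEq _ _ h1
  refine ⟨(e.toLinearMap ∘ₗ (Submodule.span ℝ {k}).mkQ).toContinuousLinearMap, ?_, ?_⟩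
  · exact e.surjective.comp (Submodule.mkQ_surjective _)
  · change e ((Submodule.span ℝ {k}).mkQ k) = 0
    rw [(Submodule.Quotient.mk_eq_zero _).2 (Submodule.mem_span_singleton_self k)
      |> fun h => (h : (Submodule.span ℝ {k}).mkQ k = 0), map_zero]

/-- The characteristic field on the projectivization, in the chart `v = u₄ / u₅`. -/
noncomputable def hProj (Y : Fin 5 → E5 → E5) (x : E5 × ℝ) : E5 × ℝ :=
  (x.2 • Y 1 x.1 - Y 0 x.1, alpha Y 3 (x.1, x.2, 1) - x.2 * alpha Y 4 (x.1, x.2, 1))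

/-- The projection to the projectivization. -/
noncomputable def projCoord (z : N7) : E5 × ℝ := (z.1, z.2.1 / z.2.2)

lemma contDiffAt_projCoord (hz : z.2.2 ≠ 0) : ContDiffAt ℝ ∞ projCoord z := by
  have h : ContDiffAt ℝ ∞ (fun z : N7 => z.2.2) z := by fun_prop
  have h' : ContDiffAt ℝ ∞ (fun z : N7 => z.2.1) z := by fun_prop
  exact contDiffAt_fst.prodMk (h'.div h hz)

lemma fderiv_projCoord (hz : z.2.2 ≠ 0) (v : N7) : fderiv ℝ projCoord z v =
    (v.1, v.2.1 / z.2.2 - z.2.1 * v.2.2 / z.2.2 ^ 2) := by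
  have hbi : HasFDerivAt (fun z : N7 => z.2.2⁻¹) _ z :=
    (hasDerivAt_inv hz).hasFDerivAt.comp z AdaptedFrame.hasFDerivAt_snd_snd
  have h1 : HasFDerivAt (fun z : N7 => (z.1, z.2.1 * z.2.2⁻¹)) _ z :=
    (hasFDerivAt_fst (𝕜 := ℝ) (E := E5) (F := ℝ × ℝ)).prodMk
      ((AdaptedFrame.hasFDerivAt_snd_fst (z := z)).mul hbi)
  have e : projCoord = fun z : N7 => (z.1, z.2.1 * z.2.2⁻¹) := by
    funext z
    rw [projCoord, div_eq_mul_inv]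
  rw [e, h1.fderiv]
  refine Prod.ext rfl ?_
  simp
  field_simp
  ring

namespace AdaptedFrame

variable (hY : AdaptedFrame Y V)
include hY

lemma contDiffOn_hProj : ContDiffOn ℝ ∞ (hProj Y) (Prod.fst ⁻¹' V) := by
  have hc : ∀ i j k, ContDiffOn ℝ ∞ (fun x : E5 × ℝ => structureFun Y i j k x.1)
      (Prod.fst ⁻¹' V) := fun i j k x hx =>
    ((hY.contDiffAt_structureFun hx i j k).comp x contDiffAt_fst).contDiffWithinAt
  have h1 : ∀ i, ContDiffOn ℝ ∞ (fun x : E5 × ℝ => Y i x.1) (Prod.fst ⁻¹' V) := fun i x hx =>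
    ((hY.contDiffAt hx i).comp x contDiffAt_fst).contDiffWithinAt
  have h2 : ContDiffOn ℝ ∞ (fun x : E5 × ℝ =>
      alpha Y 3 (x.1, x.2, 1) - x.2 * alpha Y 4 (x.1, x.2, 1)) (Prod.fst ⁻¹' V) := by
    unfold alpha
    fun_prop (disch := assumption)
  exact ((contDiff_snd.contDiffOn.smul (h1 1)).sub (h1 0)).prodMk h2

-- By homogeneity the characteristic field descends to the projectivization, up to the factor `u₅`.
omit hY in
lemma fderiv_projCoord_hRed (hz : z.2.2 ≠ 0) :
    fderiv ℝ projCoord z (hRed Y z) = z.2.2 • hProj Y (projCoord z) := by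
  rw [fderiv_projCoord hz]
  refine Prod.ext ?_ ?_
  · simp [hRed, hProj, projCoord, smul_sub, smul_smul]
    field_simp
  · simp [hRed, hProj, projCoord, alpha]
    field_simp

lemma hProj_ne_zero {x : E5 × ℝ} (hx : x.1 ∈ V) : hProj Y x ≠ 0 := by
  intro h
  have := congrArg (fun v : E5 × ℝ => coframe Y 0 x.1 v.1) h
  simp [hProj, hY.coframe_apply hx] at this

lemma hRed_ne_zero (hz : z ∈ regularDomain V) : hRed Y z ≠ 0 := by
  intro h
  have := congrArg (fun v : N7 => coframe Y 0 z.1 v.1) h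
  simp [hRed, hY.coframe_apply hz.1, hz.2] at this

/-- On the 6-dimensional projectivization the characteristic line is spanned by one nonvanishing
field, which has five first integrals. The differential of `projCoord` has the Euler line as kernel,
so the kernel of the composite is spanned by `h` and the Euler field. -/
lemma exists_reducedProjection (hz : z ∈ regularDomain V) :
    ∃ (W : Set N7) (f : N7 → E5), z ∈ W ∧ W ⊆ regularDomain V ∧ IsReducedProjection Y W f := by
  have hU : IsOpen (Prod.fst ⁻¹' V : Set (E5 × ℝ)) := hY.isOpen.preimage continuous_fst
  have hx : projCoord z ∈ (Prod.fst ⁻¹' V : Set (E5 × ℝ)) := hz.1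
  have hdim : Module.finrank ℝ (E5 × ℝ) = Module.finrank ℝ E5 + 1 := by simp
  obtain ⟨P, hP, hPK⟩ := exists_surjective_of_finrank hdim (hY.hProj_ne_zero hx)
  obtain ⟨Φ, W, hW, hxW, hWU, hΦ, hker⟩ := exists_first_integrals hU hY.contDiffOn_hProj hx
    (hY.hProj_ne_zero hx) P hP hPK hdim
  have hcont : ContinuousOn projCoord (regularDomain V) := fun z hz =>
    (contDiffAt_projCoord hz.2).continuousAt.continuousWithinAt
  refine ⟨{z | z ∈ regularDomain V ∧ projCoord z ∈ W}, Φ ∘ projCoord, ⟨hz, hxW⟩,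
    fun _ h => h.1, hcont.isOpen_inter_preimage hY.isOpen_regularDomain hW, ?_, ?_⟩
  · exact fun z hz => ((hΦ.contDiffAt (hW.mem_nhds hz.2)).comp z
      (contDiffAt_projCoord hz.1.2)).contDiffWithinAt
  · rintro z ⟨hz, hzW⟩ v
    rw [fderiv_comp z ((hΦ.contDiffAt (hW.mem_nhds hzW)).differentiableAt (by simp))
      ((contDiffAt_projCoord hz.2).differentiableAt (by simp)), ContinuousLinearMap.comp_apply]
    have h1 : ∀ u, fderiv ℝ Φ (projCoord z) u = 0 ↔ ∃ r : ℝ, r • hProj Y (projCoord z) = u := by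
      intro u
      rw [← Submodule.mem_span_singleton, ← hker _ hzW]
      rfl
    rw [h1]
    have hb := hz.2
    constructor
    · rintro ⟨r, hr⟩
      have h2 : fderiv ℝ projCoord z (v - (r / z.2.2) • hRed Y z) = 0 := by
        rw [map_sub, map_smul, fderiv_projCoord_hRed hb, ← hr, smul_smul, div_mul_cancel₀ _ hb,
          sub_self]
      set u := v - (r / z.2.2) • hRed Y z with hu
      rw [fderiv_projCoord hb] at h2
      have h3 : u.1 = 0 := congrArg Prod.fst h2
      have h4 : u.2.1 / z.2.2 - z.2.1 * u.2.2 / z.2.2 ^ 2 = 0 := congrArg Prod.snd h2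
      refine Submodule.mem_span_pair.2 ⟨r / z.2.2, u.2.2 / z.2.2, ?_⟩
      have h5 : u = (u.2.2 / z.2.2) • ((0, z.2.1, z.2.2) : N7) := by
        refine Prod.ext ?_ (Prod.ext ?_ ?_)
        · simp [h3]
        · simp
          field_simp at h4 ⊢
          linarith
        · simp
          field_simp
      rw [← h5, hu]
      abel
    · intro hv
      obtain ⟨s, t, rfl⟩ := Submodule.mem_span_pair.1 hv
      refine ⟨s * z.2.2, ?_⟩
      rw [map_add, map_smul, map_smul, fderiv_projCoord_hRed hb, fderiv_projCoord hb, smul_smul]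
      have : z.2.1 / z.2.2 - z.2.1 * z.2.2 / z.2.2 ^ 2 = 0 := by
        field_simp
        ring
      simp [this]

variable (hS : IsConormal S Y V)
include hS

/-- Extending a reduced projection to a neighborhood in the cotangent bundle. -/
lemma exists_leafProjection (hz : z ∈ regularDomain V) :
    ∃ (O : Set Phase) (φ : Phase → E5), IsLeafProjection S (conormalLift Y z) O φ := by
  obtain ⟨W, f, hzW, hWΩ, hf⟩ := hY.exists_reducedProjection hz
  have hV : IsOpen {μ : Phase | μ.1 ∈ V} := hY.isOpen.preimage continuous_fst
  have hcont : ContinuousOn (conormalCoord Y) {μ : Phase | μ.1 ∈ V} := fun μ hμ =>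
    (hY.contDiffAt_conormalCoord hμ).continuousAt.continuousWithinAt
  have hO : IsOpen {μ : Phase | μ.1 ∈ V ∧ conormalCoord Y μ ∈ W} :=
    hcont.isOpen_inter_preimage hV hf.isOpen
  -- `conormalCoord` is defined on an open set of the cotangent bundle and inverts the
  -- parametrization on `S`, so composing with it extends `f` off `S`.
  have hφ : ContDiffOn ℝ ∞ (f ∘ conormalCoord Y) {μ : Phase | μ.1 ∈ V ∧ conormalCoord Y μ ∈ W} :=
    fun μ hμ => ((hf.smooth.contDiffAt (hf.isOpen.mem_nhds hμ.2)).comp μ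
      (hY.contDiffAt_conormalCoord hμ.1)).contDiffWithinAt
  have hmem : ∀ z ∈ W, conormalLift Y z ∈ {μ : Phase | μ.1 ∈ V ∧ conormalCoord Y μ ∈ W} :=
    fun z hz => ⟨(hWΩ hz).1, by rw [hY.conormalCoord_lift (hWΩ hz).1]; exact hz⟩
  refine ⟨{μ | μ.1 ∈ V ∧ conormalCoord Y μ ∈ W}, f ∘ conormalCoord Y, hO, hmem z hzW, hφ, ?_⟩
  rintro ν ⟨⟨hνV, hνW⟩, hνS⟩
  rw [← hY.conormalLift_coord hS hνV hνS]
  refine (hY.leaf_kernel_iff hS (hWΩ hνW) hO hφ (hmem _ hνW)).2 fun v => ?_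
  rw [← hf.ker _ hνW v]
  have e : (f ∘ conormalCoord Y) ∘ conormalLift Y =ᶠ[𝓝 (conormalCoord Y ν)] f := by
    filter_upwards [hf.isOpen.mem_nhds hνW] with x hx
    simp only [Function.comp_apply]
    rw [hY.conormalCoord_lift (hWΩ hx).1]
  rw [e.fderiv_eq]

end AdaptedFrame

end Existence

/-! ### Existence of the osculating cone. -/

section Existence

variable {Y : Fin 5 → E5 → E5} {V : Set E5} {S : Set Phase} {z : N7}

namespace AdaptedFrame

variable (hY : AdaptedFrame Y V)
include hY

/-- An integral curve of the characteristic field. -/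
lemma exists_characteristic {W : Set N7} (hW : IsOpen W) (hzW : z ∈ W)
    (hWΩ : W ⊆ regularDomain V) :
    ∃ (δ : ℝ) (κ : ℝ → N7), 0 < δ ∧ κ 0 = z ∧ ContDiffOn ℝ ∞ κ (Ioo (-δ) δ) ∧
      ∀ t ∈ Ioo (-δ) δ, κ t ∈ W ∧ HasDerivAt κ (hRed Y (κ t)) t :=
  exists_smooth_integralCurve hW (hY.contDiffOn_hRed.mono hWΩ) hzW

variable (hS : IsConormal S Y V)
include hS

lemma isAbnormalExtremal_lift {δ : ℝ} {κ : ℝ → N7} (hκ0 : κ 0 = z)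
    (hκs : ContDiffOn ℝ ∞ κ (Ioo (-δ) δ))
    (hκ : ∀ t ∈ Ioo (-δ) δ, κ t ∈ regularDomain V ∧ HasDerivAt κ (hRed Y (κ t)) t) :
    IsAbnormalExtremal S (conormalLift Y z) δ fun t => conormalLift Y (κ t) := by
  refine ⟨congrArg _ hκ0, fun t ht => ((hY.contDiffAt_conormalLift (hκ t ht).1.1).comp t
    (hκs.contDiffAt (isOpen_Ioo.mem_nhds ht))).contDiffWithinAt, fun t ht => ?_⟩
  obtain ⟨hΩ, hd⟩ := hκ t ht
  have h1 : HasDerivAt (fun t => conormalLift Y (κ t))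
      (fderiv ℝ (conormalLift Y) (κ t) (hRed Y (κ t))) t :=
    ((hY.contDiffAt_conormalLift hΩ.1).differentiableAt (by simp)).hasFDerivAt.comp_hasDerivAt t hd
  rw [h1.deriv, hY.charSpace_lift hS hΩ.1 (regular_ne_zero hΩ)]
  refine ⟨hY.conormalLift_mem hS hΩ.1 (regular_ne_zero hΩ), Submodule.mem_span_singleton_self _,
    fun h => hY.hRed_ne_zero hΩ ?_⟩
  exact hY.fderiv_conormalLift_injective hΩ.1 (by rw [h, map_zero])

/-- The osculating cone exists. -/
theorem exists_osculating (hz : z ∈ regularDomain V) :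
    ∃ (O : Set Phase) (φ : Phase → E5) (δ : ℝ) (c : ℝ → Phase)
      (η : ℝ → ReducedSpace S φ (conormalLift Y z))
      (b : QuadraticForm ℝ (ReducedSpace S φ (conormalLift Y z))),
      IsLeafProjection S (conormalLift Y z) O φ ∧ 0 < δ ∧ (∀ t ∈ Ioo (-δ) δ, c t ∈ O) ∧
      IsAbnormalExtremal S (conormalLift Y z) δ c ∧
      IsRepresentative S φ (conormalLift Y z) δ c η ∧ IsOsculatingForm η b := by
  obtain ⟨O, φ, hφ⟩ := hY.exists_leafProjection hS hz
  have hf := hY.isReducedProjection hS hφ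
  have hzO : conormalLift Y z ∈ O := hφ.2.1
  obtain ⟨δ, κ, hδ, hκ0, hκs, hκ⟩ := hY.exists_characteristic hf.isOpen ⟨hz, hzO⟩ fun _ h => h.1
  have hI : Ioo (-δ) δ ∈ 𝓝 (0 : ℝ) := Ioo_mem_nhds (neg_lt_zero.2 hδ) hδ
  have h0 : (0 : ℝ) ∈ Ioo (-δ) δ := mem_of_mem_nhds hI
  have hκ1 : ∀ t ∈ Ioo (-δ) δ, HasDerivAt κ ((fun _ => (1 : ℝ)) t • hRed Y (κ t)) t :=
    fun t ht => by simpa using (hκ t ht).2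
  obtain ⟨L, hL, hexp, s, hs0, hs, v1, v2, v3⟩ :=
    hf.exists_expansion hY (fun _ h => h.1) hδ (a := fun _ => 1) continuousOn_const
      (fun t ht => (hκ t ht).1) hκ1
  have hL' : ∀ k : Fin 4, L (fderiv ℝ (φ ∘ conormalLift Y) z (adRed Y k z)) = Pi.single k 1 := by
    intro k
    have := hL k
    rwa [leafJet, hκ0] at this
  obtain ⟨e, he⟩ := hY.exists_reducedEquiv hS hφ hz hzO hL'
  let x : ℝ → Fin 3 → ℝ := fun t j => L (leafJet Y (φ ∘ conormalLift Y) κ 0 t) j.succ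
  have hG : ContDiffOn ℝ ∞ (leafJet Y (φ ∘ conormalLift Y) κ 0) (Ioo (-δ) δ) := by
    intro t ht
    obtain ⟨hW, -⟩ := hκ t ht
    have h1 := ((hf.smooth.contDiffAt (hf.isOpen.mem_nhds hW)).fderiv_right (m := ∞)
      (by simp)).comp t (hκs.contDiffAt (isOpen_Ioo.mem_nhds ht))
    have h2 := ((hY.contDiffOn_adRed 0).contDiffAt (hY.isOpen_regularDomain.mem_nhds hW.1)).comp t
      (hκs.contDiffAt (isOpen_Ioo.mem_nhds ht))
    exact (h1.clm_apply h2).contDiffWithinAt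
  have hxs : ∀ j, ContDiffOn ℝ ∞ (fun t => x t j) (Ioo (-δ) δ) := fun j =>
    ((ContinuousLinearMap.proj (R := ℝ) (φ := fun _ : Fin 4 => ℝ) j.succ).comp
      L).contDiff.comp_contDiffOn hG
  have hx0 : x 0 = 0 := by
    funext j
    have h1 := hL 0
    rw [Fin.val_zero] at h1
    simp [x, h1]
  -- The curve `x` vanishes at `0`, where the line `𝓔_γ(λ)` itself is divided out. The smooth
  -- quotient `x / t` removes the singularity; its value at `0` is the first unit vector.
  choose g hgs hg hg0 using fun j => exists_smooth_quotient (hxs j) (congrFun hx0 j)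
  have hxd : ∀ j, deriv (fun t => x t j) 0 = if j = 0 then 1 else 0 := by
    intro j
    have h1 := hf.hasDerivAt_leafJet hY (a := fun _ => 1) (fun _ h => h.1) (hκ 0 h0).1 (hκ1 0 h0) 0
    have h2 := ((ContinuousLinearMap.proj (R := ℝ) (φ := fun _ : Fin 4 => ℝ) j.succ).comp
      L).hasFDerivAt.comp_hasDerivAt 0 h1
    have h3 := hL 1
    rw [Fin.val_one] at h3
    have h4 : deriv (fun t => x t j) 0 = _ := h2.deriv
    rw [h4]
    simp only [one_smul, zero_add, ContinuousLinearMap.comp_apply, h3]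
    fin_cases j <;> simp
  let y : ℝ → Fin 3 → ℝ := fun t j => g j t
  have hy0 : y 0 = Pi.single 0 1 := by
    funext j
    simp [y, hg0, hxd, Pi.single_apply]
  have hyx : ∀ t ∈ Ioo (-δ) δ, x t = t • y t := fun t ht => funext fun j => hg j t ht
  have hyc : ContinuousAt y 0 := continuousAt_pi.2 fun j => ((hgs j).contDiffAt hI).continuousAt
  have hyne : ∀ᶠ t in 𝓝 (0 : ℝ), y t ≠ 0 := hyc.eventually_ne (by
    rw [hy0]
    intro h
    simpa using congrFun h 0)
  obtain ⟨δ', hδ', hball⟩ := Metric.eventually_nhds_iff_ball.1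
    ((Filter.eventually_of_mem hI fun _ h => h).and (hexp.and hyne))
  rw [Real.ball_eq_Ioo, zero_sub, zero_add] at hball
  have hsub : Ioo (-δ') δ' ⊆ Ioo (-δ) δ := fun t ht => (hball t ht).1
  have s1 : VanishesTo 1 s := (VanishesTo.of_hasDerivAt hs).congr fun t => by rw [hs0, sub_zero]
  rw [hκ0] at v2 v3
  have h7 : VanishesTo 7 (fun t => osculatingForm (iterCoef Y 4 2 z) (x t)) :=
    (vanishesTo_osculating s1 v1 v2 v3).congr fun t => by
      rw [osculatingForm_apply]
      rfl
  refine ⟨O, φ, δ', fun t => conormalLift Y (κ t), fun t => e.symm (y t),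
    (osculatingForm (iterCoef Y 4 2 z)).comp e.toLinearMap, hφ, hδ',
    fun t ht => (hκ t (hsub ht)).1.2,
    hY.isAbnormalExtremal_lift hS hκ0 (hκs.mono hsub)
      (fun t ht => ⟨(hκ t (hsub ht)).1.1, (hκ t (hsub ht)).2⟩), ⟨?_, ?_, ?_⟩, ?_, ?_⟩
  · intro ℓ
    have h1 : (fun t => ℓ (e.symm (y t))) = fun t =>
        (ℓ ∘ₗ e.symm.toLinearMap).toContinuousLinearMap (y t) := rfl
    rw [h1]
    exact (ContinuousLinearMap.contDiff _).comp_contDiffOn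
      (contDiffOn_pi.2 fun j => (hgs j).mono hsub)
  · intro t ht h
    exact (hball t ht).2.2 ((map_eq_zero_iff e.symm e.symm.injective).1 h)
  · intro t ht ht0
    have hlC : leafJet Y (φ ∘ conormalLift Y) κ 0 t ∈ leafContact S φ (conormalLift Y z) := by
      refine (hY.mem_leafContact_iff hS hφ hz hzO).2
        ⟨L (leafJet Y (φ ∘ conormalLift Y) κ 0 t), ?_⟩
      have := (hball t ht).2.1
      simp only [leafJet, hκ0] at this ⊢
      exact this
    refine ⟨t⁻¹ • ⟨leafJet Y (φ ∘ conormalLift Y) κ 0 t, hlC⟩, ?_, ?_⟩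
    · have hW := (hκ t (hsub ht)).1
      exact (hY.mem_lineE_iff hS hφ hW.1 hW.2).2 ⟨t⁻¹, rfl⟩
    · refine e.injective ?_
      rw [he]
      change _ = e (e.symm (y t))
      rw [e.apply_symm_apply]
      have h1 : y t = t⁻¹ • x t := by
        rw [hyx t (hsub ht), smul_smul, inv_mul_cancel₀ ht0, one_smul]
      rw [h1]
      funext j
      simp [x]
  · intro h
    have h1 := congrArg (fun q => q (e.symm ![0, 1, 0])) h
    simp [QuadraticMap.comp_apply, osculatingForm_apply] at h1
  · obtain ⟨C, hC⟩ := Asymptotics.IsBigO.bound h7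
    refine Asymptotics.IsBigO.of_bound C ?_
    filter_upwards [hC, hI] with t ht htI
    have h1 : ((osculatingForm (iterCoef Y 4 2 z)).comp e.toLinearMap) (e.symm (y t)) =
        osculatingForm (iterCoef Y 4 2 z) (y t) := by
      change osculatingForm (iterCoef Y 4 2 z) (e (e.symm (y t))) = _
      rw [e.apply_symm_apply]
    rw [h1]
    -- At `t = 0` the bound demands that the form vanish exactly; elsewhere it is the bound of order
    -- 7 for `x = t • y` with `t ^ 2` cancelled.
    by_cases ht0 : t = 0
    · subst ht0
      rw [hy0]
      simp [osculatingForm_apply]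
    · rw [hyx t htI, QuadraticMap.map_smul, smul_eq_mul, norm_mul, norm_mul, norm_pow] at ht
      rw [norm_pow]
      have hpos : 0 < ‖t‖ := norm_pos_iff.2 ht0
      have h2 : ‖t‖ * ‖t‖ * ‖osculatingForm (iterCoef Y 4 2 z) (y t)‖ ≤
          ‖t‖ * ‖t‖ * (C * ‖t‖ ^ 5) := by
        calc _ ≤ C * ‖t‖ ^ 7 := ht
          _ = _ := by ring
      exact le_of_mul_le_mul_left h2 (by positivity)

end AdaptedFrame

end Existence

/-! ### The equation of the cone in frame coordinates. -/

section ConeEquation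

/-- The left-hand side of the equation of the union of the cones, in terms of the frame. -/
noncomputable def frameForm (Y : Fin 5 → E5 → E5) (y : E5) (x : Fin 5 → ℝ) : ℝ :=
  mainForm (linearOf (coefOne Y y)) (linearOf (coefTwo Y y)) (quadraticOf (coefQ Y y))
    (quadraticOf (coefB Y y)) x

lemma frameForm_eq (Y : Fin 5 → E5 → E5) (y : E5) (x : Fin 5 → ℝ) : frameForm Y y x =
    x 0 * x 4 - x 1 * x 3 +
      2 / 3 * (x 2 - (coefTwo Y y 0 * x 4 - coefTwo Y y 1 * x 3) -
        3 / 4 * (coefOne Y y 0 * x 4 - coefOne Y y 1 * x 3)) ^ 2 -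
      (7 / 10 * (coefB Y y 0 * x 4 ^ 2 - coefB Y y 1 * (x 4 * x 3) + coefB Y y 2 * x 3 ^ 2) +
        (coefQ Y y 0 * x 4 ^ 2 - coefQ Y y 1 * (x 4 * x 3) + coefQ Y y 2 * x 3 ^ 2) +
        3 / 8 * (coefOne Y y 0 * x 4 - coefOne Y y 1 * x 3) ^ 2) := by
  rw [frameForm, mainForm]
  simp only [linearOf_apply, quadraticOf_apply]
  ring

/-- The frame in which the roles of the generators of the distribution are interchanged. -/
noncomputable def swapFrame (Y : Fin 5 → E5 → E5) : Fin 5 → E5 → E5 :=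
  ![Y 1, Y 0, -Y 2, -Y 4, -Y 3]

/-- The coordinates with respect to the interchanged frame. -/
def swapCoord (x : Fin 5 → ℝ) : Fin 5 → ℝ := ![x 1, x 0, -x 2, -x 4, -x 3]

lemma sum_swapCoord (Y : Fin 5 → E5 → E5) (y : E5) (x : Fin 5 → ℝ) :
    ∑ i, swapCoord x i • swapFrame Y i y = ∑ i, x i • Y i y := by
  simp [Fin.sum_univ_five, swapCoord, swapFrame]
  abel

variable {Y : Fin 5 → E5 → E5} {V : Set E5} {S : Set Phase} {z : N7}

lemma IsConormal.swap (hS : IsConormal S Y V) : IsConormal S (swapFrame Y) V := by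
  intro μ hμ
  rw [hS μ hμ]
  simp [swapFrame]
  tauto

namespace AdaptedFrame

variable (hY : AdaptedFrame Y V)
include hY

/-- Exchanging the generators changes the sign of their bracket, hence exchanges and negates the
last two fields. -/
lemma swap : AdaptedFrame (swapFrame Y) V := by
  have hd : ∀ {i}, ∀ y ∈ V, DifferentiableAt ℝ (Y i) y := fun {i} y hy => hY.differentiableAt hy i
  have hneg : ∀ i y, VectorField.lieBracket ℝ (Y i) (-Y 2) y =
      -VectorField.lieBracket ℝ (Y i) (Y 2) y := by
    intro i y
    simp only [VectorField.lieBracket, Pi.neg_apply, map_neg]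
    rw [fderiv_neg]
    simp
    abel
  refine ⟨hY.isOpen, ?_, ?_, ?_, ?_, ?_⟩
  · intro i
    fin_cases i
    exacts [hY.smooth 1, hY.smooth 0, (hY.smooth 2).neg, (hY.smooth 4).neg, (hY.smooth 3).neg]
  · intro y hy
    rw [Fintype.linearIndependent_iff]
    intro g hg
    have h1 : ∑ i, (![g 1, g 0, -g 2, -g 4, -g 3] : Fin 5 → ℝ) i • Y i y = 0 := by
      rw [← hg]
      simp [Fin.sum_univ_five, swapFrame]
      abel
    have h2 := Fintype.linearIndependent_iff.1 (hY.indep y hy) _ h1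
    intro i
    fin_cases i
    · simpa using h2 1
    · simpa using h2 0
    · simpa using h2 2
    · simpa using h2 4
    · simpa using h2 3
  · intro y hy
    have h := hY.bracket01 y hy
    rw [VectorField.lieBracket_swap] at h
    obtain ⟨r, s, h⟩ := Submodule.mem_span_pair.1 h
    refine Submodule.mem_span_pair.2 ⟨-s, -r, ?_⟩
    simp [swapFrame]
    have h' := congrArg Neg.neg h
    simp at h'
    rw [← sub_eq_zero] at h' ⊢
    rw [← h']
    abel
  · intro y hy
    obtain ⟨r, s, t, h⟩ := Submodule.mem_span_triple.1 (hY.bracket12 y hy)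
    refine Submodule.mem_span_triple.2 ⟨-s, -r, t, ?_⟩
    simp [swapFrame, hneg]
    have h' := congrArg Neg.neg h
    simp at h'
    rw [← sub_eq_zero] at h' ⊢
    rw [← h']
    abel
  · intro y hy
    obtain ⟨r, s, t, h⟩ := Submodule.mem_span_triple.1 (hY.bracket02 y hy)
    refine Submodule.mem_span_triple.2 ⟨-s, -r, t, ?_⟩
    simp [swapFrame, hneg]
    have h' := congrArg Neg.neg h
    simp at h'
    rw [← sub_eq_zero] at h' ⊢
    rw [← h']
    abel

lemma coords_unique {y : E5} (hy : y ∈ V) {x x' : Fin 5 → ℝ}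
    (h : ∑ i, x i • Y i y = ∑ i, x' i • Y i y) : x = x' := by
  ext k
  have := congrArg (coframe Y k y) h
  simpa [hY.coframe_apply hy] using this

/-- The equation of the cone in the coordinates of the frame. -/
lemma mem_frameCone_iff (hz : z ∈ regularDomain V) (x : Fin 5 → ℝ) :
    ∑ i, x i • Y i z.1 ∈ frameCone Y z ↔
      z.2.1 * x 3 + z.2.2 * x 4 = 0 ∧ frameForm Y z.1 x = 0 := by
  obtain ⟨r1, s1, t1, e1⟩ := hY.adRed_one hz
  obtain ⟨r2, s2, t2, e2⟩ := hY.adRed_two hz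
  obtain ⟨r3, s3, t3, e3⟩ := hY.adRed_three hz
  have hb := hz.2
  set l := linearOf (coefOne Y z.1) ![z.2.1, z.2.2] with hl
  set m := linearOf (coefTwo Y z.1) ![z.2.1, z.2.2] with hm
  set q := quadraticOf (coefQ Y z.1) ![z.2.1, z.2.2] with hq
  have hsum : ∀ (X : Fin 3 → ℝ) (s : ℝ),
      ∑ k : Fin 3, X k • (adRed Y (k + 1) z).1 + s • (hRed Y z).1 =
      ∑ i, (![-z.2.2 * (s + X 0 * s1 + X 1 * s2 + X 2 * s3),
        (-X 0 + X 1 * l + X 2 * q) / z.2.2 + z.2.1 * (s + X 0 * s1 + X 1 * s2 + X 2 * s3),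
        X 1 + X 2 * m, -z.2.2 * X 2, z.2.1 * X 2] : Fin 5 → ℝ) i • Y i z.1 := by
    intro X s
    rw [Fin.sum_univ_three, Fin.sum_univ_five]
    simp only [Fin.val_zero, Fin.val_one, Fin.val_two, zero_add, one_add_one_eq_two,
      show 2 + 1 = 3 from rfl, e1, e2, e3, adRed_zero]
    simp [hRed]
    match_scalars <;> field_simp <;> ring
  -- Here `(x 4, -x 3) = X 2 • (u₄, u₅)`, so factors `X 2` turn the values of the forms at `(u₄,
  -- u₅)` into values at `(x 4, -x 3)`, and the point of the fiber disappears. Completing the square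
  -- in `2/3 * X 1 ^ 2 - l * X 1 * X 2` gives the constants `3/4` and `3/8`.
  have hform : ∀ (X : Fin 3 → ℝ) (s : ℝ), x = ![-z.2.2 * s,
        (-X 0 + X 1 * l + X 2 * q) / z.2.2 + z.2.1 * s,
        X 1 + X 2 * m, -z.2.2 * X 2, z.2.1 * X 2] →
      osculatingForm (iterCoef Y 4 2 z) X = frameForm Y z.1 x := by
    intro X s hx
    rw [osculatingForm_apply, frameForm_eq, hY.iterCoef_four_two hz, hx, hl, hm, hq]
    simp only [linearOf_apply, quadraticOf_apply, Matrix.cons_val, Matrix.cons_val_zero,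
      Matrix.cons_val_one]
    field_simp
    ring
  constructor
  · rintro ⟨X, s, hv, h0⟩
    rw [hsum] at hv
    have hx := hY.coords_unique hz.1 hv
    refine ⟨?_, by rw [← hform X _ hx]; exact h0⟩
    rw [hx]
    simp
    ring
  · rintro ⟨h1, h2⟩
    have hx4 : x 4 = z.2.1 * (-x 3 / z.2.2) := by
      field_simp
      linarith
    have hx : x = ![-z.2.2 * (-x 0 / z.2.2),
        (-(-z.2.2 * x 1 + (x 2 - (-x 3 / z.2.2) * m) * l + (-x 3 / z.2.2) * q - z.2.1 * x 0) +
          (x 2 - (-x 3 / z.2.2) * m) * l + (-x 3 / z.2.2) * q) / z.2.2 +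
          z.2.1 * (-x 0 / z.2.2),
        (x 2 - (-x 3 / z.2.2) * m) + (-x 3 / z.2.2) * m, -z.2.2 * (-x 3 / z.2.2),
        z.2.1 * (-x 3 / z.2.2)] := by
      ext i
      fin_cases i
      · simp
        field_simp
      · simp
        field_simp
        ring
      · simp
      · simp
        field_simp
      · simpa using hx4
    -- The equations of `hsum` solved for `X`; the coefficient of `hRed` is then shifted to offset
    -- the multiples of `hRed` contained in the brackets.
    let X : Fin 3 → ℝ := ![-z.2.2 * x 1 + (x 2 - (-x 3 / z.2.2) * m) * l + (-x 3 / z.2.2) * q -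
      z.2.1 * x 0, x 2 - (-x 3 / z.2.2) * m, -x 3 / z.2.2]
    refine ⟨X, -x 0 / z.2.2 - X 0 * s1 - X 1 * s2 - X 2 * s3, ?_, ?_⟩
    · rw [hsum]
      congr 1
      funext i
      congr 1
      conv_lhs => rw [hx]
      have e : -x 0 / z.2.2 - X 0 * s1 - X 1 * s2 - X 2 * s3 + X 0 * s1 + X 1 * s2 + X 2 * s3 =
        -x 0 / z.2.2 := by ring
      rw [e]
      simp [X]
    · rw [hform X (-x 0 / z.2.2) hx]
      exact h2

end AdaptedFrame

end ConeEquation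

/-! ### The union of the cones over a fiber. -/

section UnionOfCones

/-- `A` is the osculating cone at `μ`, for some choice of the auxiliary data. -/
def IsOsculatingCone (S : Set Phase) (μ : Phase) (A : Set E5) : Prop :=
  ∃ (O : Set Phase) (φ : Phase → E5) (δ : ℝ) (c : ℝ → Phase) (η : ℝ → ReducedSpace S φ μ)
    (b : QuadraticForm ℝ (ReducedSpace S φ μ)),
    IsLeafProjection S μ O φ ∧ 0 < δ ∧ (∀ t ∈ Ioo (-δ) δ, c t ∈ O) ∧
    IsAbnormalExtremal S μ δ c ∧ IsRepresentative S φ μ δ c η ∧ IsOsculatingForm η b ∧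
    A = coneOf S φ μ b

variable {Y : Fin 5 → E5 → E5} {V : Set E5} {S : Set Phase} {z : N7} {μ : Phase}

namespace AdaptedFrame

variable (hY : AdaptedFrame Y V) (hS : IsConormal S Y V)
include hY hS

lemma isOsculatingCone_lift_iff (hz : z ∈ regularDomain V) {A : Set E5} :
    IsOsculatingCone S (conormalLift Y z) A ↔ A = frameCone Y z := by
  constructor
  · rintro ⟨O, φ, δ, c, η, b, h1, h2, h3, h4, h5, h6, rfl⟩
    exact hY.coneOf_eq_frameCone hS hz h1 h2 h3 h4 h5 h6
  · rintro rfl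
    obtain ⟨O, φ, δ, c, η, b, h1, h2, h3, h4, h5, h6⟩ := hY.exists_osculating hS hz
    exact ⟨O, φ, δ, c, η, b, h1, h2, h3, h4, h5, h6,
      (hY.coneOf_eq_frameCone hS hz h1 h2 h3 h4 h5 h6).symm⟩

lemma isOsculatingCone_iff (hμ : μ.1 ∈ V) (hμS : μ ∈ S) (h4 : μ.2 (Y 4 μ.1) ≠ 0) {A : Set E5} :
    IsOsculatingCone S μ A ↔ A = frameCone Y (conormalCoord Y μ) := by
  have := hY.isOsculatingCone_lift_iff hS (z := conormalCoord Y μ) ⟨hμ, h4⟩ (A := A)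
  rwa [hY.conormalLift_coord hS hμ hμS] at this

lemma coord_ne_zero (hμ : μ.1 ∈ V) (hμS : μ ∈ S) (h4 : μ.2 (Y 4 μ.1) = 0) :
    (μ.2 (Y 3 μ.1)) ≠ 0 := by
  intro h3
  refine ((hS μ hμ).1 hμS).1 ?_
  have h := congrArg Prod.snd (hY.conormalLift_coord hS hμ hμS)
  rw [← h]
  simp [conormalLift, conormalCoord, h3, h4]

/-- The osculating cone exists and is unique. -/
theorem existsUnique_osculatingCone (hμ : μ.1 ∈ V) (hμS : μ ∈ S) :
    ∃! A : Set E5, IsOsculatingCone S μ A := by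
  -- Where `u₅ = 0` one has `u₄ ≠ 0`, so the frame with interchanged generators applies.
  by_cases h4 : μ.2 (Y 4 μ.1) = 0
  · have h3 := hY.coord_ne_zero hS hμ hμS h4
    have h3' : μ.2 (swapFrame Y 4 μ.1) ≠ 0 := by simpa [swapFrame] using h3
    simp only [hY.swap.isOsculatingCone_iff hS.swap hμ hμS h3', existsUnique_eq]
  · simp only [hY.isOsculatingCone_iff hS hμ hμS h4, existsUnique_eq]

/-- The covector with `(u₄, u₅) = (x 4, -x 3)` annihilates the vector and is regular for both
frames. By uniqueness of the cone at this covector both forms decide the same membership. -/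
lemma frameForm_swap_iff {y : E5} (hy : y ∈ V) {x : Fin 5 → ℝ} (h3 : x 3 ≠ 0) (h4 : x 4 ≠ 0) :
    frameForm Y y x = 0 ↔ frameForm (swapFrame Y) y (swapCoord x) = 0 := by
  let z : N7 := (y, x 4, -x 3)
  have hz : z ∈ regularDomain V := ⟨hy, neg_ne_zero.2 h3⟩
  have hz' : conormalCoord (swapFrame Y) (conormalLift Y z) = (y, x 3, -x 4) := by
    have h := hY.conormalCoord_lift (z := z) hy
    have e3 : (conormalLift Y z).2 (Y 3 y) = x 4 := congrArg (fun z : N7 => z.2.1) h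
    have e4 : (conormalLift Y z).2 (Y 4 y) = -x 3 := congrArg (fun z : N7 => z.2.2) h
    refine Prod.ext rfl (Prod.ext ?_ ?_)
    · change (conormalLift Y z).2 (-Y 4 y) = x 3
      rw [map_neg, e4, neg_neg]
    · change (conormalLift Y z).2 (-Y 3 y) = -x 4
      rw [map_neg, e3]
  have hzS : conormalLift Y z ∈ S := hY.conormalLift_mem hS hy (regular_ne_zero hz)
  have h5 : (conormalLift Y z).2 (swapFrame Y 4 (conormalLift Y z).1) ≠ 0 := by
    have h := congrArg (fun z : N7 => z.2.2) hz'
    change (conormalLift Y z).2 (swapFrame Y 4 (conormalLift Y z).1) = -x 4 at h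
    rw [h]
    exact neg_ne_zero.2 h4
  have h6 := (hY.swap.isOsculatingCone_iff hS.swap hy hzS h5).1
    ((hY.isOsculatingCone_lift_iff hS hz).2 rfl)
  rw [hz'] at h6
  have h7 := hY.mem_frameCone_iff hz x
  have h8 := hY.swap.mem_frameCone_iff (z := (y, x 3, -x 4)) ⟨hy, neg_ne_zero.2 h4⟩ (swapCoord x)
  rw [h6] at h7
  have e := sum_swapCoord Y y x
  rw [e, h7] at h8
  have c1 : x 4 * x 3 + -x 3 * x 4 = 0 := by ring
  have c2 : x 3 * swapCoord x 3 + -x 4 * swapCoord x 4 = 0 := by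
    simp [swapCoord]
    ring
  exact ⟨fun h => (h8.1 ⟨c1, h⟩).2, fun h => (h8.2 ⟨c2, h⟩).2⟩

/-- The equation of the union of the cones does not depend on the order of the generators. -/
lemma frameForm_swap {y : E5} (hy : y ∈ V) (x : Fin 5 → ℝ) :
    frameForm (swapFrame Y) y (swapCoord x) = frameForm Y y x := by
  have key : ∀ x : Fin 5 → ℝ, x 3 ≠ 0 → x 4 ≠ 0 →
      frameForm (swapFrame Y) y (swapCoord x) = frameForm Y y x := by
    intro x h3 h4
    -- Both forms are affine in `x 0` with the same slope `x 4`. Subtracting `r` from `x 0` makes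
    -- the first one vanish, so equality of zero sets yields equality of values.
    obtain ⟨r, hr⟩ : ∃ r, r * x 4 = frameForm Y y x := ⟨_, div_mul_cancel₀ _ h4⟩
    let x' : Fin 5 → ℝ := ![x 0 - r, x 1, x 2, x 3, x 4]
    have h1 : frameForm Y y x' = 0 := by
      have : frameForm Y y x' = frameForm Y y x - r * x 4 := by
        rw [frameForm_eq Y y x', frameForm_eq Y y x]
        simp only [x', Matrix.cons_val, Matrix.cons_val_zero, Matrix.cons_val_one]
        ring
      rw [this, hr, sub_self]
    have h2 := (hY.frameForm_swap_iff hS hy (x := x') h3 h4).1 h1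
    have h3 : frameForm (swapFrame Y) y (swapCoord x') =
        frameForm (swapFrame Y) y (swapCoord x) - r * x 4 := by
      rw [frameForm_eq _ y (swapCoord x'), frameForm_eq _ y (swapCoord x)]
      simp only [x', swapCoord, Matrix.cons_val, Matrix.cons_val_zero, Matrix.cons_val_one]
      ring
    rw [h2, hr] at h3
    linarith
  -- The cases `x 3 = 0` and `x 4 = 0` follow by continuity along this line, where both coordinates
  -- are nonzero for small `t ≠ 0`.
  let p : ℝ → Fin 5 → ℝ := fun t => ![x 0, x 1, x 2, x 3 + t, x 4 + t]
  have hp0 : p 0 = x := by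
    ext i
    fin_cases i <;> simp [p]
  have c1 : Continuous fun t => frameForm (swapFrame Y) y (swapCoord (p t)) := by
    simp only [frameForm_eq, p, swapCoord, Matrix.cons_val, Matrix.cons_val_zero,
      Matrix.cons_val_one]
    fun_prop
  have c2 : Continuous fun t => frameForm Y y (p t) := by
    simp only [frameForm_eq, p, Matrix.cons_val, Matrix.cons_val_zero, Matrix.cons_val_one]
    fun_prop
  have hne : ∀ r : ℝ, ∀ᶠ t in 𝓝[≠] (0 : ℝ), r + t ≠ 0 := by
    intro r
    by_cases hr : r = 0
    · filter_upwards [self_mem_nhdsWithin] with t ht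
      rwa [hr, zero_add]
    · exact ((continuous_const.add continuous_id).continuousAt.eventually_ne
        (by simpa using hr)).filter_mono nhdsWithin_le_nhds
  have hev : (fun t => frameForm (swapFrame Y) y (swapCoord (p t))) =ᶠ[𝓝[≠] 0]
      fun t => frameForm Y y (p t) := by
    filter_upwards [hne (x 3), hne (x 4)] with t h3 h4 using key (p t) h3 h4
  have l1 := (c1.tendsto 0).mono_left (nhdsWithin_le_nhds (s := {0}ᶜ))
  have l2 := (c2.tendsto 0).mono_left (nhdsWithin_le_nhds (s := {0}ᶜ))
  have := tendsto_nhds_unique (l1.congr' hev) l2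
  simpa [hp0] using this

/-- The equation of the union of the osculating cones over a point. -/
theorem mem_union_cones_iff {y : E5} (hy : y ∈ V) (x : Fin 5 → ℝ) :
    (∃ p : E5 →L[ℝ] ℝ, ((y, p) : Phase) ∈ S ∧ ∃ A, IsOsculatingCone S (y, p) A ∧
      ∑ i, x i • Y i y ∈ A) ↔ frameForm Y y x = 0 := by
  constructor
  · rintro ⟨p, hpS, A, hA, hx⟩
    by_cases h4 : p (Y 4 y) = 0
    · have h3 := hY.coord_ne_zero hS (μ := (y, p)) hy hpS h4
      have h3' : p (swapFrame Y 4 y) ≠ 0 := by simpa [swapFrame] using h3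
      rw [(hY.swap.isOsculatingCone_iff hS.swap (μ := (y, p)) hy hpS h3').1 hA,
        ← sum_swapCoord] at hx
      have := ((hY.swap.mem_frameCone_iff (z := conormalCoord (swapFrame Y) (y, p)) ⟨hy, h3'⟩
        (swapCoord x)).1 hx).2
      rwa [← hY.frameForm_swap hS hy]
    · rw [(hY.isOsculatingCone_iff hS (μ := (y, p)) hy hpS h4).1 hA] at hx
      exact ((hY.mem_frameCone_iff (z := conormalCoord Y (y, p)) ⟨hy, h4⟩ x).1 hx).2
  · intro h
    -- Every tangent vector is annihilated by some covector of the fiber; therefore the union of the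
    -- cones fills the whole quadric.
    obtain ⟨a, b, hab, hc⟩ : ∃ a b : ℝ, (a ≠ 0 ∨ b ≠ 0) ∧ a * x 3 + b * x 4 = 0 := by
      by_cases h34 : x 3 = 0 ∧ x 4 = 0
      · exact ⟨0, 1, Or.inr one_ne_zero, by simp [h34]⟩
      · refine ⟨x 4, -x 3, ?_, by ring⟩
        rw [neg_ne_zero]
        tauto
    by_cases hb : b = 0
    · have ha : a ≠ 0 := by tauto
      have hz : ((y, -b, -a) : N7) ∈ regularDomain V := ⟨hy, neg_ne_zero.2 ha⟩
      refine ⟨(conormalLift (swapFrame Y) (y, -b, -a)).2,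
        hY.swap.conormalLift_mem hS.swap hy (regular_ne_zero hz), _,
        (hY.swap.isOsculatingCone_lift_iff hS.swap hz).2 rfl, ?_⟩
      rw [← sum_swapCoord]
      refine (hY.swap.mem_frameCone_iff hz (swapCoord x)).2 ⟨?_, ?_⟩
      · simp [swapCoord]
        linarith
      · rw [hY.frameForm_swap hS hy, h]
    · have hz : ((y, a, b) : N7) ∈ regularDomain V := ⟨hy, hb⟩
      exact ⟨(conormalLift Y (y, a, b)).2, hY.conormalLift_mem hS hy (regular_ne_zero hz), _,
        (hY.isOsculatingCone_lift_iff hS hz).2 rfl, (hY.mem_frameCone_iff hz x).2 ⟨hc, h⟩⟩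

end AdaptedFrame

end UnionOfCones

/-! ### The signature of the quadratic form. -/

section Signature

/-- The weights of a diagonalization of the form `x₀x₄ - x₁x₃ + ⅔ x₂²`. -/
noncomputable def signatureWeights : Fin 5 → ℝ := ![1 / 4, 1 / 4, 2 / 3, -1 / 4, -1 / 4]

lemma ncard_signatureWeights_pos : {i | 0 < signatureWeights i}.ncard = 3 := by
  have : {i | 0 < signatureWeights i} = (({0, 1, 2} : Finset (Fin 5)) : Set (Fin 5)) := by
    ext i
    fin_cases i <;> simp [signatureWeights]
  rw [this, Set.ncard_coe_finset]
  rfl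

lemma ncard_signatureWeights_neg : {i | signatureWeights i < 0}.ncard = 2 := by
  have : {i | signatureWeights i < 0} = (({3, 4} : Finset (Fin 5)) : Set (Fin 5)) := by
    ext i
    fin_cases i <;> norm_num [signatureWeights, Fin.ext_iff]
  rw [this, Set.ncard_coe_finset]
  rfl

/-- The coordinates in which a form `x₀x₄ - x₁x₃ + ⅔ (x₂ - r₀x₄ - r₁x₃)² - …` is diagonal. -/
def signatureMap (a : Fin 3 → ℝ) (r : Fin 2 → ℝ) : (Fin 5 → ℝ) →ₗ[ℝ] (Fin 5 → ℝ) where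
  toFun x := ![x 4 + (x 0 - a 0 * x 4 - a 1 * x 3), x 3 - (x 1 + a 2 * x 3),
    x 2 - (r 0 * x 4 + r 1 * x 3), x 4 - (x 0 - a 0 * x 4 - a 1 * x 3), x 3 + (x 1 + a 2 * x 3)]
  map_add' x x' := by
    ext i
    fin_cases i <;> simp <;> ring
  map_smul' c x := by
    ext i
    fin_cases i <;> simp <;> ring

lemma signatureMap_injective (a : Fin 3 → ℝ) (r : Fin 2 → ℝ) :
    Function.Injective (signatureMap a r) := by
  rw [injective_iff_map_eq_zero]
  intro x hx
  have h0 : x 4 + (x 0 - a 0 * x 4 - a 1 * x 3) = 0 := congrFun hx 0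
  have h1 : x 3 - (x 1 + a 2 * x 3) = 0 := congrFun hx 1
  have h2 : x 2 - (r 0 * x 4 + r 1 * x 3) = 0 := congrFun hx 2
  have h3 : x 4 - (x 0 - a 0 * x 4 - a 1 * x 3) = 0 := congrFun hx 3
  have h4 : x 3 + (x 1 + a 2 * x 3) = 0 := congrFun hx 4
  have k4 : x 4 = 0 := by linarith
  have k3 : x 3 = 0 := by linarith
  rw [k3, k4] at h0 h2
  rw [k3] at h1
  ext i
  fin_cases i
  · simpa using h0
  · simpa using h1
  · simpa using h2
  · exact k3
  · exact k4

/-- The form is `x 4 * p - x 3 * w` plus a positive square, with `p = x 0 - a 0 * x 4 - a 1 * x 3`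
and `w = x 1 + a 2 * x 3`. Each product is a difference of two squares with weights `±1/4`. -/
lemma weightedSumSquares_signatureMap (a : Fin 3 → ℝ) (r : Fin 2 → ℝ) (x : Fin 5 → ℝ) :
    QuadraticMap.weightedSumSquares ℝ signatureWeights (signatureMap a r x) =
      x 0 * x 4 - x 1 * x 3 + 2 / 3 * (x 2 - (r 0 * x 4 + r 1 * x 3)) ^ 2 -
        (a 0 * x 4 ^ 2 + a 1 * (x 4 * x 3) + a 2 * x 3 ^ 2) := by
  rw [QuadraticMap.weightedSumSquares_apply, Fin.sum_univ_five]
  change (1 / 4 : ℝ) * ((x 4 + (x 0 - a 0 * x 4 - a 1 * x 3)) *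
      (x 4 + (x 0 - a 0 * x 4 - a 1 * x 3))) +
    (1 / 4 : ℝ) * ((x 3 - (x 1 + a 2 * x 3)) * (x 3 - (x 1 + a 2 * x 3))) +
    (2 / 3 : ℝ) * ((x 2 - (r 0 * x 4 + r 1 * x 3)) * (x 2 - (r 0 * x 4 + r 1 * x 3))) +
    (-1 / 4 : ℝ) * ((x 4 - (x 0 - a 0 * x 4 - a 1 * x 3)) *
      (x 4 - (x 0 - a 0 * x 4 - a 1 * x 3))) +
    (-1 / 4 : ℝ) * ((x 3 + (x 1 + a 2 * x 3)) * (x 3 + (x 1 + a 2 * x 3))) = _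
  ring

/-- The equation of the union of the cones is a quadratic form of signature `(3, 2)`. -/
lemma exists_signature {T : Type*} [AddCommGroup T] [Module ℝ T] (e : T ≃ₗ[ℝ] (Fin 5 → ℝ))
    (Y : Fin 5 → E5 → E5) (y : E5) :
    ∃ B : QuadraticForm ℝ T, sigPos B = 3 ∧ sigNeg B = 2 ∧ ∀ v, B v = frameForm Y y (e v) := by
  obtain ⟨r, hr⟩ : ∃ r : Fin 2 → ℝ, r = ![coefTwo Y y 0 + 3 / 4 * coefOne Y y 0,
    -coefTwo Y y 1 - 3 / 4 * coefOne Y y 1] := ⟨_, rfl⟩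
  obtain ⟨a, ha⟩ : ∃ a : Fin 3 → ℝ, a =
    ![7 / 10 * coefB Y y 0 + coefQ Y y 0 + 3 / 8 * coefOne Y y 0 ^ 2,
      -(7 / 10 * coefB Y y 1 + coefQ Y y 1 + 3 / 4 * coefOne Y y 0 * coefOne Y y 1),
      7 / 10 * coefB Y y 2 + coefQ Y y 2 + 3 / 8 * coefOne Y y 1 ^ 2] := ⟨_, rfl⟩
  have hA := signatureMap_injective a r
  have hF : ∀ x, QuadraticMap.weightedSumSquares ℝ signatureWeights (signatureMap a r x) =
      frameForm Y y x := by
    intro x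
    rw [weightedSumSquares_signatureMap, frameForm_eq, hr, ha]
    simp only [Matrix.cons_val_zero, Matrix.cons_val_one, Matrix.cons_val]
    ring
  have hB : ((QuadraticMap.weightedSumSquares ℝ signatureWeights).comp
      (e.trans (LinearEquiv.ofInjectiveEndo (signatureMap a r) hA)).toLinearMap).Equivalent
      (QuadraticMap.weightedSumSquares ℝ signatureWeights) :=
    ⟨⟨e.trans (LinearEquiv.ofInjectiveEndo (signatureMap a r) hA), fun v => rfl⟩⟩
  have : Module.Finite ℝ T := Module.Finite.equiv e.symm
  refine ⟨(QuadraticMap.weightedSumSquares ℝ signatureWeights).comp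
    (e.trans (LinearEquiv.ofInjectiveEndo (signatureMap a r) hA)).toLinearMap, ?_, ?_,
    fun v => hF (e v)⟩
  · rw [QuadraticForm.sigPos_of_equiv_weightedSumSquares hB, ncard_signatureWeights_pos]
  · rw [QuadraticForm.sigNeg_of_equiv_weightedSumSquares hB, ncard_signatureWeights_neg]

end Signature

/-! ### Sections of spans and their brackets. -/

section SectionsOfSpans

variable {ι κ : Type} [Fintype ι] [Fintype κ] {y : E5}

/-- Sections of the span of independent differentiable fields have differentiable coefficients. -/
lemma exists_differentiableAt_coefficients {W : ι → E5 → E5} {Z : E5 → E5}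
    (hW : ∀ i, DifferentiableAt ℝ (W i) y) (hZ : DifferentiableAt ℝ Z y)
    (hind : LinearIndependent ℝ (fun i => W i y))
    (hmem : ∀ᶠ y' in 𝓝 y, Z y' ∈ Submodule.span ℝ (range fun i => W i y')) :
    ∃ c : ι → E5 → ℝ, (∀ i, DifferentiableAt ℝ (c i) y) ∧
      ∀ᶠ y' in 𝓝 y, Z y' = ∑ i, c i y' • W i y' := by
  let T : E5 → (ι → ℝ) →L[ℝ] E5 := fun y' =>
    ∑ i, (ContinuousLinearMap.proj (R := ℝ) (φ := fun _ : ι => ℝ) i).smulRight (W i y')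
  have hTapply : ∀ y' x, T y' x = ∑ i, x i • W i y' := fun y' x => by
    simp [T, _root_.sum_apply]
  have hT : DifferentiableAt ℝ T y := by
    refine DifferentiableAt.fun_sum fun i _ => ?_
    exact ((ContinuousLinearMap.smulRightL ℝ (ι → ℝ) E5
      (ContinuousLinearMap.proj (R := ℝ) (φ := fun _ : ι => ℝ) i)).differentiableAt).comp y (hW i)
  -- With a fixed left inverse `P` of `T y`, the operator `P ∘ T y'` is invertible for `y'` near
  -- `y`, and the coefficients are its inverse applied to `P (Z y')`.
  obtain ⟨P₀, hP₀⟩ := LinearMap.exists_leftInverse_of_injective (T y : (ι → ℝ) →ₗ[ℝ] E5) (by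
    rw [LinearMap.ker_eq_bot']
    intro x hx
    have hx' : ∑ i, x i • W i y = 0 := by rw [← hTapply]; exact hx
    funext i
    exact Fintype.linearIndependent_iff.1 hind x hx' i)
  let P : E5 →L[ℝ] (ι → ℝ) := LinearMap.toContinuousLinearMap P₀
  let G : E5 → (ι → ℝ) →L[ℝ] (ι → ℝ) := fun y' => P.comp (T y')
  have hG : DifferentiableAt ℝ G y := (differentiableAt_const P).clm_comp hT
  have hGy : G y = ContinuousLinearMap.id ℝ (ι → ℝ) := by
    ext1 x
    exact LinearMap.congr_fun hP₀ x
  have hGinv : (G y).IsInvertible := by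
    rw [hGy]
    exact ⟨ContinuousLinearEquiv.refl ℝ _, rfl⟩
  have hnear : ∀ᶠ y' in 𝓝 y, (G y').IsInvertible := by
    obtain ⟨e, he⟩ := hGinv
    have := e.nhds
    rw [he] at this
    filter_upwards [hG.continuousAt this] with y' hy'
    exact hy'
  have hI : DifferentiableAt ℝ (fun y' => (G y').inverse) y := by
    obtain ⟨e, he⟩ := hGinv
    have h := (contDiffAt_map_inverse (n := 1) e).differentiableAt one_ne_zero
    rw [he] at h
    exact h.comp y hG
  have hc : DifferentiableAt ℝ (fun y' => (G y').inverse (P (Z y'))) y :=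
    hI.clm_apply ((P.differentiableAt).comp y hZ)
  refine ⟨fun i y' => (G y').inverse (P (Z y')) i, fun i => differentiableAt_pi.1 hc i, ?_⟩
  filter_upwards [hmem, hnear] with y' hy' hinv
  obtain ⟨x, hx⟩ := (Submodule.mem_span_range_iff_exists_fun ℝ).1 hy'
  have hPZ : P (Z y') = G y' x := by
    rw [← hx, ← hTapply]
    rfl
  have : (G y').inverse (P (Z y')) = x := by
    rw [hPZ]
    exact hinv.inverse_apply_eq.2 rfl
  rw [this, hx]

/-- The Leibniz rule in both arguments: derivatives of the coefficients only produce multiples of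
the fields. This reduces `D + [D, F]`, defined through all local sections, to finitely many
brackets. -/
lemma lieBracket_mem_of_sections {W : ι → E5 → E5} {W' : κ → E5 → E5} {Z Z' : E5 → E5}
    (hW : ∀ i, DifferentiableAt ℝ (W i) y) (hW' : ∀ j, DifferentiableAt ℝ (W' j) y)
    (hZ : DifferentiableAt ℝ Z y) (hZ' : DifferentiableAt ℝ Z' y)
    (hind : LinearIndependent ℝ (fun i => W i y)) (hind' : LinearIndependent ℝ (fun j => W' j y))
    (hmem : ∀ᶠ y' in 𝓝 y, Z y' ∈ Submodule.span ℝ (range fun i => W i y'))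
    (hmem' : ∀ᶠ y' in 𝓝 y, Z' y' ∈ Submodule.span ℝ (range fun j => W' j y'))
    {F : Submodule ℝ E5} (hF : ∀ i, W i y ∈ F) (hF' : ∀ j, W' j y ∈ F)
    (hbr : ∀ i j, VectorField.lieBracket ℝ (W i) (W' j) y ∈ F) :
    VectorField.lieBracket ℝ Z Z' y ∈ F := by
  obtain ⟨c, hc, hZc⟩ := exists_differentiableAt_coefficients hW hZ hind hmem
  obtain ⟨c', hc', hZc'⟩ := exists_differentiableAt_coefficients hW' hZ' hind' hmem'
  have hsum : ∀ i, VectorField.lieBracket ℝ (W i) (fun y' => ∑ j, c' j y' • W' j y') y ∈ F := by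
    intro i
    rw [lieBracket_sum_smul_right hc' hW']
    exact Submodule.sum_mem _ fun j _ => F.add_mem (F.smul_mem _ (hF' j)) (F.smul_mem _ (hbr i j))
  rw [Filter.EventuallyEq.lieBracket_vectorField_eq hZc hZc', VectorField.lieBracket_swap,
    lieBracket_sum_smul_right hc hW]
  refine F.neg_mem (Submodule.sum_mem _ fun i _ => F.add_mem (F.smul_mem _ (hF i))
    (F.smul_mem _ ?_))
  rw [VectorField.lieBracket_swap]
  exact F.neg_mem (hsum i)

end SectionsOfSpans

/-! ### Vector fields and brackets in a chart. -/

section Charts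

variable {M : Type*} [TopologicalSpace M] [ChartedSpace E5 M] [IsManifold (𝓡 5) ∞ M]

lemma isInvertible_chartDeriv {q x : M} (hx : x ∈ (extChartAt (𝓡 5) q).source) :
    (chartDeriv q x).IsInvertible :=
  haveI : IsManifold (𝓡 5) 1 M := IsManifold.of_le (n := ∞) (by simp)
  isInvertible_mfderiv_extChartAt hx

lemma isInvertible_mfderiv_chart_symm {q : M} {y : E5} (hy : y ∈ (extChartAt (𝓡 5) q).target) :
    (mfderiv 𝓘(ℝ, E5) (𝓡 5) (extChartAt (𝓡 5) q).symm y).IsInvertible := by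
  have : IsManifold (𝓡 5) 1 M := IsManifold.of_le (n := ∞) (by simp)
  have h := isInvertible_mfderivWithin_extChartAt_symm (I := 𝓡 5) hy
  rwa [ModelWithCorners.Boundaryless.range_eq_univ, mfderivWithin_univ] at h

lemma inChart_eq_mpullback {q : M} (X : VField M) {y : E5}
    (hy : y ∈ (extChartAt (𝓡 5) q).target) : inChart q X y =
      VectorField.mpullback 𝓘(ℝ, E5) (𝓡 5) (extChartAt (𝓡 5) q).symm X y := by
  have : IsManifold (𝓡 5) 1 M := IsManifold.of_le (n := ∞) (by simp)
  have hinv := isInvertible_mfderiv_chart_symm hy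
  rw [VectorField.mpullback_apply]
  have h' := mfderivWithin_extChartAt_symm_comp_mfderiv_extChartAt (I := 𝓡 5) hy
  rw [ModelWithCorners.Boundaryless.range_eq_univ, mfderivWithin_univ] at h'
  exact (hinv.inverse_apply_eq.2
    (DFunLike.congr_fun h' (X ((extChartAt (𝓡 5) q).symm y))).symm).symm

lemma contMDiffAt_chart_symm {q : M} {y : E5} (hy : y ∈ (extChartAt (𝓡 5) q).target) :
    ContMDiffAt 𝓘(ℝ, E5) (𝓡 5) ∞ (extChartAt (𝓡 5) q).symm y :=
  (contMDiffOn_extChartAt_symm q).contMDiffAt ((isOpen_extChartAt_target q).mem_nhds hy)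

lemma SmoothFieldOn.contMDiffAt {X : VField M} {U : Set M} (hX : SmoothFieldOn X U)
    (hU : IsOpen U) {x : M} (hx : x ∈ U) : ContMDiffAt (𝓡 5) (𝓡 5).tangent ∞
      (fun x => (⟨x, X x⟩ : TangentBundle (𝓡 5) M)) x :=
  ContMDiffOn.contMDiffAt hX (hU.mem_nhds hx)

lemma isOpen_chart_preimage (q : M) {U : Set M} (hU : IsOpen U) :
    IsOpen ((extChartAt (𝓡 5) q).target ∩ (extChartAt (𝓡 5) q).symm ⁻¹' U) :=
  (continuousOn_extChartAt_symm q).isOpen_inter_preimage (isOpen_extChartAt_target q) hU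

lemma contDiffAt_inChart {q : M} {X : VField M} {U : Set M} (hX : SmoothFieldOn X U)
    (hU : IsOpen U) {y : E5} (hy : y ∈ (extChartAt (𝓡 5) q).target)
    (hyU : (extChartAt (𝓡 5) q).symm y ∈ U) : ContDiffAt ℝ ∞ (inChart q X) y := by
  have h := ContMDiffAt.mpullback_vectorField_preimage (m := ∞) (n := ∞)
    (hX.contMDiffAt hU hyU) (contMDiffAt_chart_symm hy)
    (isInvertible_mfderiv_chart_symm hy) (by simp)
  have h' := ((contMDiff_snd_tangentBundle_modelSpace E5 𝓘(ℝ, E5)).contMDiffAt.comp y h)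
  have h'' : ContDiffAt ℝ ∞
      (VectorField.mpullback 𝓘(ℝ, E5) (𝓡 5) (extChartAt (𝓡 5) q).symm X) y :=
    contMDiffAt_iff_contDiffAt.1 h'
  refine h''.congr_of_eventuallyEq ?_
  filter_upwards [(isOpen_extChartAt_target q).mem_nhds hy] with y' hy'
  exact inChart_eq_mpullback X hy'

/-- `inChart` is the pullback by the inverse chart, pullback commutes with brackets, and on the
model space the manifold bracket is the usual one. -/
lemma chartDeriv_mlieBracket {q : M} {X X' : VField M} {U U' : Set M} (hX : SmoothFieldOn X U)
    (hU : IsOpen U) (hX' : SmoothFieldOn X' U') (hU' : IsOpen U') {y : E5}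
    (hy : y ∈ (extChartAt (𝓡 5) q).target) (hyU : (extChartAt (𝓡 5) q).symm y ∈ U)
    (hyU' : (extChartAt (𝓡 5) q).symm y ∈ U') :
    chartDeriv q ((extChartAt (𝓡 5) q).symm y)
      (VectorField.mlieBracket (𝓡 5) X X' ((extChartAt (𝓡 5) q).symm y)) =
      VectorField.lieBracket ℝ (inChart q X) (inChart q X') y := by
  have h2 : (2 : ℕ∞ω) ≤ ∞ := WithTop.coe_le_coe.2 (le_top : (2 : ℕ∞) ≤ ⊤)
  have hmin : minSmoothness ℝ 2 = 2 := minSmoothness_of_isRCLikeNormedField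
  have : IsManifold (𝓡 5) (minSmoothness ℝ 2) M := by
    rw [hmin]
    exact IsManifold.of_le (n := ∞) h2
  have h := VectorField.mpullback_mlieBracket (n := ∞)
    ((hX.contMDiffAt hU hyU).mdifferentiableAt (by simp))
    ((hX'.contMDiffAt hU' hyU').mdifferentiableAt (by simp)) (contMDiffAt_chart_symm hy)
    (by rw [hmin]; exact h2)
  have hflat : ∀ A B : E5 → E5, VectorField.mlieBracket 𝓘(ℝ, E5) A B y =
      VectorField.lieBracket ℝ A B y := by
    intro A B
    exact (congrFun (VectorField.mlieBracketWithin_univ (I := 𝓘(ℝ, E5)) (V := A) (W := B)) y).symm.trans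
      ((congrFun (VectorField.mlieBracketWithin_eq_lieBracketWithin (𝕜 := ℝ) (V := A) (W := B)
        (s := univ)) y).trans (congrFun VectorField.lieBracketWithin_univ y))
  have hnear : ∀ Z : VField M, inChart q Z =ᶠ[𝓝 y]
      (VectorField.mpullback 𝓘(ℝ, E5) (𝓡 5) (extChartAt (𝓡 5) q).symm Z : E5 → E5) := fun Z => by
    filter_upwards [(isOpen_extChartAt_target q).mem_nhds hy] with y' hy'
    exact inChart_eq_mpullback Z hy'
  have h' : inChart q (VectorField.mlieBracket (𝓡 5) X X') y = VectorField.mlieBracket 𝓘(ℝ, E5)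
      (VectorField.mpullback 𝓘(ℝ, E5) (𝓡 5) (extChartAt (𝓡 5) q).symm X)
      (VectorField.mpullback 𝓘(ℝ, E5) (𝓡 5) (extChartAt (𝓡 5) q).symm X') y :=
    (inChart_eq_mpullback _ hy).trans h
  exact (h'.trans (hflat _ _)).trans
    (Filter.EventuallyEq.lieBracket_vectorField_eq (hnear X) (hnear X')).symm

end Charts

/-! ### Sections of distributions read in a chart. -/

section Charts

variable {M : Type*} [TopologicalSpace M] [ChartedSpace E5 M]

lemma inChart_extChartAt {q x : M} (X : VField M) (hx : x ∈ (extChartAt (𝓡 5) q).source) :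
    inChart q X (extChartAt (𝓡 5) q x) = chartDeriv q x (X x) := by
  rw [inChart, (extChartAt (𝓡 5) q).left_inv hx]

variable [IsManifold (𝓡 5) ∞ M]

lemma chartDeriv_mlieBracket_of_mem_source {q x : M} {X X' : VField M} {U U' : Set M}
    (hX : SmoothFieldOn X U) (hU : IsOpen U) (hX' : SmoothFieldOn X' U') (hU' : IsOpen U')
    (hx : x ∈ (extChartAt (𝓡 5) q).source) (hxU : x ∈ U) (hxU' : x ∈ U') :
    chartDeriv q x (VectorField.mlieBracket (𝓡 5) X X' x) =
      VectorField.lieBracket ℝ (inChart q X) (inChart q X') (extChartAt (𝓡 5) q x) := by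
  have hl := (extChartAt (𝓡 5) q).left_inv hx
  have h := chartDeriv_mlieBracket hX hU hX' hU' ((extChartAt (𝓡 5) q).map_source hx)
    (by rwa [hl]) (by rwa [hl])
  rwa [hl] at h

lemma chartDeriv_injective {q x : M} (hx : x ∈ (extChartAt (𝓡 5) q).source) :
    Function.Injective (chartDeriv q x) := by
  obtain ⟨e, he⟩ := isInvertible_chartDeriv hx
  rw [← he]
  exact e.injective

lemma mem_of_chartDeriv_mem_map {q x : M} (hx : x ∈ (extChartAt (𝓡 5) q).source)
    {G : Submodule ℝ (TangentSpace (𝓡 5) x)} {v : TangentSpace (𝓡 5) x}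
    (h : chartDeriv q x v ∈ G.map (chartDeriv q x : TangentSpace (𝓡 5) x →ₗ[ℝ] E5)) : v ∈ G := by
  obtain ⟨w, hw, hwv⟩ := h
  rwa [← chartDeriv_injective hx hwv]

lemma linearIndependent_chartDeriv {q x : M} (hx : x ∈ (extChartAt (𝓡 5) q).source)
    {ι : Type} {v : ι → TangentSpace (𝓡 5) x} (hv : LinearIndependent ℝ v) :
    LinearIndependent ℝ (fun i => chartDeriv q x (v i)) :=
  hv.map' (chartDeriv q x : TangentSpace (𝓡 5) x →ₗ[ℝ] E5)
    (LinearMap.ker_eq_bot.2 (chartDeriv_injective hx))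

lemma inChart_mem_span {q : M} {F : SubspaceField M} {ι : Type} {W : ι → VField M} {Z : VField M}
    {y : E5} (hZ : Z ((extChartAt (𝓡 5) q).symm y) ∈ F ((extChartAt (𝓡 5) q).symm y))
    (hF : F ((extChartAt (𝓡 5) q).symm y) =
      Submodule.span ℝ (range fun i => W i ((extChartAt (𝓡 5) q).symm y))) :
    inChart q Z y ∈ Submodule.span ℝ (range fun i => inChart q (W i) y) := by
  rw [hF] at hZ
  have h := Submodule.mem_map_of_mem
    (f := (chartDeriv q ((extChartAt (𝓡 5) q).symm y) : TangentSpace (𝓡 5) _ →ₗ[ℝ] E5)) hZ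
  rw [Submodule.map_span, ← range_comp] at h
  exact h

/-- Brackets of sections of the spans of two families of independent fields are determined by the
brackets of these fields. -/
lemma mlieBracket_mem_of_isSectionOn {D F : SubspaceField M} {ι κ : Type} [Fintype ι] [Fintype κ]
    {W : ι → VField M} {W' : κ → VField M} {U U' : Set M} {Z Z' : VField M} {x : M}
    (hU : IsOpen U) (hW : ∀ i, SmoothFieldOn (W i) U) (hW' : ∀ j, SmoothFieldOn (W' j) U)
    (hD : ∀ x ∈ U, D x = Submodule.span ℝ (range fun i => W i x))
    (hF : ∀ x ∈ U, F x = Submodule.span ℝ (range fun j => W' j x))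
    (hU' : IsOpen U') (hZ : IsSectionOn D Z U') (hZ' : IsSectionOn F Z' U')
    (hx : x ∈ U) (hx' : x ∈ U') (hind : LinearIndependent ℝ (fun i => W i x))
    (hind' : LinearIndependent ℝ (fun j => W' j x)) {G : Submodule ℝ (TangentSpace (𝓡 5) x)}
    (hG : ∀ i, W i x ∈ G) (hG' : ∀ j, W' j x ∈ G)
    (hbr : ∀ i j, VectorField.mlieBracket (𝓡 5) (W i) (W' j) x ∈ G) :
    VectorField.mlieBracket (𝓡 5) Z Z' x ∈ G := by
  have hxs : x ∈ (extChartAt (𝓡 5) x).source := mem_extChartAt_source x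
  have hyt := (extChartAt (𝓡 5) x).map_source hxs
  have hl := (extChartAt (𝓡 5) x).left_inv hxs
  have hmap : ∀ {v}, v ∈ G → chartDeriv x x v ∈
      G.map (chartDeriv x x : TangentSpace (𝓡 5) x →ₗ[ℝ] E5) :=
    fun hv => Submodule.mem_map_of_mem hv
  have hd : ∀ {X : VField M} {U₀ : Set M}, SmoothFieldOn X U₀ → IsOpen U₀ → x ∈ U₀ →
      DifferentiableAt ℝ (inChart x X) (extChartAt (𝓡 5) x x) := fun hX h0 hx0 =>
    (contDiffAt_inChart hX h0 hyt (by rwa [hl])).differentiableAt (by simp)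
  have hnear : ∀ᶠ y in 𝓝 (extChartAt (𝓡 5) x x), (extChartAt (𝓡 5) x).symm y ∈ U ∩ U' := by
    have := (isOpen_chart_preimage x (hU.inter hU')).eventually_mem
      (x := extChartAt (𝓡 5) x x) ⟨hyt, by rw [mem_preimage, hl]; exact ⟨hx, hx'⟩⟩
    exact this.mono fun y hy => hy.2
  apply mem_of_chartDeriv_mem_map hxs
  rw [chartDeriv_mlieBracket_of_mem_source hZ.1 hU' hZ'.1 hU' hxs hx' hx']
  refine lieBracket_mem_of_sections (W := fun i => inChart x (W i))
    (W' := fun j => inChart x (W' j)) (fun i => hd (hW i) hU hx) (fun j => hd (hW' j) hU hx)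
    (hd hZ.1 hU' hx') (hd hZ'.1 hU' hx') ?_ ?_ ?_ ?_ ?_ ?_ ?_
  · simp only [inChart_extChartAt _ hxs]
    exact linearIndependent_chartDeriv hxs hind
  · simp only [inChart_extChartAt _ hxs]
    exact linearIndependent_chartDeriv hxs hind'
  · filter_upwards [hnear] with y hy
    exact inChart_mem_span (hZ.2 _ hy.2) (hD _ hy.1)
  · filter_upwards [hnear] with y hy
    exact inChart_mem_span (hZ'.2 _ hy.2) (hF _ hy.1)
  · intro i
    rw [inChart_extChartAt _ hxs]
    exact hmap (hG i)
  · intro j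
    rw [inChart_extChartAt _ hxs]
    exact hmap (hG' j)
  · intro i j
    rw [← chartDeriv_mlieBracket_of_mem_source (hW i) hU (hW' j) hU hxs hx hx]
    exact hmap (hbr i j)

end Charts

/-! ### Adapted frames on the manifold. -/

section ManifoldFrames

variable {M : Type*} [TopologicalSpace M] [ChartedSpace E5 M] [IsManifold (𝓡 5) ∞ M]
  {D : SubspaceField M} {X : Fin 5 → VField M} {U : Set M} {x : M}

lemma linearIndependent_of_finrank_span {T : Type*} [AddCommGroup T] [Module ℝ T] {n : ℕ}
    {v : Fin n → T} {F : Submodule ℝ T} (hF : F ≤ Submodule.span ℝ (range v))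
    (hn : Module.finrank ℝ F = n) : LinearIndependent ℝ v := by
  rw [linearIndependent_iff_card_le_finrank_span, Fintype.card_fin]
  have : Module.Finite ℝ (Submodule.span ℝ (range v)) := .span_of_finite ℝ (finite_range v)
  exact hn.ge.trans (Submodule.finrank_mono hF)

namespace IsAdaptedFrame

variable (hX : IsAdaptedFrame D X U) (hg : HasGrowth235 D)
include hX

lemma eq_span_pair (hx : x ∈ U) : D x = Submodule.span ℝ (range ![X 0 x, X 1 x]) := by
  rw [(hX.2.2 x hx).1]
  congr 1
  simp [pair_comm]

lemma isSectionOn (i : Fin 2) : IsSectionOn D (X (![0, 1] i)) U := by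
  refine ⟨hX.2.1 _, fun x hx => ?_⟩
  rw [hX.eq_span_pair hx]
  apply Submodule.subset_span
  fin_cases i <;> simp

include hg

lemma linearIndependent_pair (hx : x ∈ U) : LinearIndependent ℝ ![X 0 x, X 1 x] :=
  linearIndependent_of_finrank_span (hX.eq_span_pair hx).le (hg x).1

/-- Brackets of sections of `D` reduce to that of `X 0` and `X 1`, which is `X 2` modulo `D`. -/
lemma distSq_eq (hx : x ∈ U) :
    distSq D x = Submodule.span ℝ (range ![X 0 x, X 1 x, X 2 x]) := by
  set G := Submodule.span ℝ (range ![X 0 x, X 1 x, X 2 x]) with hG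
  have hr : range ![X 0 x, X 1 x, X 2 x] = {X 0 x, X 1 x, X 2 x} := by
    ext v
    simp
    tauto
  have h0 : X 0 x ∈ G := Submodule.subset_span (by simp [hr])
  have h1 : X 1 x ∈ G := Submodule.subset_span (by simp [hr])
  have h2 : X 2 x ∈ G := Submodule.subset_span (by simp [hr])
  obtain ⟨hDx, hb, -, -⟩ := hX.2.2 x hx
  have hDG : D x ≤ G := by
    rw [hDx, Submodule.span_le, insert_subset_iff, singleton_subset_iff]
    exact ⟨h0, h1⟩
  have h01 : VectorField.mlieBracket (𝓡 5) (X 0) (X 1) x ∈ G := by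
    have := G.sub_mem h2 (hDG hb)
    rwa [sub_sub_cancel] at this
  apply le_antisymm
  · refine sup_le hDG (Submodule.span_le.2 ?_)
    rintro w ⟨U', Z, Z', hU', hxU', hZ, hZ', rfl⟩
    have hr2 : ∀ x, range ![X 0 x, X 1 x] = range fun i : Fin 2 => X (![0, 1] i) x := by
      intro x
      congr 1
      funext i
      fin_cases i <;> rfl
    have hfun : (fun i : Fin 2 => X (![0, 1] i) x) = ![X 0 x, X 1 x] := by
      funext i
      fin_cases i <;> rfl
    have hspan : ∀ x ∈ U, D x = Submodule.span ℝ (range fun i : Fin 2 => X (![0, 1] i) x) :=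
      fun x hx => by rw [hX.eq_span_pair hx, hr2]
    have hi := hX.linearIndependent_pair hg hx
    rw [← hfun] at hi
    have hmem : ∀ i : Fin 2, X (![0, 1] i) x ∈ G := by
      intro i
      fin_cases i
      exacts [h0, h1]
    refine mlieBracket_mem_of_isSectionOn hX.1 (fun i => hX.2.1 _) (fun i => hX.2.1 _) hspan hspan
      hU' hZ hZ' hx hxU' hi hi hmem hmem ?_
    intro i j
    fin_cases i <;> fin_cases j
    · change VectorField.mlieBracket (𝓡 5) (X 0) (X 0) x ∈ G
      rw [VectorField.mlieBracket_self]
      exact G.zero_mem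
    · exact h01
    · change VectorField.mlieBracket (𝓡 5) (X 1) (X 0) x ∈ G
      rw [VectorField.mlieBracket_swap_apply]
      exact G.neg_mem h01
    · change VectorField.mlieBracket (𝓡 5) (X 1) (X 1) x ∈ G
      rw [VectorField.mlieBracket_self]
      exact G.zero_mem
  · have hDS : D x ≤ distSq D x := le_sup_left
    have hbS : VectorField.mlieBracket (𝓡 5) (X 0) (X 1) x ∈ distSq D x :=
      Submodule.mem_sup_right (Submodule.subset_span
        ⟨U, X 0, X 1, hX.1, hx, hX.isSectionOn 0, hX.isSectionOn 1, rfl⟩)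
    rw [hG, Submodule.span_le, hr, insert_subset_iff, insert_subset_iff, singleton_subset_iff]
    refine ⟨hDS ((hX.isSectionOn 0).2 x hx), hDS ((hX.isSectionOn 1).2 x hx), ?_⟩
    have := (distSq D x).add_mem (hDS hb) hbS
    rwa [sub_add_cancel] at this

lemma linearIndependent_triple (hx : x ∈ U) : LinearIndependent ℝ ![X 0 x, X 1 x, X 2 x] :=
  linearIndependent_of_finrank_span (hX.distSq_eq hg hx).le (hg x).2.1

/-- The span of the five fields contains `D³`, which has dimension five. As for the pair and the
triple, the growth vector enters through a dimension count. -/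
lemma linearIndependent (hx : x ∈ U) : LinearIndependent ℝ (fun i => X i x) := by
  refine linearIndependent_of_finrank_span (F := distCube D x) ?_ (hg x).2.2
  set G := Submodule.span ℝ (range fun i => X i x)
  have hm : ∀ i, X i x ∈ G := fun i => Submodule.subset_span ⟨i, rfl⟩
  have hSG : distSq D x ≤ G := by
    rw [hX.distSq_eq hg hx, Submodule.span_le]
    rintro _ ⟨i, rfl⟩
    fin_cases i
    exacts [hm 0, hm 1, hm 2]
  obtain ⟨hDx, hb, hb', hb''⟩ := hX.2.2 x hx
  have h01 : VectorField.mlieBracket (𝓡 5) (X 0) (X 1) x ∈ G := by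
    have := G.sub_mem (hm 2) (hSG ((le_sup_left : D x ≤ distSq D x) hb))
    rwa [sub_sub_cancel] at this
  have h02 : VectorField.mlieBracket (𝓡 5) (X 0) (X 2) x ∈ G := by
    have := G.sub_mem (hm 3) (hSG hb')
    rwa [sub_sub_cancel] at this
  have h12 : VectorField.mlieBracket (𝓡 5) (X 1) (X 2) x ∈ G := by
    have := G.sub_mem (hm 4) (hSG hb'')
    rwa [sub_sub_cancel] at this
  refine sup_le hSG (Submodule.span_le.2 ?_)
  rintro w ⟨U', Z, Z', hU', hxU', hZ, hZ', rfl⟩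
  have e2 : ∀ x, (fun i : Fin 2 => X (![0, 1] i) x) = ![X 0 x, X 1 x] := by
    intro x
    funext i
    fin_cases i <;> rfl
  have e3 : ∀ x, (fun i : Fin 3 => X (![0, 1, 2] i) x) = ![X 0 x, X 1 x, X 2 x] := by
    intro x
    funext i
    fin_cases i <;> rfl
  refine mlieBracket_mem_of_isSectionOn (W := fun i : Fin 2 => X (![0, 1] i))
    (W' := fun i : Fin 3 => X (![0, 1, 2] i)) hX.1 (fun i => hX.2.1 _) (fun i => hX.2.1 _)
    (fun x hx => by rw [e2, hX.eq_span_pair hx]) (fun x hx => by rw [e3, hX.distSq_eq hg hx])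
    hU' hZ hZ' hx hxU' (by rw [e2]; exact hX.linearIndependent_pair hg hx)
    (by rw [e3]; exact hX.linearIndependent_triple hg hx) (fun i => hm _) (fun i => hm _) ?_
  intro i j
  fin_cases i <;> fin_cases j
  · change VectorField.mlieBracket (𝓡 5) (X 0) (X 0) x ∈ G
    rw [VectorField.mlieBracket_self]
    exact G.zero_mem
  · exact h01
  · exact h02
  · change VectorField.mlieBracket (𝓡 5) (X 1) (X 0) x ∈ G
    rw [VectorField.mlieBracket_swap_apply]
    exact G.neg_mem h01
  · change VectorField.mlieBracket (𝓡 5) (X 1) (X 1) x ∈ G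
    rw [VectorField.mlieBracket_self]
    exact G.zero_mem
  · exact h12

end IsAdaptedFrame

end ManifoldFrames

/-! ### Transfer to the chart and conclusion. -/

section ManifoldFrames

variable {M : Type*} [TopologicalSpace M] [ChartedSpace E5 M] [IsManifold (𝓡 5) ∞ M]
  {D : SubspaceField M} {X : Fin 5 → VField M} {U : Set M} {q : M}

lemma SmoothFieldOn.mlieBracket {Z Z' : VField M} (hU : IsOpen U) (hZ : SmoothFieldOn Z U)
    (hZ' : SmoothFieldOn Z' U) :
    SmoothFieldOn (fun x => VectorField.mlieBracket (𝓡 5) Z Z' x) U := by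
  have : IsManifold (𝓡 5) (((⊤ : ℕ∞) : ℕ∞ω) + 1) M := ‹IsManifold (𝓡 5) ∞ M›
  have : IsManifold (𝓡 5) (minSmoothness ℝ 2) M := by
    rw [minSmoothness_of_isRCLikeNormedField]
    exact IsManifold.of_le (n := ∞) (WithTop.coe_le_coe.2 (le_top : (2 : ℕ∞) ≤ ⊤))
  intro x hx
  refine ContMDiffAt.contMDiffWithinAt ?_
  exact (hZ.contMDiffAt hU hx).mlieBracket_vectorField (m := ⊤) (n := ⊤) (hZ'.contMDiffAt hU hx)
    (by rw [minSmoothness_of_isRCLikeNormedField]; exact le_rfl)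

/-- The two generators of a distribution and their brackets form an adapted frame. -/
lemma exists_isAdaptedFrame (hD : IsRankTwoDistribution D) (q : M) :
    ∃ (X : Fin 5 → VField M) (U : Set M), q ∈ U ∧ IsAdaptedFrame D X U := by
  obtain ⟨U, hU, hq, X₁, X₂, h1, h2, h⟩ := hD q
  have h3 := h1.mlieBracket hU h2
  refine ⟨![X₁, X₂, fun x => VectorField.mlieBracket (𝓡 5) X₁ X₂ x,
    fun x => VectorField.mlieBracket (𝓡 5) X₁ (fun x => VectorField.mlieBracket (𝓡 5) X₁ X₂ x) x,
    fun x => VectorField.mlieBracket (𝓡 5) X₂ (fun x => VectorField.mlieBracket (𝓡 5) X₁ X₂ x) x],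
    U, hq, hU, ?_, fun x hx => ⟨(h x hx).2, ?_, ?_, ?_⟩⟩
  · intro i
    fin_cases i
    exacts [h1, h2, h3, h1.mlieBracket hU h3, h2.mlieBracket hU h3]
  · exact (sub_self (VectorField.mlieBracket (𝓡 5) X₁ X₂ x)).symm ▸ (D x).zero_mem
  · exact (sub_self (VectorField.mlieBracket (𝓡 5) X₁
      (fun x => VectorField.mlieBracket (𝓡 5) X₁ X₂ x) x)).symm ▸ (distSq D x).zero_mem
  · exact (sub_self (VectorField.mlieBracket (𝓡 5) X₂
      (fun x => VectorField.mlieBracket (𝓡 5) X₁ X₂ x) x)).symm ▸ (distSq D x).zero_mem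

namespace IsAdaptedFrame

variable (hX : IsAdaptedFrame D X U) (hg : HasGrowth235 D)
include hX hg

/-- An adapted frame, written in a chart. -/
lemma adaptedFrame_inChart (q : M) : AdaptedFrame (fun i => inChart q (X i))
    ((extChartAt (𝓡 5) q).target ∩ (extChartAt (𝓡 5) q).symm ⁻¹' U) := by
  have hbr : ∀ i j, ∀ y ∈ (extChartAt (𝓡 5) q).target ∩ (extChartAt (𝓡 5) q).symm ⁻¹' U,
      VectorField.lieBracket ℝ (inChart q (X i)) (inChart q (X j)) y =
      chartDeriv q ((extChartAt (𝓡 5) q).symm y)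
        (VectorField.mlieBracket (𝓡 5) (X i) (X j) ((extChartAt (𝓡 5) q).symm y)) :=
    fun i j y hy => (chartDeriv_mlieBracket (hX.2.1 i) hX.1 (hX.2.1 j) hX.1 hy.1 hy.2 hy.2).symm
  have hmap : ∀ {n : ℕ} {y : E5} {v : Fin n → TangentSpace (𝓡 5) ((extChartAt (𝓡 5) q).symm y)}
      {a b : TangentSpace (𝓡 5) ((extChartAt (𝓡 5) q).symm y)},
      b - a ∈ Submodule.span ℝ (range v) →
      chartDeriv q ((extChartAt (𝓡 5) q).symm y) a -
        chartDeriv q ((extChartAt (𝓡 5) q).symm y) b ∈ Submodule.span ℝ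
          (range fun i => chartDeriv q ((extChartAt (𝓡 5) q).symm y) (v i)) := by
    intro n y v a b h
    have h' := Submodule.mem_map_of_mem
      (f := (chartDeriv q ((extChartAt (𝓡 5) q).symm y) : TangentSpace (𝓡 5) _ →ₗ[ℝ] E5)) h
    rw [Submodule.map_span, ← range_comp] at h'
    rw [← neg_sub, ← map_sub]
    exact Submodule.neg_mem _ h'
  refine ⟨isOpen_chart_preimage q hX.1, ?_, ?_, ?_, ?_, ?_⟩
  · exact fun i y hy => (contDiffAt_inChart (hX.2.1 i) hX.1 hy.1 hy.2).contDiffWithinAt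
  · exact fun y hy => linearIndependent_chartDeriv ((extChartAt (𝓡 5) q).map_target hy.1)
      (hX.linearIndependent hg hy.2)
  · intro y hy
    rw [hbr 0 1 y hy]
    have h := (hX.2.2 _ hy.2).2.1
    rw [hX.eq_span_pair hy.2] at h
    refine Submodule.span_mono ?_ (hmap h)
    rintro _ ⟨i, rfl⟩
    fin_cases i
    exacts [Or.inl rfl, Or.inr rfl]
  · intro y hy
    rw [hbr 0 2 y hy]
    have h := (hX.2.2 _ hy.2).2.2.1
    rw [hX.distSq_eq hg hy.2] at h
    refine Submodule.span_mono ?_ (hmap h)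
    rintro _ ⟨i, rfl⟩
    fin_cases i
    exacts [Or.inl rfl, Or.inr (Or.inl rfl), Or.inr (Or.inr rfl)]
  · intro y hy
    rw [hbr 1 2 y hy]
    have h := (hX.2.2 _ hy.2).2.2.2
    rw [hX.distSq_eq hg hy.2] at h
    refine Submodule.span_mono ?_ (hmap h)
    rintro _ ⟨i, rfl⟩
    fin_cases i
    exacts [Or.inl rfl, Or.inr (Or.inl rfl), Or.inr (Or.inr rfl)]

lemma isConormal (q : M) : IsConormal (conormal D q) (fun i => inChart q (X i))
    ((extChartAt (𝓡 5) q).target ∩ (extChartAt (𝓡 5) q).symm ⁻¹' U) := by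
  intro μ hμ
  have hS := hX.distSq_eq hg hμ.2
  have hmem : ∀ i : Fin 3, ![X 0, X 1, X 2] i ((extChartAt (𝓡 5) q).symm μ.1) ∈
      distSq D ((extChartAt (𝓡 5) q).symm μ.1) := by
    intro i
    rw [hS]
    apply Submodule.subset_span
    fin_cases i
    exacts [⟨0, rfl⟩, ⟨1, rfl⟩, ⟨2, rfl⟩]
  constructor
  · rintro ⟨-, h0, h⟩
    exact ⟨h0, h _ (hmem 0), h _ (hmem 1), h _ (hmem 2)⟩
  · rintro ⟨h0, e0, e1, e2⟩
    refine ⟨hμ.1, h0, fun v hv => ?_⟩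
    have hle : distSq D ((extChartAt (𝓡 5) q).symm μ.1) ≤
        LinearMap.ker ((μ.2.comp (chartDeriv q ((extChartAt (𝓡 5) q).symm μ.1)) :
          TangentSpace (𝓡 5) ((extChartAt (𝓡 5) q).symm μ.1) →L[ℝ] ℝ) :
          TangentSpace (𝓡 5) ((extChartAt (𝓡 5) q).symm μ.1) →ₗ[ℝ] ℝ) := by
      rw [hS, Submodule.span_le]
      rintro _ ⟨i, rfl⟩
      fin_cases i
      exacts [e0, e1, e2]
    exact hle hv

end IsAdaptedFrame

lemma extChartAt_mem_of_mem (hq : q ∈ U) : extChartAt (𝓡 5) q q ∈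
    (extChartAt (𝓡 5) q).target ∩ (extChartAt (𝓡 5) q).symm ⁻¹' U :=
  ⟨mem_extChartAt_target q, by rwa [mem_preimage, extChartAt_to_inv]⟩

lemma isCon_iff {p : E5 →L[ℝ] ℝ} {K : Set (TangentSpace (𝓡 5) q)} : IsCon D q p K ↔
    ∃ A, IsOsculatingCone (conormal D q) (covectorAt q p) A ∧ K = chartDeriv q q ⁻¹' A := by
  constructor
  · rintro ⟨O, φ, δ, c, η, b, h1, h2, h3, h4, h5, h6, h⟩
    exact ⟨_, ⟨O, φ, δ, c, η, b, h1, h2, h3, h4, h5, h6, rfl⟩, h⟩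
  · rintro ⟨_, ⟨O, φ, δ, c, η, b, h1, h2, h3, h4, h5, h6, rfl⟩, h⟩
    exact ⟨O, φ, δ, c, η, b, h1, h2, h3, h4, h5, h6, h⟩

namespace IsAdaptedFrame

variable (hX : IsAdaptedFrame D X U) (hg : HasGrowth235 D) (hq : q ∈ U)
include hX hg hq

lemma existsUnique_isCon {p : E5 →L[ℝ] ℝ} (hp : covectorAt q p ∈ conormal D q) :
    ∃! K : Set (TangentSpace (𝓡 5) q), IsCon D q p K := by
  obtain ⟨A, hA, huniq⟩ := (hX.adaptedFrame_inChart hg q).existsUnique_osculatingCone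
    (hX.isConormal hg q) (μ := covectorAt q p) (extChartAt_mem_of_mem hq) hp
  refine ⟨chartDeriv q q ⁻¹' A, isCon_iff.2 ⟨A, hA, rfl⟩, fun K hK => ?_⟩
  obtain ⟨A', hA', rfl⟩ := isCon_iff.1 hK
  rw [huniq A' hA']

lemma sum_mem_Xi_iff (x : Fin 5 → ℝ) : (∑ i, x i • X i q) ∈ Xi D q ↔
    frameForm (fun i => inChart q (X i)) (extChartAt (𝓡 5) q q) x = 0 := by
  rw [← (hX.adaptedFrame_inChart hg q).mem_union_cones_iff (hX.isConormal hg q)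
    (extChartAt_mem_of_mem hq)]
  have hsum : chartDeriv q q (∑ i, x i • X i q) =
      ∑ i, x i • inChart q (X i) (extChartAt (𝓡 5) q q) := by
    rw [map_sum]
    refine Finset.sum_congr rfl fun i _ => ?_
    rw [map_smul, inChart_extChartAt _ (mem_extChartAt_source q)]
  constructor
  · rintro ⟨p, hp, K, hK, hv⟩
    obtain ⟨A, hA, rfl⟩ := isCon_iff.1 hK
    exact ⟨p, hp, A, hA, hsum ▸ hv⟩
  · rintro ⟨p, hp, A, hA, hv⟩
    exact ⟨p, hp, _, isCon_iff.2 ⟨A, hA, rfl⟩, by rwa [mem_preimage, hsum]⟩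

lemma exists_quadraticForm_Xi : ∃ B : QuadraticForm ℝ (TangentSpace (𝓡 5) q),
    sigPos B = 3 ∧ sigNeg B = 2 ∧ Xi D q = {v | B v = 0} := by
  have hfin : Fintype.card (Fin 5) = Module.finrank ℝ (TangentSpace (𝓡 5) q) := by
    change _ = Module.finrank ℝ E5
    simp
  let e := basisOfLinearIndependentOfCardEqFinrank (hX.linearIndependent hg hq) hfin
  obtain ⟨B, h3, h2, hB⟩ := exists_signature e.equivFun (fun i => inChart q (X i))
    (extChartAt (𝓡 5) q q)
  refine ⟨B, h3, h2, ?_⟩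
  ext v
  rw [mem_ofPred_eq, hB, ← hX.sum_mem_Xi_iff hg hq]
  have : ∑ i, e.equivFun v i • X i q = v := by
    conv_rhs => rw [← e.sum_equivFun v]
    simp [e]
  rw [this]

lemma isFrameCoefficients {θ : E5 → E5 →L[ℝ] ℝ} (hθ : IsDualToFourth q X U θ) :
    IsFrameCoefficients D q X θ
      (linearOf (coefOne (fun i => inChart q (X i)) (extChartAt (𝓡 5) q q)))
      (linearOf (coefTwo (fun i => inChart q (X i)) (extChartAt (𝓡 5) q q)))
      (quadraticOf (coefQ (fun i => inChart q (X i)) (extChartAt (𝓡 5) q q)))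
      (quadraticOf (coefB (fun i => inChart q (X i)) (extChartAt (𝓡 5) q q))) := by
  intro p μ u₄ u₅ Y hμ hμS h4 h5 hY hne
  obtain rfl : Y = fun i => inChart q (X i) μ.1 := funext hY
  subst hμ h4 h5
  exact (hX.adaptedFrame_inChart hg q).adAmb_expansions (fun y hy j => hθ y hy.1 hy.2 j)
    (hX.isConormal hg q) (extChartAt_mem_of_mem hq) hμS hne

end IsAdaptedFrame

end ManifoldFrames

end TwoFive

theorem theorem1 {M : Type*} [TopologicalSpace M] [ChartedSpace (EuclideanSpace ℝ (Fin 5)) M]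
    [IsManifold (𝓡 5) ∞ M] (D : TwoFive.SubspaceField M)
    (hD : TwoFive.IsRankTwoDistribution D) (hgrowth : TwoFive.HasGrowth235 D) (q : M) :
    (∀ p : TwoFive.E5 →L[ℝ] ℝ, TwoFive.covectorAt q p ∈ TwoFive.conormal D q →
      ∃! K : Set (TangentSpace (𝓡 5) q), TwoFive.IsCon D q p K) ∧
    (∃ B : QuadraticForm ℝ (TangentSpace (𝓡 5) q),
      sigPos B = 3 ∧ sigNeg B = 2 ∧ TwoFive.Xi D q = {v | B v = 0}) ∧
    (∀ (X : Fin 5 → TwoFive.VField M) (U : Set M) (θ : TwoFive.E5 → TwoFive.E5 →L[ℝ] ℝ),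
      TwoFive.IsAdaptedFrame D X U → q ∈ U → TwoFive.IsDualToFourth q X U θ →
      ∃ (l₁ l₂ : (Fin 2 → ℝ) →ₗ[ℝ] ℝ) (Q B₂ : QuadraticForm ℝ (Fin 2 → ℝ)),
        TwoFive.IsFrameCoefficients D q X θ l₁ l₂ Q B₂ ∧
        ∀ x : Fin 5 → ℝ,
          (∑ i, x i • X i q) ∈ TwoFive.Xi D q ↔ TwoFive.mainForm l₁ l₂ Q B₂ x = 0) := by
  -- The first two claims need only one adapted frame near `q`; the third is proved for each adapted
  -- frame separately.
  obtain ⟨X, U, hq, hX⟩ := TwoFive.exists_isAdaptedFrame hD q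
  exact ⟨fun p hp => hX.existsUnique_isCon hgrowth hq hp, hX.exists_quadraticForm_Xi hgrowth hq,
    fun X U θ hX hq hθ => ⟨_, _, _, _, hX.isFrameCoefficients hgrowth hq hθ,
      fun x => hX.sum_mem_Xi_iff hgrowth hq x⟩⟩
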